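/- **Theorem (classification).** Let $m\ge 1$ be an integer and let $\alpha$ be a real number with $\alpha-2m+1>0$. Put $$2^*=\frac{2(\alpha+1)}{\alpha-2m+1},\qquad \Delta_\alpha u=u''+\frac{\alpha}{r}u',\qquad \nabla_\alpha^m u=\begin{cases}\Delta_\alpha^{k}u,& m=2k,\\ (\Delta_\alpha^{k}u)',& m=2k+1.\end{cases}$$ Let $AC^{m-1}_{loc}(0,\infty)$ be the set of functions $u\in C^{m-1}(0,\infty)$ such that $u^{(m-1)}$ is absolutely continuous on compact subintervals of $(0,\infty)$. Let $\mathcal D^{m,2}_\infty(\alpha)$ be the completion, for the norm $\big(\int_0^\infty |u^{(m)}|^2r^\alpha\,dr\big)^{1/2}$, of the set of all $u\in AC^{m-1}_{loc}(0,\infty)$ with $\lim_{r\to\infty}u^{(j)}(r)=0$ for $j=0,\dots,m-1$ and $\int_0^\infty |u^{(m)}|^2r^\alpha\,dr<\infty$. (For $\alpha-2m+1>0$ this set is already complete, so $\mathcal D^{m,2}_\infty(\alpha)$ is this set of functions.) Let $v\in\mathcal D^{m,2}_\infty(\alpha)$ with $v>0$ on $(0,\infty)$ be a solution of $$(-\Delta_\alpha)^m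 v=|v|^{2^*-2}v\quad\text{in }(0,\infty),$$ either in the weak sense, that is, $$\int_0^\infty \nabla_\alpha^m v\,\nabla_\alpha^m\varphi\, r^\alpha\,dr=\int_0^\infty |v|^{2^*-2}v\,\varphi\, r^\alpha\,dr\qquad\text{for all }\varphi\in\mathcal D^{m,2}_\infty(\alpha),$$ or in the classical sense, that is, $v\in C^{2m}(0,\infty)$ and the equation holds at every $r>0$. Suppose that $v$ is $(2m-1)$-th nonsingular at $r=0$, i.e. for every $0\le i\le 2m-1$ the limit $v^{(i)}(0):=\lim_{r\to0^+}v^{(i)}(r)$ exists and is finite, and that $v^{(i)}(0)=0$ for $i=1,3,\dots,2m-1$. Then there is $\epsilon>0$ such that for all $r>0$ $$v(r)=w_\epsilon(r):=\mathcal P^{\frac{\alpha-2m+1}{4m}}\left(\frac{\epsilon}{\epsilon^2+r^2}\right)^{\frac{\alpha-2m+1}{2}},\qquad \mathcal P=\prod_{h=-m}^{m-1}(\alpha+1+2h).$$ -/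

import Mathlib

open Set Filter Topology MeasureTheory

namespace GenRadial

/-- `u ∈ AC^ℓ_loc(0,∞)`: the derivatives `u, u', …, u^(ℓ)` exist on `(0,∞)`, are continuous there,
and `u^(ℓ)` is absolutely continuous on every compact interval `[a,b] ⊂ (0,∞)`.
Only the values of `u` on `(0,∞)` matter. -/
def ACLoc (ℓ : ℕ) (u : ℝ → ℝ) : Prop :=
  ContDiffOn ℝ ℓ u (Ioi 0) ∧
    ∀ a b : ℝ, 0 < a → a ≤ b → AbsolutelyContinuousOnInterval (iteratedDeriv ℓ u) a b

/-- `u ∈ 𝒟^{m,2}_∞(α)`, for `m ≥ 1` and `α > 2m - 1`: `u ∈ AC^{m-1}_loc(0,∞)`, the derivatives of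
order `0, …, m-1` tend to `0` at infinity, and `∫₀^∞ |u^(m)|² r^α dr < ∞`.
(The weak derivative `u^(m)` is the almost everywhere derivative of `u^(m-1)`.)
The space `𝒟^{m,2}_∞(α)` is the completion of this set of functions for the norm
`(∫₀^∞ |u^(m)|² r^α dr)^{1/2}`; the set is already complete (see `memD_complete` below), hence
is the completion. -/
def MemD (m : ℕ) (α : ℝ) (u : ℝ → ℝ) : Prop :=
  ACLoc (m - 1) u ∧
  (∀ j : ℕ, j ≤ m - 1 → Tendsto (iteratedDeriv j u) atTop (𝓝 0)) ∧
  IntegrableOn (fun r : ℝ => iteratedDeriv m u r ^ 2 * r ^ α) (Ioi 0)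

/-- The generalized radial Laplacian `Δ_α u = u'' + (α / r) u'`. -/
noncomputable def lap (α : ℝ) (u : ℝ → ℝ) : ℝ → ℝ :=
  fun r => deriv (deriv u) r + α / r * deriv u r

/-- `∇^m_α u`: it is `Δ_α^k u` if `m = 2k`, and `(Δ_α^k u)'` if `m = 2k + 1`. -/
noncomputable def grad (m : ℕ) (α : ℝ) (u : ℝ → ℝ) : ℝ → ℝ :=
  if Even m then (lap α)^[m / 2] u else deriv ((lap α)^[m / 2] u)

/-- The polyharmonic operator `(-Δ_α)^m`. -/
noncomputable def polyharmonic (m : ℕ) (α : ℝ) (u : ℝ → ℝ) : ℝ → ℝ :=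
  (fun w : ℝ → ℝ => fun r => -lap α w r)^[m] u

/-- The critical exponent `2^* = 2(α+1)/(α-2m+1)`. -/
noncomputable def critExp (m : ℕ) (α : ℝ) : ℝ := 2 * (α + 1) / (α - 2 * m + 1)

/-- Weak solutions of `(-Δ_α)^m u = |u|^{2^*-2} u` in `(0,∞)`, for `u ∈ 𝒟^{m,2}_∞(α)`. -/
def IsWeakSolution (m : ℕ) (α : ℝ) (u : ℝ → ℝ) : Prop :=
  ∀ φ : ℝ → ℝ, MemD m α φ →
    ∫ r in Ioi (0 : ℝ), grad m α u r * grad m α φ r * r ^ α =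
      ∫ r in Ioi (0 : ℝ), |u r| ^ (critExp m α - 2) * u r * φ r * r ^ α

/-- Classical solutions of `(-Δ_α)^m u = |u|^{2^*-2} u` in `(0,∞)`. -/
def IsClassicalSolution (m : ℕ) (α : ℝ) (u : ℝ → ℝ) : Prop :=
  ContDiffOn ℝ (2 * m : ℕ) u (Ioi 0) ∧
    ∀ r : ℝ, 0 < r → polyharmonic m α u r = |u r| ^ (critExp m α - 2) * u r

/-- `u` is `ℓ`-th nonsingular at `r = 0`: the limits `u^(i)(0) := lim_{r → 0⁺} u^(i)(r)`,
`0 ≤ i ≤ ℓ`, exist and are finite. -/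
def Nonsingular (ℓ : ℕ) (u : ℝ → ℝ) : Prop :=
  ∀ i : ℕ, i ≤ ℓ → ∃ L : ℝ, Tendsto (iteratedDeriv i u) (𝓝[>] 0) (𝓝 L)

/-- `𝒫(α, m) = ∏_{h = -m}^{m-1} (α + 1 + 2h)`. -/
noncomputable def constP (m : ℕ) (α : ℝ) : ℝ :=
  ∏ h ∈ Finset.Ico (-(m : ℤ)) (m : ℤ), (α + 1 + 2 * (h : ℝ))

/-- `w_ε(r) = 𝒫^{(α-2m+1)/(4m)} (ε / (ε² + r²))^{(α-2m+1)/2}`. -/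
noncomputable def bubble (m : ℕ) (α ε : ℝ) (r : ℝ) : ℝ :=
  constP m α ^ ((α - 2 * m + 1) / (4 * m)) *
    (ε / (ε ^ 2 + r ^ 2)) ^ ((α - 2 * m + 1) / 2)

/-- Integration from infinity of a continuous function with power decay. -/
theorem primitive_aux {h : ℝ → ℝ} {s C : ℝ} (hs : 0 < s) (hc : ContinuousOn h (Ioi 0))
    (hb : ∀ r : ℝ, 1 ≤ r → |h r| ≤ C * r ^ (-(s + 1))) :
    ∃ g : ℝ → ℝ, (∀ r : ℝ, 0 < r → HasDerivAt g (h r) r) ∧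
      ∀ r : ℝ, 1 ≤ r → |g r| ≤ (C / s) * r ^ (-s) := by
  have hint1 : ∀ a : ℝ, 1 ≤ a → IntegrableOn h (Ioi a) := by
    intro a ha
    have h1 : IntegrableOn (fun t : ℝ => C * t ^ (-(s + 1))) (Ioi a) :=
      (integrableOn_Ioi_rpow_of_lt (by linarith) (by linarith)).const_mul C
    refine Integrable.mono' h1 ?_ ?_
    · exact (hc.mono fun x hx => lt_trans (by linarith) (mem_Ioi.1 hx)).aestronglyMeasurable
        measurableSet_Ioi
    · filter_upwards [ae_restrict_mem measurableSet_Ioi] with t ht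
      exact hb t (ha.trans (le_of_lt ht))
  have hint : ∀ a b : ℝ, 0 < a → 0 < b → IntervalIntegrable h volume a b := by
    intro a b ha hb
    refine (hc.mono ?_).intervalIntegrable
    intro x hx
    exact lt_of_lt_of_le (lt_min ha hb) hx.1
  refine ⟨fun r => (∫ t in (1 : ℝ)..r, h t) - ∫ t in Ioi (1 : ℝ), h t, ?_, ?_⟩
  · intro r hr
    have hca : ContinuousAt h r := hc.continuousAt (Ioi_mem_nhds hr)
    exact (intervalIntegral.integral_hasDerivAt_right (hint 1 r one_pos hr)
      (hc.stronglyMeasurableAtFilter isOpen_Ioi r hr) hca).sub_const _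
  · intro r hr
    have hr0 : 0 < r := by linarith
    have e : (∫ t in (1 : ℝ)..r, h t) - ∫ t in Ioi (1 : ℝ), h t = -∫ t in Ioi r, h t := by
      have := intervalIntegral.integral_interval_add_Ioi (hint1 1 le_rfl) (hint1 r hr)
      linarith
    show |(∫ t in (1 : ℝ)..r, h t) - ∫ t in Ioi (1 : ℝ), h t| ≤ (C / s) * r ^ (-s)
    rw [e, abs_neg]
    have h1 : IntegrableOn (fun t : ℝ => C * t ^ (-(s + 1))) (Ioi r) :=
      (integrableOn_Ioi_rpow_of_lt (by linarith) hr0).const_mul C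
    calc |∫ t in Ioi r, h t| ≤ ∫ t in Ioi r, C * t ^ (-(s + 1)) := by
          refine norm_integral_le_of_norm_le (f := h) h1 ?_
          filter_upwards [ae_restrict_mem measurableSet_Ioi] with t ht
          exact hb t (hr.trans (le_of_lt ht))
      _ = (C / s) * r ^ (-s) := by
          rw [integral_const_mul, integral_Ioi_rpow_of_lt (by linarith) hr0]
          have : -(s + 1) + 1 = -s := by ring
          rw [this]
          field_simp

theorem ac_congr {f g : ℝ → ℝ} {a b : ℝ} (hf : AbsolutelyContinuousOnInterval f a b)
    (hfg : ∀ x ∈ uIcc a b, f x = g x) : AbsolutelyContinuousOnInterval g a b := by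
  rw [absolutelyContinuousOnInterval_iff] at hf ⊢
  intro ε hε
  obtain ⟨δ, hδ, H⟩ := hf ε hε
  refine ⟨δ, hδ, fun E hE hlen => ?_⟩
  refine lt_of_eq_of_lt (Finset.sum_congr rfl fun i hi => ?_) (H E hE hlen)
  rw [hfg _ (hE.1 i hi).1, hfg _ (hE.1 i hi).2]

theorem iterated_primitive_aux (n : ℕ) : ∀ (s C : ℝ) (h : ℝ → ℝ), 0 < s →
    ContinuousOn h (Ioi 0) → (∀ r : ℝ, 1 ≤ r → |h r| ≤ C * r ^ (-(s + n))) →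
    ∃ u : ℝ → ℝ, ∃ C' : ℝ, ContDiffOn ℝ n u (Ioi 0) ∧
      (∀ r : ℝ, 0 < r → iteratedDeriv n u r = h r) ∧
      (∀ j : ℕ, j ≤ n → Tendsto (iteratedDeriv j u) atTop (𝓝 0)) ∧
      ∀ r : ℝ, 1 ≤ r → |u r| ≤ C' * r ^ (-s) := by
  have key : ∀ (s C : ℝ) (u : ℝ → ℝ), 0 < s → (∀ r : ℝ, 1 ≤ r → |u r| ≤ C * r ^ (-s)) →
      Tendsto u atTop (𝓝 0) := by
    intro s C u hs hu
    have h1 : Tendsto (fun r : ℝ => C * r ^ (-s)) atTop (𝓝 0) := by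
      simpa using (tendsto_rpow_neg_atTop hs).const_mul C
    refine squeeze_zero_norm' ?_ h1
    filter_upwards [eventually_ge_atTop 1] with r hr using hu r hr
  induction n with
  | zero =>
    intro s C h hs hc hb
    refine ⟨h, C, by simpa using (contDiffOn_zero (𝕜 := ℝ)).2 hc, by simp, ?_, by simpa using hb⟩
    intro j hj
    obtain rfl : j = 0 := by omega
    simpa using key s C h hs (by simpa using hb)
  | succ n ih =>
    intro s C h hs hc hb
    obtain ⟨u', C', h1, h2, h3, h4⟩ := ih (s + 1) C h (by linarith) hc (by
      intro r hr
      have := hb r hr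
      push_cast at this
      rwa [show s + 1 + (n : ℝ) = s + (n + 1) by ring])
    obtain ⟨u, hu1, hu2⟩ := primitive_aux hs h1.continuousOn h4
    have hd : ∀ r : ℝ, 0 < r → deriv u r = u' r := fun r hr => (hu1 r hr).deriv
    have hloc : ∀ (j : ℕ) (r : ℝ), 0 < r → iteratedDeriv (j + 1) u r = iteratedDeriv j u' r := by
      intro j r hr
      rw [iteratedDeriv_succ']
      have : deriv u =ᶠ[𝓝 r] u' := by
        filter_upwards [Ioi_mem_nhds hr] with x hx using hd x hx
      exact this.iteratedDeriv_eq j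
    refine ⟨u, C' / s, ?_, ?_, ?_, hu2⟩
    · push_cast
      rw [contDiffOn_succ_iff_deriv_of_isOpen isOpen_Ioi]
      refine ⟨fun r hr => (hu1 r hr).differentiableAt.differentiableWithinAt, by simp, ?_⟩
      exact h1.congr fun r hr => hd r hr
    · intro r hr
      rw [hloc n r hr, h2 r hr]
    · intro j hj
      rcases j with _ | j
      · simpa using key s _ u hs hu2
      · refine (h3 j (by omega)).congr' ?_
        filter_upwards [eventually_gt_atTop 0] with r hr using (hloc j r hr).symm

/-- Every `f ∈ L²_α` is the `m`-th derivative of an element of `𝒟^{m,2}_∞(α)`. -/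
theorem exists_memD {m : ℕ} {α : ℝ} (hm : 1 ≤ m) (hα : 2 * (m : ℝ) - 1 < α) {f : ℝ → ℝ}
    (hf : AEStronglyMeasurable f (volume.restrict (Ioi 0)))
    (hf2 : IntegrableOn (fun r : ℝ => f r ^ 2 * r ^ α) (Ioi 0)) :
    ∃ u : ℝ → ℝ, MemD m α u ∧
      ∀ᵐ r ∂(volume.restrict (Ioi (0 : ℝ))), iteratedDeriv m u r = f r := by
  obtain ⟨n, rfl⟩ : ∃ n, m = n + 1 := ⟨m - 1, by omega⟩
  push_cast at hα
  obtain ⟨s, hs0, hs⟩ : ∃ s : ℝ, 0 < s ∧ 2 * (s + n) - α < -1 :=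
    ⟨(α - 2 * n - 1) / 4, by linarith, by linarith⟩
  have hsn : 0 ≤ s + n := by positivity
  -- weighted integrability near infinity
  have hI : ∀ a : ℝ, 0 < a → IntegrableOn (fun t => |f t| * t ^ (s + n)) (Ioi a) := by
    intro a ha
    have hsub : Ioi a ⊆ Ioi (0 : ℝ) := Ioi_subset_Ioi ha.le
    have h1 := (hf2.mono_set hsub).add (integrableOn_Ioi_rpow_of_lt hs ha)
    refine Integrable.mono' h1 ?_ ?_
    · refine AEStronglyMeasurable.mul ?_ ?_
      · simpa using (hf.mono_measure (Measure.restrict_mono hsub le_rfl)).norm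
      · exact (Measurable.pow_const measurable_id _).aestronglyMeasurable
    · filter_upwards [ae_restrict_mem measurableSet_Ioi] with t ht
      have ht0 : 0 < t := ha.trans ht
      rw [Real.norm_of_nonneg (by positivity)]
      set p := t ^ (α / 2) with hp
      set q := t ^ (s + n - α / 2) with hq
      have hp2 : t ^ α = p ^ 2 := by
        rw [hp, ← Real.rpow_natCast, ← Real.rpow_mul ht0.le]; congr 1; push_cast; ring
      have hq2 : t ^ (2 * (s + n) - α) = q ^ 2 := by
        rw [hq, ← Real.rpow_natCast, ← Real.rpow_mul ht0.le]; congr 1; push_cast; ring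
      have hpq : t ^ (s + n) = p * q := by
        rw [hp, hq, ← Real.rpow_add ht0]; congr 1; ring
      simp only [Pi.add_apply]
      rw [hp2, hq2, hpq, ← sq_abs (f t)]
      have hpp : 0 < p := Real.rpow_pos_of_pos ht0 _
      have hqq : 0 < q := Real.rpow_pos_of_pos ht0 _
      nlinarith [sq_nonneg (|f t| * p - q), abs_nonneg (f t), mul_pos hpp hqq,
        mul_nonneg (abs_nonneg (f t)) (mul_pos hpp hqq).le]
  have hfa : ∀ a : ℝ, 0 < a → IntegrableOn f (Ioi a) := by
    intro a ha
    have hsub : Ioi a ⊆ Ioi (0 : ℝ) := Ioi_subset_Ioi ha.le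
    refine Integrable.mono' ((hI a ha).const_mul (a ^ (-(s + n))))
      (hf.mono_measure (Measure.restrict_mono hsub le_rfl)) ?_
    filter_upwards [ae_restrict_mem measurableSet_Ioi] with t ht
    have h1 : a ^ (s + n) ≤ t ^ (s + n) := Real.rpow_le_rpow ha.le (le_of_lt ht) hsn
    have h2 : 0 < a ^ (s + n) := Real.rpow_pos_of_pos ha _
    rw [Real.norm_eq_abs, Real.rpow_neg ha.le, inv_mul_eq_div, le_div_iff₀ h2]
    exact mul_le_mul_of_nonneg_left h1 (abs_nonneg _)
  have hint : ∀ a b : ℝ, 0 < a → 0 < b → IntervalIntegrable f volume a b := by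
    intro a b ha hb
    rw [intervalIntegrable_iff]
    refine (hfa (min a b / 2) (by positivity)).mono_set ?_
    intro x hx
    have : min a b < x := hx.1
    have h0 : 0 < min a b := lt_min ha hb
    exact mem_Ioi.2 (by linarith)
  set h : ℝ → ℝ := fun r => (∫ t in (1 : ℝ)..r, f t) - ∫ t in Ioi (1 : ℝ), f t with hh
  have hAC : ∀ a b : ℝ, 0 < a → a ≤ b → AbsolutelyContinuousOnInterval h a b := by
    intro a b ha hab
    have hb : 0 < b := ha.trans_le hab
    have h1 := (hint a b ha hb).absolutelyContinuousOnInterval_intervalIntegral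
      (c := a) left_mem_uIcc
    have h2 : AbsolutelyContinuousOnInterval
        (fun _ : ℝ => (∫ t in (1 : ℝ)..a, f t) - ∫ t in Ioi (1 : ℝ), f t) a b :=
      ((LipschitzWith.const (α := ℝ) _).lipschitzOnWith).absolutelyContinuousOnInterval
    refine ac_congr (h1.add h2) ?_
    intro x hx
    rw [uIcc_of_le hab] at hx
    have := intervalIntegral.integral_add_adjacent_intervals (hint 1 a one_pos ha)
      (hint a x ha (ha.trans_le hx.1))
    simp only [hh, Pi.add_apply]
    linarith
  have hcont : ContinuousOn h (Ioi 0) := by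
    intro x hx
    have hx' : 0 < x := hx
    have h1 := (hAC (x / 2) (2 * x) (by linarith) (by linarith)).continuousOn
    rw [uIcc_of_le (by linarith)] at h1
    exact (h1.continuousAt (Icc_mem_nhds (by linarith) (by linarith))).continuousWithinAt
  obtain ⟨u, -, h1, h2, h3, -⟩ := iterated_primitive_aux n s
    (∫ t in Ioi (1 : ℝ), |f t| * t ^ (s + n)) h hs0 hcont (by
      intro r hr
      have hr0 : 0 < r := by linarith
      have e : h r = -∫ t in Ioi r, f t := by
        have := intervalIntegral.integral_interval_add_Ioi (hfa 1 one_pos) (hfa r hr0)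
        simp only [hh]
        linarith
      have hrp : 0 < r ^ (s + n) := Real.rpow_pos_of_pos hr0 _
      rw [e, abs_neg, Real.rpow_neg hr0.le, ← div_eq_mul_inv, le_div_iff₀ hrp]
      calc |∫ t in Ioi r, f t| * r ^ (s + n) ≤ (∫ t in Ioi r, |f t|) * r ^ (s + n) :=
            mul_le_mul_of_nonneg_right (norm_integral_le_integral_norm f) hrp.le
        _ = ∫ t in Ioi r, |f t| * r ^ (s + n) := (integral_mul_const _ _).symm
        _ ≤ ∫ t in Ioi r, |f t| * t ^ (s + n) := by
            refine setIntegral_mono_on ((hfa r hr0).norm.mul_const _) (hI r hr0)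
              measurableSet_Ioi ?_
            intro t ht
            exact mul_le_mul_of_nonneg_left
              (Real.rpow_le_rpow hr0.le (le_of_lt ht) hsn) (abs_nonneg _)
        _ ≤ ∫ t in Ioi (1 : ℝ), |f t| * t ^ (s + n) := by
            refine setIntegral_mono_set (hI 1 one_pos) ?_
              (Ioi_subset_Ioi hr).eventuallyLE
            filter_upwards [ae_restrict_mem measurableSet_Ioi] with t ht
            have : 0 < t := one_pos.trans ht
            simp only [Pi.zero_apply]
            positivity)
  have hae : ∀ᵐ r ∂(volume.restrict (Ioi (0 : ℝ))), iteratedDeriv (n + 1) u r = f r := by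
    have hd : ∀ k : ℕ, ∀ᵐ r : ℝ, r ∈ Ioo (1 / ((k : ℝ) + 1)) ((k : ℝ) + 1) →
        iteratedDeriv (n + 1) u r = f r := by
      intro k
      have hk : (0 : ℝ) < 1 / ((k : ℝ) + 1) := by positivity
      have hk1 : (0 : ℝ) < (k : ℝ) + 1 := by positivity
      have := (hint _ _ hk hk1).ae_hasDerivAt_integral
      filter_upwards [this] with r hr hrk
      have hr0 : 0 < r := hk.trans hrk.1
      have h4 := hr (Ioo_subset_Icc_self.trans Icc_subset_uIcc hrk) _ left_mem_uIcc
      have h5 : HasDerivAt h (f r) r := by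
        have h6 := h4.add_const ((∫ t in (1 : ℝ)..(1 / ((k : ℝ) + 1)), f t)
          - ∫ t in Ioi (1 : ℝ), f t)
        refine h6.congr_of_eventuallyEq ?_
        filter_upwards [Ioi_mem_nhds hr0] with x hx
        have := intervalIntegral.integral_add_adjacent_intervals (hint 1 _ one_pos hk)
          (hint _ x hk hx)
        simp only [hh]
        linarith
      rw [iteratedDeriv_succ]
      have h7 : iteratedDeriv n u =ᶠ[𝓝 r] h := by
        filter_upwards [Ioi_mem_nhds hr0] with x hx using h2 x hx
      rw [h7.deriv_eq, h5.deriv]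
    rw [ae_restrict_iff' measurableSet_Ioi]
    filter_upwards [ae_all_iff.2 hd] with r hr hr0
    have hr0' : (0 : ℝ) < r := hr0
    obtain ⟨k, hk⟩ := exists_nat_gt (max r (1 / r))
    refine hr k ⟨?_, ?_⟩
    · rw [div_lt_comm₀ (by positivity) hr0']
      linarith [(le_max_right r (1 / r)).trans_lt hk]
    · linarith [(le_max_left r (1 / r)).trans_lt hk]
  refine ⟨u, ⟨⟨by simpa using h1, ?_⟩, by simpa using h3, ?_⟩, hae⟩
  · intro a b ha hab
    refine ac_congr (hAC a b ha hab) ?_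
    intro x hx
    rw [uIcc_of_le hab] at hx
    simpa using (h2 x (ha.trans_le hx.1)).symm
  · refine Integrable.congr hf2 ?_
    filter_upwards [hae] with r hr
    rw [hr]

/-- The norm `(∫₀^∞ |u^(m)|² r^α dr)^{1/2}` is complete on the functions satisfying `MemD m α`. -/
theorem memD_complete {m : ℕ} {α : ℝ} (hm : 1 ≤ m) (hα : 2 * (m : ℝ) - 1 < α)
    (u : ℕ → ℝ → ℝ) (hu : ∀ n, MemD m α (u n))
    (hC : ∀ ε : ℝ, 0 < ε → ∃ N : ℕ, ∀ n, N ≤ n → ∀ k, N ≤ k →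
      ∫ r in Ioi (0 : ℝ), (iteratedDeriv m (u n) r - iteratedDeriv m (u k) r) ^ 2 * r ^ α < ε) :
    ∃ v : ℝ → ℝ, MemD m α v ∧
      Tendsto (fun n => ∫ r in Ioi (0 : ℝ),
        (iteratedDeriv m (u n) r - iteratedDeriv m v r) ^ 2 * r ^ α) atTop (𝓝 0) := by
  set μ := volume.restrict (Ioi (0 : ℝ)) with hμ
  have hmeas : ∀ w : ℝ → ℝ, Measurable (iteratedDeriv m w) := by
    intro w
    obtain ⟨n, rfl⟩ : ∃ n, m = n + 1 := ⟨m - 1, by omega⟩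
    rw [iteratedDeriv_succ]
    exact measurable_deriv _
  have hsq : ∀ (x r : ℝ), 0 < r → (x * r ^ (α / 2)) ^ 2 = x ^ 2 * r ^ α := by
    intro x r hr
    rw [mul_pow, ← Real.rpow_natCast (r ^ (α / 2)), ← Real.rpow_mul hr.le]
    congr 2; push_cast; ring
  set G : ℕ → ℝ → ℝ := fun n r => iteratedDeriv m (u n) r * r ^ (α / 2) with hG
  have hGL : ∀ n, MemLp (G n) 2 μ := by
    intro n
    have hm' : AEStronglyMeasurable (G n) μ :=
      ((hmeas _).mul (Measurable.pow_const measurable_id (α / 2))).aestronglyMeasurable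
    rw [memLp_two_iff_integrable_sq hm']
    refine Integrable.congr (hu n).2.2 ?_
    filter_upwards [ae_restrict_mem measurableSet_Ioi] with r hr
    exact (hsq _ r hr).symm
  have hnorm : ∀ F : Lp ℝ 2 μ, ‖F‖ ^ 2 = ∫ r, F r ^ 2 ∂μ := by
    intro F
    rw [← real_inner_self_eq_norm_sq, L2.inner_def]
    refine integral_congr_ae (Eventually.of_forall fun r => ?_)
    simp [sq]
  have hcs : CauchySeq fun n => (hGL n).toLp (G n) := by
    rw [Metric.cauchySeq_iff]
    intro ε hε
    obtain ⟨N, hN⟩ := hC (ε ^ 2) (by positivity)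
    refine ⟨N, fun n hn k hk => ?_⟩
    refine lt_of_pow_lt_pow_left₀ 2 hε.le ?_
    rw [dist_eq_norm, hnorm]
    refine lt_of_eq_of_lt ?_ (hN n hn k hk)
    refine integral_congr_ae ?_
    filter_upwards [ae_restrict_mem measurableSet_Ioi, (hGL n).coeFn_toLp, (hGL k).coeFn_toLp,
      Lp.coeFn_sub ((hGL n).toLp (G n)) ((hGL k).toLp (G k))] with r hr h1 h2 h3
    rw [h3, Pi.sub_apply, h1, h2, ← hsq _ r hr]
    simp only [hG]
    ring
  obtain ⟨F, hF⟩ := cauchySeq_tendsto_of_complete hcs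
  have hFL : MemLp F 2 μ := Lp.memLp F
  have hrp : ∀ r : ℝ, 0 < r → r ^ (-(α / 2)) * r ^ (α / 2) = 1 := by
    intro r hr
    rw [← Real.rpow_add hr]; simp
  obtain ⟨v, hv, hvF⟩ := exists_memD hm hα (f := fun r => F r * r ^ (-(α / 2)))
    (hFL.1.mul (Measurable.pow_const measurable_id _).aestronglyMeasurable) (by
      refine Integrable.congr ((memLp_two_iff_integrable_sq hFL.1).1 hFL) ?_
      filter_upwards [ae_restrict_mem measurableSet_Ioi] with r hr
      rw [← hsq _ r hr, mul_assoc, hrp r hr, mul_one])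
  refine ⟨v, hv, ?_⟩
  have h1 : Tendsto (fun n => ‖(hGL n).toLp (G n) - F‖ ^ 2) atTop (𝓝 0) := by
    have := (tendsto_iff_norm_sub_tendsto_zero.1 hF).pow 2
    simpa using this
  refine h1.congr fun n => ?_
  rw [hnorm]
  refine integral_congr_ae ?_
  filter_upwards [ae_restrict_mem measurableSet_Ioi, (hGL n).coeFn_toLp, hvF,
    Lp.coeFn_sub ((hGL n).toLp (G n)) F] with r hr h1 h2 h3
  rw [h3, Pi.sub_apply, h1, h2, ← hsq _ r hr]
  have h4 := hrp r hr
  simp only [hG]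
  rw [sub_mul, mul_assoc (F r), h4, mul_one]

end GenRadial

/-!
The solution is a Riesz potential of its own power, and positive solutions of the resulting integral
equation are found by the method of moving planes, although the dimension `N = α + 1` need not be
an integer.

Write `γ = (α + 1)/2 - m` and `p = 2^* - 1`, and regard a function of `r` as a radial function on
the space of dimension `N`. Singling out one plane `ℂ` of this space and keeping of the
remaining `N - 2` coordinates only their norm `z`, integration becomes integration over `ℂ × (0,∞)`
against `z^(α-2) dζ dz` (`spaceMeasure`), which makes sense for every real `α > 1`; this measure is
invariant under the isometries of the plane and has spherical coordinates, so Riesz potentials may be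
centered at any point of the plane.

*Integral equation.* The spherical averages `sphAvg` of the regularised Riesz kernels satisfy
`(-Δ_α)^m (|x - P|² + δ²)^(-γ) = 𝒫 δ^(2m) (|x - P|² + δ²)^(-(γ+2m))` (`lap_iterate_sphAvg`). Testing the
equation with them (`integral_mul_sphAvg`) is justified by Green's formula, where the boundary
terms at `0` vanish because the derivatives are bounded there and `α > 2m - 1`, and by the decay
`v = o(r^(-γ))` at infinity (`MemD.isLittleO`), which follows from the finite energy. As `δ → 0` the left
side is an approximate identity, and one obtains
`c v(|P|) = ∫ |P - q|^(-2γ) v(|q|)^p dq` for every `P` in the plane (`RadialProfile.representation`).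

*Moving planes.* In logarithmic polar coordinates `x₀ + e^t e^{ib}` around a point `x₀` of the axis, the
function `Φ(t, b) = e^{γ t} v` solves an integral equation on a cylinder, whose kernel depends
on `t` only through a difference. Inversions in spheres centered at `x₀` become reflections in `t`. For
`τ` near `-∞` the function lies, on `t < τ`, below its reflection in the section `t = τ`, by a maximum
principle in sets of small measure (`CylProfile.exists_small`), and since `Φ → 0` as `t → ∞` this cannot
persist for all `τ`; where it stops, `Φ` equals its reflection (`CylProfile.eq_reflection`,
`CylProfile.exists_symmetric`).

*Conclusion.* Thus `v` is symmetric under an inversion centered at each point `x₀` of the axis. If `r₀`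
maximizes `r^γ v(r)`, the radius of this inversion is `√(x₀² + r₀²)` (`RadialProfile.exists_inversion`).
It exchanges `x₀` and infinity, so `(x₀² + r₀²)^γ v(x₀) = lim r^(2γ) v(r)` is independent of `x₀`. This is the
profile of the bubble with `ε = r₀`, and the equation determines the multiplicative constant.
-/

namespace GenRadial

open scoped ENNReal

/-! ### Locally absolutely continuous functions on the half-line -/

/-- Absolute continuity on every compact subinterval of `(0,∞)`. -/
def LocAC (f : ℝ → ℝ) : Prop :=
  ∀ a b : ℝ, 0 < a → a ≤ b → AbsolutelyContinuousOnInterval f a b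

theorem uIcc_subset_Ioi {a b : ℝ} (ha : 0 < a) (hab : a ≤ b) : uIcc a b ⊆ Ioi 0 := by
  rw [uIcc_of_le hab]
  exact fun x hx => ha.trans_le hx.1

namespace LocAC

variable {f g : ℝ → ℝ}

theorem congr (hf : LocAC f) (h : EqOn f g (Ioi 0)) : LocAC g := fun a b ha hab =>
  ac_congr (hf a b ha hab) fun _ hx => h (uIcc_subset_Ioi ha hab hx)

theorem add (hf : LocAC f) (hg : LocAC g) : LocAC (fun s => f s + g s) :=
  fun a b ha hab => (hf a b ha hab).add (hg a b ha hab)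

theorem mul (hf : LocAC f) (hg : LocAC g) : LocAC (fun s => f s * g s) :=
  fun a b ha hab => (hf a b ha hab).mul (hg a b ha hab)

theorem of_contDiffOn (hf : ContDiffOn ℝ 1 f (Ioi 0)) : LocAC f := fun _ _ ha hab =>
  (hf.mono (uIcc_subset_Ioi ha hab)).absolutelyContinuousOnInterval

theorem continuousOn (hf : LocAC f) : ContinuousOn f (Ioi 0) := by
  intro x hx
  have hx' : 0 < x := hx
  have h1 := (hf (x / 2) (2 * x) (by linarith) (by linarith)).continuousOn
  rw [uIcc_of_le (by linarith)] at h1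
  exact (h1.continuousAt (Icc_mem_nhds (by linarith) (by linarith))).continuousWithinAt

theorem ae_differentiableAt (hf : LocAC f) : ∀ᵐ x : ℝ, 0 < x → DifferentiableAt ℝ f x := by
  have hd : ∀ k : ℕ, ∀ᵐ r : ℝ, r ∈ uIcc (1 / ((k : ℝ) + 1)) (1 / ((k : ℝ) + 1) + k) →
      DifferentiableAt ℝ f r := fun k =>
    (hf _ _ (by positivity) (by linarith [(Nat.cast_nonneg k : (0 : ℝ) ≤ k)])).ae_differentiableAt
  filter_upwards [ae_all_iff.2 hd] with r hr hr0
  obtain ⟨k, hk⟩ := exists_nat_gt (max r (1 / r))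
  refine hr k ?_
  rw [uIcc_of_le (by linarith [(Nat.cast_nonneg k : (0 : ℝ) ≤ k)])]
  have h1 : (1 : ℝ) / ((k : ℝ) + 1) ≤ r := by
    rw [div_le_comm₀ (by positivity) hr0]
    linarith [(le_max_right r (1 / r)).trans_lt hk]
  have h2 : (0 : ℝ) < 1 / ((k : ℝ) + 1) := by positivity
  exact ⟨h1, by linarith [(le_max_left r (1 / r)).trans_lt hk]⟩

theorem rpow (κ : ℝ) : LocAC (fun s : ℝ => s ^ κ) :=
  of_contDiffOn fun _ hx => (contDiffAt_id.rpow_const_of_ne (ne_of_gt hx)).contDiffWithinAt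

end LocAC

/-! ### Scales of growth, stable under differentiation -/

/-- A notion `B κ f` of "`f` is regular and of size `s ^ κ`" for families `f` of functions on
`(0,∞)`, compatible with the algebraic operations. -/
structure GrowthScale {ι : Type} (B : ℝ → (ι → ℝ → ℝ) → Prop) : Prop where
  congr : ∀ {κ f g}, B κ f → (∀ i, EqOn (f i) (g i) (Ioi 0)) → B κ g
  add : ∀ {κ f g}, B κ f → B κ g → B κ (fun i s => f i s + g i s)
  mul : ∀ {κ κ' f g}, B κ f → B κ' g → B (κ + κ') (fun i s => f i s * g i s)
  const : ∀ c : ℝ, B 0 (fun _ _ => c)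
  inv : B (-1) (fun _ s => s⁻¹)

/-- `Tower B n κ f`: the functions `f i` are `n` times differentiable on `(0,∞)`, and
`B (κ - j) f^(j)` holds for `j = 0, …, n`. -/
def Tower {ι : Type} (B : ℝ → (ι → ℝ → ℝ) → Prop) : ℕ → ℝ → (ι → ℝ → ℝ) → Prop
  | 0, κ, f => B κ f
  | n + 1, κ, f => (∀ i, DifferentiableOn ℝ (f i) (Ioi 0)) ∧ B κ f ∧
      Tower B n (κ - 1) (fun i => deriv (f i))

namespace Tower

variable {ι : Type} {B : ℝ → (ι → ℝ → ℝ) → Prop} {n : ℕ} {κ κ' : ℝ} {f g : ι → ℝ → ℝ}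

theorem base (h : Tower B n κ f) : B κ f := by
  cases n with
  | zero => exact h
  | succ n => exact h.2.1

theorem pred : ∀ {n : ℕ} {κ : ℝ} {f : ι → ℝ → ℝ}, Tower B (n + 1) κ f → Tower B n κ f
  | 0, _, _, h => h.2.1
  | _ + 1, _, _, h => ⟨h.1, h.2.1, pred h.2.2⟩

theorem mono {n' : ℕ} (hn : n' ≤ n) (h : Tower B n κ f) : Tower B n' κ f := by
  induction n, hn using Nat.le_induction with
  | base => exact h
  | succ k _ ih => exact ih h.pred

theorem congr (hB : GrowthScale B) : ∀ {n : ℕ} {κ : ℝ} {f g : ι → ℝ → ℝ}, Tower B n κ f →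
    (∀ i, EqOn (f i) (g i) (Ioi 0)) → Tower B n κ g
  | 0, _, _, _, h, e => hB.congr h e
  | _ + 1, _, _, _, h, e => ⟨fun i => (h.1 i).congr fun _ hx => (e i hx).symm, hB.congr h.2.1 e,
      congr hB h.2.2 fun i _ hx => ((e i).eventuallyEq_of_mem (Ioi_mem_nhds hx)).deriv_eq⟩

theorem add (hB : GrowthScale B) : ∀ {n : ℕ} {κ : ℝ} {f g : ι → ℝ → ℝ}, Tower B n κ f →
    Tower B n κ g → Tower B n κ (fun i s => f i s + g i s)
  | 0, _, _, _, hf, hg => hB.add hf hg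
  | _ + 1, _, _, _, hf, hg => ⟨fun i => (hf.1 i).add (hg.1 i), hB.add hf.2.1 hg.2.1,
      (add hB hf.2.2 hg.2.2).congr hB fun i _ hx =>
        (deriv_fun_add ((hf.1 i).differentiableAt (Ioi_mem_nhds hx))
          ((hg.1 i).differentiableAt (Ioi_mem_nhds hx))).symm⟩

theorem mul (hB : GrowthScale B) : ∀ {n : ℕ} {κ κ' : ℝ} {f g : ι → ℝ → ℝ}, Tower B n κ f →
    Tower B n κ' g → Tower B n (κ + κ') (fun i s => f i s * g i s)
  | 0, _, _, _, _, hf, hg => hB.mul hf hg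
  | n + 1, κ, κ', f, g, hf, hg => by
      refine ⟨fun i => (hf.1 i).mul (hg.1 i), hB.mul hf.2.1 hg.2.1, ?_⟩
      have h1 := mul hB hf.2.2 hg.pred
      have h2 := mul hB hf.pred hg.2.2
      rw [show κ - 1 + κ' = κ + κ' - 1 by ring] at h1
      rw [show κ + (κ' - 1) = κ + κ' - 1 by ring] at h2
      exact (add hB h1 h2).congr hB fun i _ hx =>
        (deriv_fun_mul ((hf.1 i).differentiableAt (Ioi_mem_nhds hx))
          ((hg.1 i).differentiableAt (Ioi_mem_nhds hx))).symm

end Tower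

theorem GrowthScale.const_mul {ι : Type} {B : ℝ → (ι → ℝ → ℝ) → Prop} (hB : GrowthScale B)
    {κ : ℝ} {f : ι → ℝ → ℝ} (h : B κ f) (c : ℝ) : B κ (fun i s => c * f i s) := by
  have := hB.mul (hB.const c) h
  rwa [zero_add] at this

namespace Tower

variable {ι : Type} {B : ℝ → (ι → ℝ → ℝ) → Prop} {n : ℕ} {κ κ' : ℝ} {f g : ι → ℝ → ℝ}

theorem const_mul (hB : GrowthScale B) (c : ℝ) : ∀ {n : ℕ} {κ : ℝ} {f : ι → ℝ → ℝ},
    Tower B n κ f → Tower B n κ (fun i s => c * f i s)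
  | 0, _, _, h => hB.const_mul h c
  | _ + 1, _, _, h => ⟨fun i => (h.1 i).const_mul c, hB.const_mul h.2.1 c,
      (const_mul hB c h.2.2).congr hB fun _ _ _ => (deriv_const_mul_field c).symm⟩

theorem inv_pow (hB : GrowthScale B) : ∀ (n k : ℕ),
    Tower B n (-(k : ℝ)) (fun (_ : ι) s => (s⁻¹) ^ k) := by
  have h0 : ∀ k : ℕ, B (-(k : ℝ)) (fun (_ : ι) s => (s⁻¹) ^ k) := by
    intro k
    induction k with
    | zero => simpa using hB.const 1
    | succ k ih =>
      have := hB.mul ih hB.inv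
      refine hB.congr (f := fun (_ : ι) s => (s⁻¹) ^ k * s⁻¹) ?_ fun i s _ => by
        simp only [pow_succ]
      rwa [show -((k + 1 : ℕ) : ℝ) = -(k : ℝ) + -1 by push_cast; ring]
  intro n
  induction n with
  | zero => exact h0
  | succ n ih =>
    intro k
    have hd : ∀ s : ℝ, 0 < s → HasDerivAt (fun s : ℝ => (s⁻¹) ^ k)
        (-(k : ℝ) * (s⁻¹) ^ (k + 1)) s := by
      intro s hs
      have h := (hasDerivAt_inv hs.ne').fun_pow k
      convert! h using 1
      rcases k with _ | k
      · simp
      · rw [Nat.add_sub_cancel, ← _root_.inv_pow]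
        ring
    refine ⟨fun _ s hs => (hd s hs).differentiableAt.differentiableWithinAt, h0 k, ?_⟩
    have h1 := const_mul hB (-(k : ℝ)) (ih (k + 1))
    rw [show -((k + 1 : ℕ) : ℝ) = -(k : ℝ) - 1 by push_cast; ring] at h1
    exact h1.congr hB fun _ s hs => (hd s hs).deriv.symm

theorem lap (hB : GrowthScale B) (α : ℝ) (h : Tower B (n + 2) κ f) :
    Tower B n (κ - 2) (fun i => lap α (f i)) := by
  have h1 : Tower B n (κ - 1 - 1) (fun i => deriv (deriv (f i))) := h.2.2.2.2
  have h2 := const_mul hB α (mul hB (inv_pow (ι := ι) hB n 1) h.2.2.pred)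
  rw [show κ - 1 - 1 = κ - 2 by ring] at h1
  rw [show -((1 : ℕ) : ℝ) + (κ - 1) = κ - 2 by push_cast; ring] at h2
  refine (add hB h1 h2).congr hB fun i s _ => ?_
  simp only [GenRadial.lap, pow_one]
  ring

theorem lap_iterate (hB : GrowthScale B) (α : ℝ) (k : ℕ) : ∀ {n : ℕ} {κ : ℝ} {f : ι → ℝ → ℝ},
    Tower B (n + 2 * k) κ f → Tower B n (κ - 2 * k) (fun i => (GenRadial.lap α)^[k] (f i)) := by
  induction k with
  | zero => intro n κ f h; simpa using h
  | succ k ih =>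
    intro n κ f h
    have h1 := ih (h.lap (n := n + 2 * k) hB α)
    rw [show κ - 2 - 2 * (k : ℝ) = κ - 2 * ((k + 1 : ℕ) : ℝ) by push_cast; ring] at h1
    exact h1

end Tower

/-- Uniform size `s ^ κ` on the set `S`. -/
def PowBound {ι : Type} (S : Set ℝ) (κ : ℝ) (f : ι → ℝ → ℝ) : Prop :=
  ∃ C : ℝ, ∀ i, ∀ s ∈ S, |f i s| ≤ C * s ^ κ

theorem growthScale_powBound {ι : Type} {S : Set ℝ} (hS : S ⊆ Ioi 0) :
    GrowthScale (PowBound (ι := ι) S) where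
  congr := fun ⟨C, h⟩ e => ⟨C, fun i s hs => by rw [← e i (hS hs)]; exact h i s hs⟩
  add := fun ⟨C, h⟩ ⟨C', h'⟩ => ⟨C + C', fun i s hs => by
    rw [add_mul]; exact (abs_add_le _ _).trans (add_le_add (h i s hs) (h' i s hs))⟩
  mul := fun {κ κ' f g} ⟨C, h⟩ ⟨C', h'⟩ => ⟨C * C', fun i s hs => by
    rw [abs_mul, Real.rpow_add (hS hs), mul_mul_mul_comm]
    exact mul_le_mul (h i s hs) (h' i s hs) (abs_nonneg _) ((abs_nonneg _).trans (h i s hs))⟩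
  const := fun c => ⟨|c|, fun _ s _ => by simp⟩
  inv := ⟨1, fun _ s hs => by
    have : 0 < s := hS hs
    rw [abs_of_pos (by positivity), Real.rpow_neg_one, one_mul]⟩

/-- Local absolute continuity on `(0,∞)`, together with the bound `O(s ^ κ)` on `(0,ρ)`. -/
def ACBound (ρ : ℝ) {ι : Type} (κ : ℝ) (f : ι → ℝ → ℝ) : Prop :=
  (∀ i, LocAC (f i)) ∧ PowBound (Ioo 0 ρ) κ f

theorem growthScale_acBound (ρ : ℝ) {ι : Type} : GrowthScale (ACBound ρ (ι := ι)) := by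
  have hP := growthScale_powBound (ι := ι) (S := Ioo 0 ρ) fun s hs => hs.1
  exact
  { congr := fun h e => ⟨fun i => (h.1 i).congr (e i), hP.congr h.2 e⟩
    add := fun h h' => ⟨fun i => (h.1 i).add (h'.1 i), hP.add h.2 h'.2⟩
    mul := fun h h' => ⟨fun i => (h.1 i).mul (h'.1 i), hP.mul h.2 h'.2⟩
    const := fun c => ⟨fun _ => LocAC.of_contDiffOn contDiffOn_const, hP.const c⟩
    inv := ⟨fun _ => LocAC.of_contDiffOn fun s hs =>
      (contDiffAt_inv ℝ (ne_of_gt hs)).contDiffWithinAt, hP.inv⟩ }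

/-- `ACBound ρ κ f`, together with the almost everywhere bound `O(s ^ (κ - 1))` for the derivatives
on `(0,ρ)`. -/
def ACBoundDeriv (ρ : ℝ) {ι : Type} (κ : ℝ) (f : ι → ℝ → ℝ) : Prop :=
  ACBound ρ κ f ∧ ∃ C : ℝ, ∀ i, ∀ᵐ s : ℝ, s ∈ Ioo (0 : ℝ) ρ → |deriv (f i) s| ≤ C * s ^ (κ - 1)

theorem growthScale_acBoundDeriv (ρ : ℝ) {ι : Type} : GrowthScale (ACBoundDeriv ρ (ι := ι)) where
  congr := fun h e => ⟨(growthScale_acBound ρ).congr h.1 e, by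
    obtain ⟨C, hC⟩ := h.2
    refine ⟨C, fun i => ?_⟩
    filter_upwards [hC i] with s hs hs'
    rw [← ((e i).eventuallyEq_of_mem (Ioi_mem_nhds hs'.1)).deriv_eq]
    exact hs hs'⟩
  add := fun {κ f g} h h' => ⟨(growthScale_acBound ρ).add h.1 h'.1, by
    obtain ⟨C, hC⟩ := h.2
    obtain ⟨C', hC'⟩ := h'.2
    refine ⟨C + C', fun i => ?_⟩
    filter_upwards [hC i, hC' i, (h.1.1 i).ae_differentiableAt, (h'.1.1 i).ae_differentiableAt]
      with s hs hs' hd hd' h01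
    rw [deriv_fun_add (hd h01.1) (hd' h01.1), add_mul]
    exact (abs_add_le _ _).trans (add_le_add (hs h01) (hs' h01))⟩
  mul := fun {κ κ' f g} h h' => ⟨(growthScale_acBound ρ).mul h.1 h'.1, by
    obtain ⟨C, hC⟩ := h.2
    obtain ⟨C', hC'⟩ := h'.2
    obtain ⟨D, hD⟩ := h.1.2
    obtain ⟨D', hD'⟩ := h'.1.2
    refine ⟨C * D' + D * C', fun i => ?_⟩
    filter_upwards [hC i, hC' i, (h.1.1 i).ae_differentiableAt, (h'.1.1 i).ae_differentiableAt]
      with s hs hs' hd hd' h01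
    have h1 := hs h01
    have h2 := hs' h01
    have h3 := hD i s h01
    have h4 := hD' i s h01
    rw [deriv_fun_mul (hd h01.1) (hd' h01.1)]
    have e1 : s ^ (κ + κ' - 1) = s ^ (κ - 1) * s ^ κ' := by
      rw [← Real.rpow_add h01.1]; congr 1; ring
    have e2 : s ^ (κ + κ' - 1) = s ^ κ * s ^ (κ' - 1) := by
      rw [← Real.rpow_add h01.1]; congr 1; ring
    calc |deriv (f i) s * g i s + f i s * deriv (g i) s|
        ≤ |deriv (f i) s| * |g i s| + |f i s| * |deriv (g i) s| := by
          rw [← abs_mul, ← abs_mul]; exact abs_add_le _ _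
      _ ≤ (C * s ^ (κ - 1)) * (D' * s ^ κ') + (D * s ^ κ) * (C' * s ^ (κ' - 1)) :=
          add_le_add
            (mul_le_mul h1 h4 (abs_nonneg _) ((abs_nonneg _).trans h1))
            (mul_le_mul h3 h2 (abs_nonneg _) ((abs_nonneg _).trans h3))
      _ = (C * D' + D * C') * s ^ (κ + κ' - 1) := by
          rw [add_mul]; nth_rewrite 1 [e1]; rw [e2]; ring⟩
  const := fun c => ⟨(growthScale_acBound ρ).const c, 0, fun i => by simp⟩
  inv := ⟨(growthScale_acBound ρ).inv, 1, fun i => by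
    filter_upwards with s hs
    rw [deriv_inv, abs_neg, abs_of_nonneg (by positivity), one_mul,
      show (-1 - 1 : ℝ) = -(2 : ℕ) by norm_num, Real.rpow_neg hs.1.le, Real.rpow_natCast]⟩

theorem Tower.acBound {ρ : ℝ} {ι : Type} : ∀ {n : ℕ} {κ : ℝ} {f : ι → ℝ → ℝ},
    Tower (ACBoundDeriv ρ) n κ f → Tower (ACBound ρ) n κ f
  | 0, _, _, h => h.1
  | _ + 1, _, _, h => ⟨h.1, h.2.1.1, h.2.2.acBound⟩

/-! ### Green's formula for the radial Laplacian -/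

theorem tendsto_setIntegral_Ioi_right {F : ℝ → ℝ} (hF : IntegrableOn F (Ioi 0)) {T : ℝ}
    (hT : ∀ s, T < s → F s = 0) (hT0 : 0 < T) :
    Tendsto (fun ε => ∫ s in ε..T, F s) (𝓝[>] 0) (𝓝 (∫ s in Ioi (0 : ℝ), F s)) := by
  have hi : IntervalIntegrable F volume 0 T :=
    (intervalIntegrable_iff_integrableOn_Ioc_of_le hT0.le).2 (hF.mono_set Ioc_subset_Ioi_self)
  have h1 : ∫ s in Ioi (0 : ℝ), F s = ∫ s in (0 : ℝ)..T, F s := by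
    rw [intervalIntegral.integral_of_le hT0.le]
    refine setIntegral_eq_of_subset_of_forall_sdiff_eq_zero measurableSet_Ioi
      Ioc_subset_Ioi_self fun s hs => hT s ?_
    by_contra h
    exact hs.2 ⟨hs.1, not_lt.1 h⟩
  rw [h1]
  have hc : ContinuousOn (fun ε => ∫ s in ε..T, F s) (uIcc 0 T) :=
    intervalIntegral.continuousOn_primitive_interval_left ((intervalIntegrable_iff' (by simp)).1 hi)
  have h2 : ContinuousWithinAt (fun ε => ∫ s in ε..T, F s) (uIcc 0 T) 0 := hc 0 left_mem_uIcc
  rw [uIcc_of_le hT0.le] at h2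
  refine (h2.mono_of_mem_nhdsWithin ?_).tendsto
  filter_upwards [Ioo_mem_nhdsGT hT0] with s hs using Ioo_subset_Icc_self hs

/-- A function which is locally integrable on `(0,∞)`, vanishes near infinity, and is
`O(s ^ κ)`, `κ > -1`, near `0` is integrable. -/
theorem integrableOn_of_pow_bound {F : ℝ → ℝ} {ρ κ C T : ℝ} (hρ : 0 < ρ)
    (hloc : ∀ a b : ℝ, 0 < a → a ≤ b → IntervalIntegrable F volume a b)
    (hb : ∀ᵐ s : ℝ, s ∈ Ioo (0 : ℝ) ρ → |F s| ≤ C * s ^ κ) (hκ : -1 < κ)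
    (hT : ∀ s, T < s → F s = 0) : IntegrableOn F (Ioi 0) := by
  have hm : AEStronglyMeasurable F (volume.restrict (Ioo 0 ρ)) := by
    have e : Ioo (0 : ℝ) ρ ⊆ ⋃ n : ℕ, Ioc (ρ / ((n : ℝ) + 1)) ρ := by
      intro s hs
      obtain ⟨k, hk⟩ := exists_nat_gt (ρ / s)
      refine mem_iUnion.2 ⟨k, ?_, hs.2.le⟩
      rw [div_lt_comm₀ (by positivity) hs.1]
      linarith
    refine AEStronglyMeasurable.mono_set e (aestronglyMeasurable_iUnion_iff.2 fun n => ?_)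
    have h1 : ρ / ((n : ℝ) + 1) ≤ ρ :=
      div_le_self hρ.le (by linarith [(Nat.cast_nonneg n : (0 : ℝ) ≤ n)])
    exact ((intervalIntegrable_iff_integrableOn_Ioc_of_le h1).1
      (hloc _ ρ (by positivity) h1)).aestronglyMeasurable
  have h1 : IntegrableOn F (Ioo 0 ρ) := by
    have hp : IntegrableOn (fun s : ℝ => C * s ^ κ) (Ioo 0 ρ) :=
      (((intervalIntegral.intervalIntegrable_rpow' hκ (a := 0) (b := ρ)).const_mul C).1).mono_set
        Ioo_subset_Ioc_self
    refine Integrable.mono' hp hm ?_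
    rw [ae_restrict_iff' measurableSet_Ioo]
    exact hb
  have h2 : IntegrableOn F (Ioc (ρ / 2) (max T ρ)) :=
    (intervalIntegrable_iff_integrableOn_Ioc_of_le (by
      linarith [le_max_right T ρ])).1 (hloc _ _ (by linarith) (by linarith [le_max_right T ρ]))
  have h3 : IntegrableOn F (Ioi (max T ρ)) :=
    integrableOn_zero.congr_fun (fun s hs => (hT s ((le_max_left _ _).trans_lt hs)).symm)
      measurableSet_Ioi
  refine ((h1.union h2).union h3).mono_set fun s hs => ?_
  rcases lt_or_ge s ρ with h | h
  · exact Or.inl (Or.inl ⟨hs, h⟩)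
  · rcases le_or_gt s (max T ρ) with h' | h'
    · exact Or.inl (Or.inr ⟨by linarith, h'⟩)
    · exact Or.inr h'

theorem tendsto_zero_of_pow_bound {F : ℝ → ℝ} {ρ κ C : ℝ} (hρ : 0 < ρ) (hκ : 0 < κ)
    (hb : ∀ s ∈ Ioo (0 : ℝ) ρ, |F s| ≤ C * s ^ κ) : Tendsto F (𝓝[>] 0) (𝓝 0) := by
  have h1 : Tendsto (fun s : ℝ => C * s ^ κ) (𝓝[>] 0) (𝓝 0) := by
    have : ContinuousAt (fun s : ℝ => C * s ^ κ) 0 :=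
      (Real.continuousAt_rpow_const 0 κ (Or.inr hκ.le)).const_mul C
    have h := this.tendsto
    rw [Real.zero_rpow hκ.ne', mul_zero] at h
    exact h.mono_left nhdsWithin_le_nhds
  refine squeeze_zero_norm' ?_ h1
  filter_upwards [Ioo_mem_nhdsGT hρ] with s hs using hb s hs

/-- Integration by parts against the weight `s ^ α`. -/
theorem integral_deriv_mul_weight {α ρ κ κ' C C' T : ℝ} {w F : ℝ → ℝ} (hρ : 0 < ρ) (hw : LocAC w) (hF : LocAC F)
    (hbw : ∀ s ∈ Ioo (0 : ℝ) ρ, |w s| ≤ C * s ^ κ) (hbF : ∀ s ∈ Ioo (0 : ℝ) ρ, |F s| ≤ C' * s ^ κ')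
    (hκ : 0 < κ + κ' + α)
    (hT : ∀ s, T < s → w s * F s = 0)
    (hT1 : ∀ s, T < s → deriv w s * F s = 0) (hT2 : ∀ s, T < s → w s * (deriv F s + α / s * F s) = 0)
    (hi1 : IntegrableOn (fun s => deriv w s * F s * s ^ α) (Ioi 0))
    (hi2 : IntegrableOn (fun s => w s * (deriv F s + α / s * F s) * s ^ α) (Ioi 0)) :
    ∫ s in Ioi (0 : ℝ), deriv w s * F s * s ^ α =
      -∫ s in Ioi (0 : ℝ), w s * (deriv F s + α / s * F s) * s ^ α := by
  set S := max T 0 + 1 with hS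
  have hTS : T < S := by rw [hS]; linarith [le_max_left T 0]
  have hS0 : 0 < S := by rw [hS]; linarith [le_max_right T 0]
  have hG : LocAC (fun s => F s * s ^ α) := hF.mul (LocAC.rpow α)
  have key : ∀ ε ∈ Ioo (0 : ℝ) S,
      ∫ s in ε..S, (deriv w s * F s * s ^ α + w s * (deriv F s + α / s * F s) * s ^ α) =
        -(w ε * F ε * ε ^ α) := by
    intro ε hε
    have h1 := (hw ε S hε.1 hε.2.le).integral_deriv_mul_eq_sub (hG ε S hε.1 hε.2.le)
    have h2 : w S * (F S * S ^ α) = 0 := by rw [← mul_assoc, hT S hTS, zero_mul]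
    rw [h2, zero_sub, ← mul_assoc] at h1
    rw [← h1]
    refine intervalIntegral.integral_congr_ae ?_
    filter_upwards [hF.ae_differentiableAt] with s hs hsε
    rw [uIoc_of_le hε.2.le] at hsε
    have hs0 : 0 < s := hε.1.trans hsε.1
    have hd := ((hs hs0).hasDerivAt.mul (Real.hasDerivAt_rpow_const (p := α) (Or.inl hs0.ne'))).deriv
    have hd' : deriv (fun s => F s * s ^ α) s = deriv F s * s ^ α + F s * (α * s ^ (α - 1)) := hd
    rw [hd', Real.rpow_sub_one hs0.ne']
    field_simp
  have h0 : Tendsto (fun ε => -(w ε * F ε * ε ^ α)) (𝓝[>] 0) (𝓝 0) := by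
    suffices h : Tendsto (fun ε => w ε * F ε * ε ^ α) (𝓝[>] 0) (𝓝 0) by simpa using h.neg
    refine tendsto_zero_of_pow_bound (C := C * C') hρ hκ fun s hs => ?_
    rw [abs_mul, abs_mul, Real.rpow_add hs.1, Real.rpow_add hs.1, abs_of_pos (Real.rpow_pos_of_pos hs.1 α),
      ← mul_assoc]
    refine mul_le_mul_of_nonneg_right ?_ (Real.rpow_nonneg hs.1.le _)
    rw [← mul_assoc, mul_right_comm C, mul_assoc (C * s ^ κ)]
    exact mul_le_mul (hbw s hs) (hbF s hs) (abs_nonneg _) ((abs_nonneg _).trans (hbw s hs))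
  have h1 := tendsto_setIntegral_Ioi_right (hi1.add hi2) (T := S) (fun s hs => by
    simp only [Pi.add_apply]
    rw [hT1 s (hTS.trans hs), hT2 s (hTS.trans hs)]; simp) hS0
  have h2 := tendsto_nhds_unique (h1.congr' (by
    filter_upwards [Ioo_mem_nhdsGT hS0] with ε hε
    exact key ε hε)) h0
  have h3 := integral_add hi1 hi2
  simp only [Pi.add_apply] at h2
  rw [h3] at h2
  linarith

theorem deriv_eq_zero_of_vanish {B : ℝ → ℝ} {T : ℝ} (hT : ∀ s, T < s → B s = 0) :
    ∀ s, T < s → deriv B s = 0 := by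
  intro s hs
  have : B =ᶠ[𝓝 s] fun _ => 0 := by
    filter_upwards [Ioi_mem_nhds hs] with x hx using hT x hx
  rw [this.deriv_eq, deriv_const]

theorem lap_eq_zero_of_vanish {B : ℝ → ℝ} {T α : ℝ} (hT : ∀ s, T < s → B s = 0) :
    ∀ s, T < s → lap α B s = 0 := by
  intro s hs
  have h := deriv_eq_zero_of_vanish hT
  rw [lap, deriv_eq_zero_of_vanish h s hs, h s hs]
  simp

theorem lap_iterate_eq_zero_of_vanish {B : ℝ → ℝ} {T α : ℝ} (hT : ∀ s, T < s → B s = 0) (k : ℕ) :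
    ∀ s, T < s → (lap α)^[k] B s = 0 := by
  induction k with
  | zero => exact hT
  | succ k ih => rw [Function.iterate_succ_apply']; exact lap_eq_zero_of_vanish ih

section Single

variable {α ρ κ κ' T : ℝ} {w B : ℝ → ℝ}

theorem integrable_lap_mul (hρ : 0 < ρ) (hw : Tower (ACBoundDeriv ρ) 1 κ (fun _ : Unit => w))
    (hB : ACBound ρ κ' (fun _ : Unit => B)) (hκ : 1 < κ + κ' + α) (hT : ∀ s, T < s → lap α w s * B s = 0) :
    IntegrableOn (fun s => lap α w s * B s * s ^ α) (Ioi 0) := by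
  obtain ⟨-, -, hw1, C, hC⟩ := hw
  obtain ⟨D, hD⟩ := hw1.2
  obtain ⟨E, hE⟩ := hB.2
  refine integrableOn_of_pow_bound hρ (κ := κ + κ' + α - 2) (C := (C + |α| * D) * E) (T := T)
    ?_ ?_ (by linarith) fun s hs => by rw [hT s hs, zero_mul]
  · intro a b ha hab
    have h1 : IntervalIntegrable (deriv (deriv w)) volume a b :=
      (hw1.1 () a b ha hab).intervalIntegrable_deriv
    have hsub := uIcc_subset_Ioi ha hab
    have hc : ContinuousOn (fun s => α / s * deriv w s) (uIcc a b) :=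
      (continuousOn_const.div continuousOn_id fun s hs => ne_of_gt (hsub hs)).mul
        ((hw1.1 ()).continuousOn.mono hsub)
    have h2 := (h1.add hc.intervalIntegrable).mul_continuousOn
      (((hB.1 ()).mul (LocAC.rpow α)).continuousOn.mono hsub)
    refine h2.congr_ae ?_
    filter_upwards with s
    simp only [lap]
    ring
  · filter_upwards [hC ()] with s hs h01
    have h1 := hs h01
    have h2 := hD () s h01
    have h3 := hE () s h01
    have e : s ^ (κ + κ' + α - 2) = s ^ (κ - 1 - 1) * s ^ κ' * s ^ α := by
      rw [← Real.rpow_add h01.1, ← Real.rpow_add h01.1]; congr 1; ring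
    have hp : 0 < s ^ α := Real.rpow_pos_of_pos h01.1 _
    have h4 : |lap α w s| ≤ (C + |α| * D) * s ^ (κ - 1 - 1) := by
      have h5 : |α / s * deriv w s| ≤ |α| * D * s ^ (κ - 1 - 1) := by
        rw [abs_mul, abs_div, abs_of_pos h01.1, Real.rpow_sub_one h01.1.ne' (κ - 1)]
        calc |α| / s * |deriv w s| ≤ |α| / s * (D * s ^ (κ - 1)) :=
              mul_le_mul_of_nonneg_left h2 (div_nonneg (abs_nonneg _) h01.1.le)
          _ = _ := by ring
      rw [add_mul]
      exact (abs_add_le _ _).trans (add_le_add h1 h5)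
    rw [abs_mul, abs_mul, abs_of_pos hp, e, ← mul_assoc]
    refine mul_le_mul_of_nonneg_right ?_ hp.le
    rw [show (C + |α| * D) * E * (s ^ (κ - 1 - 1) * s ^ κ') =
      ((C + |α| * D) * s ^ (κ - 1 - 1)) * (E * s ^ κ') by ring]
    exact mul_le_mul h4 h3 (abs_nonneg _) ((abs_nonneg _).trans h4)

theorem integrable_deriv_mul_deriv (hρ : 0 < ρ) (hw : ACBoundDeriv ρ κ (fun _ : Unit => w))
    (hB : Tower (ACBound ρ) 1 κ' (fun _ : Unit => B)) (hκ : 1 < κ + κ' + α)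
    (hT : ∀ s, T < s → deriv w s * deriv B s = 0) :
    IntegrableOn (fun s => deriv w s * deriv B s * s ^ α) (Ioi 0) := by
  obtain ⟨hw1, C, hC⟩ := hw
  obtain ⟨-, -, hB1⟩ := hB
  obtain ⟨D, hD⟩ := hB1.2
  refine integrableOn_of_pow_bound hρ (κ := κ + κ' + α - 2) (C := C * D) (T := T)
    ?_ ?_ (by linarith) fun s hs => by rw [hT s hs, zero_mul]
  · intro a b ha hab
    have h1 : IntervalIntegrable (deriv w) volume a b :=
      (hw1.1 () a b ha hab).intervalIntegrable_deriv
    have hsub := uIcc_subset_Ioi ha hab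
    have h2 := h1.mul_continuousOn
      (((hB1.1 ()).mul (LocAC.rpow α)).continuousOn.mono hsub)
    refine h2.congr_ae ?_
    filter_upwards with s
    ring
  · filter_upwards [hC ()] with s hs h01
    have h1 := hs h01
    have h3 := hD () s h01
    have e : s ^ (κ + κ' + α - 2) = s ^ (κ - 1) * s ^ (κ' - 1) * s ^ α := by
      rw [← Real.rpow_add h01.1, ← Real.rpow_add h01.1]; congr 1; ring
    have hp : 0 < s ^ α := Real.rpow_pos_of_pos h01.1 _
    rw [abs_mul, abs_mul, abs_of_pos hp, e, ← mul_assoc]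
    refine mul_le_mul_of_nonneg_right ?_ hp.le
    rw [show C * D * (s ^ (κ - 1) * s ^ (κ' - 1)) =
      (C * s ^ (κ - 1)) * (D * s ^ (κ' - 1)) by ring]
    exact mul_le_mul h1 h3 (abs_nonneg _) ((abs_nonneg _).trans h1)

/-- Green's first formula. -/
theorem integral_deriv_mul_deriv (hρ : 0 < ρ) (hw : ACBoundDeriv ρ κ (fun _ : Unit => w))
    (hB : Tower (ACBoundDeriv ρ) 1 κ' (fun _ : Unit => B)) (hκ : 1 < κ + κ' + α)
    (hT : ∀ s, T < s → B s = 0) :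
    ∫ s in Ioi (0 : ℝ), deriv w s * deriv B s * s ^ α =
      -∫ s in Ioi (0 : ℝ), w s * lap α B s * s ^ α := by
  obtain ⟨C, hC⟩ := hw.1.2
  obtain ⟨D, hD⟩ := hB.2.2.1.2
  have hd := deriv_eq_zero_of_vanish hT
  have hl := lap_eq_zero_of_vanish (α := α) hT
  refine integral_deriv_mul_weight hρ (F := deriv B) (κ' := κ' - 1) (T := T) (hw.1.1 ())
    (hB.2.2.1.1 ()) (hC ()) (hD ()) (by linarith)
    (fun s hs => by rw [hd s hs, mul_zero]) (fun s hs => by rw [hd s hs, mul_zero])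
    (fun s hs => by have := hl s hs; rw [lap] at this; rw [this, mul_zero])
    (integrable_deriv_mul_deriv hρ (T := T) hw hB.acBound hκ fun s hs => by rw [hd s hs, mul_zero]) ?_
  refine (integrable_lap_mul hρ (T := T) hB hw.1 (by linarith) fun s hs => by
    rw [hl s hs, zero_mul]).congr_fun (fun s _ => ?_) measurableSet_Ioi
  simp only [lap]
  ring

/-- Green's second formula. The integrability hypothesis is needed because the second
derivative of `w` is not controlled near `0`. -/
theorem integral_lap_mul (hρ : 0 < ρ) (hw : Tower (ACBound ρ) 1 κ (fun _ : Unit => w))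
    (hB : Tower (ACBoundDeriv ρ) 1 κ' (fun _ : Unit => B)) (hκ : 1 < κ + κ' + α)
    (hT : ∀ s, T < s → B s = 0)
    (hi : IntegrableOn (fun s => lap α w s * B s * s ^ α) (Ioi 0)) :
    ∫ s in Ioi (0 : ℝ), lap α w s * B s * s ^ α =
      ∫ s in Ioi (0 : ℝ), w s * lap α B s * s ^ α := by
  obtain ⟨C, hC⟩ := hw.2.2.2
  obtain ⟨D, hD⟩ := hB.2.1.1.2
  have hd := deriv_eq_zero_of_vanish hT
  have hw0 : ACBoundDeriv ρ κ (fun _ : Unit => w) :=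
    ⟨hw.2.1, C, fun i => by filter_upwards with s hs using hC i s hs⟩
  have hi' := integrable_deriv_mul_deriv hρ (T := T) (α := α) hw0 hB.acBound hκ
    fun s hs => by rw [hd s hs, mul_zero]
  have h1 : ∫ s in Ioi (0 : ℝ), deriv B s * deriv w s * s ^ α =
      -∫ s in Ioi (0 : ℝ), B s * (deriv (deriv w) s + α / s * deriv w s) * s ^ α := by
    refine integral_deriv_mul_weight hρ (T := T) (κ := κ') (κ' := κ - 1) (hB.2.1.1.1 ())
      (hw.2.2.1 ()) (hD ()) (hC ()) (by linarith) (fun s hs => by rw [hT s hs, zero_mul])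
      (fun s hs => by rw [hd s hs, zero_mul]) (fun s hs => by rw [hT s hs, zero_mul]) ?_ ?_
    · exact hi'.congr_fun (fun s _ => by ring) measurableSet_Ioi
    · exact hi.congr_fun (fun s _ => by simp only [lap]; ring) measurableSet_Ioi
  have h2 := integral_deriv_mul_deriv hρ (T := T) hw0 hB hκ hT
  have e1 : ∫ s in Ioi (0 : ℝ), deriv B s * deriv w s * s ^ α =
      ∫ s in Ioi (0 : ℝ), deriv w s * deriv B s * s ^ α := by
    congr 1; ext s; ring
  have e2 : ∫ s in Ioi (0 : ℝ), B s * (deriv (deriv w) s + α / s * deriv w s) * s ^ α =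
      ∫ s in Ioi (0 : ℝ), lap α w s * B s * s ^ α := by
    congr 1; ext s; simp only [lap]; ring
  rw [e1, e2] at h1
  linarith

/-- Iterated Green's formula. -/
theorem integral_lap_iterate_mul (hρ : 0 < ρ) (j : ℕ) : ∀ {κ' : ℝ} {B : ℝ → ℝ},
    Tower (ACBoundDeriv ρ) (2 * j - 1) κ (fun _ : Unit => w) →
    (∀ n, Tower (ACBoundDeriv ρ) n κ' (fun _ : Unit => B)) → 2 * (j : ℝ) - 1 < κ + κ' + α →
    (∀ s, T < s → B s = 0) →
    ∫ s in Ioi (0 : ℝ), (lap α)^[j] w s * B s * s ^ α =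
      ∫ s in Ioi (0 : ℝ), w s * (lap α)^[j] B s * s ^ α := by
  induction j with
  | zero => intro κ' B _ _ _ _; simp
  | succ j ih =>
    intro κ' B hw hB hκ hT
    push_cast at hκ
    have hl := lap_eq_zero_of_vanish (α := α) hT
    have h1 : Tower (ACBoundDeriv ρ) 1 (κ - 2 * j) (fun _ : Unit => (lap α)^[j] w) :=
      Tower.lap_iterate (growthScale_acBoundDeriv ρ) α j (hw.mono (by omega))
    have h2 := integral_lap_mul hρ (T := T) h1.acBound (hB 1) (by linarith) hT
      (integrable_lap_mul hρ (T := T) h1 (hB 0).1 (by linarith) fun s hs => by rw [hT s hs, mul_zero])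
    rw [Function.iterate_succ_apply', h2, Function.iterate_succ_apply]
    exact ih (κ' := κ' - 2) (hw.mono (by omega))
      (fun n => (hB (n + 2)).lap (growthScale_acBoundDeriv ρ) α) (by linarith) hl

end Single

theorem lap_neg (α : ℝ) (u : ℝ → ℝ) : lap α (fun r => -u r) = fun r => -lap α u r := by
  have h : ∀ f : ℝ → ℝ, deriv (fun r => -f r) = fun r => -deriv f r := fun f => by
    ext r; exact deriv.fun_neg
  ext r
  simp only [lap, h]
  ring

theorem lap_iterate_neg (α : ℝ) (k : ℕ) (u : ℝ → ℝ) :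
    (lap α)^[k] (fun r => -u r) = fun r => -(lap α)^[k] u r := by
  induction k generalizing u with
  | zero => rfl
  | succ k ih => rw [Function.iterate_succ_apply, lap_neg, ih, Function.iterate_succ_apply]

theorem polyharmonic_eq (m : ℕ) (α : ℝ) (u : ℝ → ℝ) (r : ℝ) :
    polyharmonic m α u r = (-1) ^ m * (lap α)^[m] u r := by
  induction m generalizing u with
  | zero => simp [polyharmonic]
  | succ m ih =>
    have h1 : polyharmonic (m + 1) α u = polyharmonic m α (fun r => -lap α u r) :=
      Function.iterate_succ_apply _ _ _
    rw [h1, ih, lap_iterate_neg, Function.iterate_succ_apply]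
    ring

/-! ### Distributional form of the equation -/

section Distrib

variable {ρ : ℝ}

theorem le_mul_rpow_of_nonpos {M κ s : ℝ} (hM : 0 ≤ M) (hκ : κ ≤ 0) (hs : s ∈ Ioo (0 : ℝ) ρ)
    (hρ : ρ ≤ 1) : M ≤ M * s ^ κ :=
  le_mul_of_one_le_right hM (Real.one_le_rpow_of_pos_of_le_one_of_nonpos hs.1
    (hs.2.le.trans hρ) hκ)

theorem contDiffOn_deriv_Ioi {n : ℕ} {v : ℝ → ℝ} (h : ContDiffOn ℝ (n + 1 : ℕ) v (Ioi 0)) :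
    DifferentiableOn ℝ v (Ioi 0) ∧ ContDiffOn ℝ n (deriv v) (Ioi 0) := by
  rw [Nat.cast_add, Nat.cast_one, contDiffOn_succ_iff_deriv_of_isOpen isOpen_Ioi] at h
  exact ⟨h.1, h.2.2⟩

theorem locAC_iteratedDeriv {n : ℕ} : ∀ {v : ℝ → ℝ}, ContDiffOn ℝ (n + 1 : ℕ) v (Ioi 0) →
    LocAC (iteratedDeriv n v) := by
  induction n with
  | zero => intro v h; simpa using LocAC.of_contDiffOn (by simpa using h)
  | succ n ih =>
    intro v h
    rw [iteratedDeriv_succ']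
    exact ih (contDiffOn_deriv_Ioi h).2

/-- A function whose derivatives are bounded near `0` has size `s ^ κ` for every `κ ≤ 0`. The exponent
loses one with each derivative, which leaves room for the singular coefficient `α / s` of the Laplacian. -/
theorem tower_acBound (hρ1 : ρ ≤ 1) {M : ℝ} (hM : 0 ≤ M) {n : ℕ} : ∀ {v : ℝ → ℝ} {κ : ℝ}, κ ≤ 0 →
    ContDiffOn ℝ n v (Ioi 0) → LocAC (iteratedDeriv n v) →
    (∀ i ≤ n, ∀ s ∈ Ioo (0 : ℝ) ρ, |iteratedDeriv i v s| ≤ M) →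
    Tower (ACBound ρ) n κ (fun _ : Unit => v) := by
  induction n with
  | zero =>
    intro v κ hκ _ h hb
    refine ⟨fun _ => by simpa using h, M, fun _ s hs => ?_⟩
    have := hb 0 le_rfl s hs
    rw [iteratedDeriv_zero] at this
    exact this.trans (le_mul_rpow_of_nonpos hM hκ hs hρ1)
  | succ n ih =>
    intro v κ hκ hc h hb
    have hd := contDiffOn_deriv_Ioi hc
    refine ⟨fun _ => hd.1, ⟨fun _ => LocAC.of_contDiffOn (hc.of_le (by norm_cast; omega)),
      M, fun _ s hs => ?_⟩, ?_⟩
    · have := hb 0 (by omega) s hs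
      rw [iteratedDeriv_zero] at this
      exact this.trans (le_mul_rpow_of_nonpos hM hκ hs hρ1)
    · refine ih (by linarith) hd.2 (by rwa [← iteratedDeriv_succ']) fun i hi s hs => ?_
      rw [← iteratedDeriv_succ']
      exact hb (i + 1) (by omega) s hs

/-- The variant of `tower_acBound` which also controls the almost everywhere derivative of the top order. -/
theorem tower_acBoundDeriv (hρ1 : ρ ≤ 1) {M : ℝ} (hM : 0 ≤ M) {n : ℕ} : ∀ {v : ℝ → ℝ} {κ : ℝ},
    κ ≤ 0 → ContDiffOn ℝ n v (Ioi 0) → LocAC (iteratedDeriv n v) →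
    (∀ i ≤ n + 1, ∀ s ∈ Ioo (0 : ℝ) ρ, |iteratedDeriv i v s| ≤ M) →
    Tower (ACBoundDeriv ρ) n κ (fun _ : Unit => v) := by
  have h1 : ∀ {n : ℕ} {v : ℝ → ℝ} {κ : ℝ}, κ ≤ 0 →
      (∀ i ≤ n + 1, ∀ s ∈ Ioo (0 : ℝ) ρ, |iteratedDeriv i v s| ≤ M) →
      ∃ C : ℝ, ∀ i : Unit, ∀ᵐ s : ℝ, s ∈ Ioo (0 : ℝ) ρ → |deriv v s| ≤ C * s ^ (κ - 1) := by
    intro n v κ hκ hb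
    refine ⟨M, fun _ => Eventually.of_forall fun s hs => ?_⟩
    have := hb 1 (by omega) s hs
    rw [iteratedDeriv_one] at this
    exact this.trans (le_mul_rpow_of_nonpos hM (by linarith) hs hρ1)
  induction n with
  | zero =>
    intro v κ hκ hc h hb
    exact ⟨tower_acBound (n := 0) hρ1 hM hκ hc h fun i hi => hb i (by omega), h1 hκ hb⟩
  | succ n ih =>
    intro v κ hκ hc h hb
    have hd := contDiffOn_deriv_Ioi hc
    refine ⟨fun _ => hd.1, ⟨(tower_acBound (n := n + 1) hρ1 hM hκ hc h
      fun i hi => hb i (by omega)).base, h1 hκ hb⟩, ?_⟩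
    refine ih (by linarith) hd.2 (by rwa [← iteratedDeriv_succ']) fun i hi s hs => ?_
    rw [← iteratedDeriv_succ']
    exact hb (i + 1) (by omega) s hs

theorem contDiff_deriv {φ : ℝ → ℝ} (hφ : ContDiff ℝ (⊤ : ℕ∞) φ) :
    Differentiable ℝ φ ∧ ContDiff ℝ (⊤ : ℕ∞) (deriv φ) :=
  contDiff_infty_iff_deriv.1 hφ

theorem tower_of_contDiff (hρ1 : ρ ≤ 1) (n : ℕ) : ∀ {φ : ℝ → ℝ} {κ : ℝ},
    ContDiff ℝ (⊤ : ℕ∞) φ → κ ≤ 0 → Tower (ACBoundDeriv ρ) n κ (fun _ : Unit => φ) := by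
  have hb : ∀ {φ : ℝ → ℝ}, Continuous φ → ∃ M : ℝ, 0 ≤ M ∧ ∀ s ∈ Ioo (0 : ℝ) ρ, |φ s| ≤ M := by
    intro φ hφ
    obtain ⟨M, hM⟩ := (isCompact_Icc (a := (0 : ℝ)) (b := ρ)).exists_bound_of_continuousOn
      hφ.continuousOn
    exact ⟨max M 0, le_max_right _ _, fun s hs =>
      (hM s (Ioo_subset_Icc_self hs)).trans (le_max_left _ _)⟩
  have h0 : ∀ {φ : ℝ → ℝ} {κ : ℝ}, ContDiff ℝ (⊤ : ℕ∞) φ → κ ≤ 0 →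
      ACBoundDeriv ρ κ (fun _ : Unit => φ) := by
    intro φ κ hφ hκ
    obtain ⟨M, hM0, hM⟩ := hb hφ.continuous
    obtain ⟨M', hM0', hM'⟩ := hb (contDiff_deriv hφ).2.continuous
    refine ⟨⟨fun _ => LocAC.of_contDiffOn (hφ.contDiffOn.of_le (by norm_cast)),
      M, fun _ s hs => (hM s hs).trans (le_mul_rpow_of_nonpos hM0 hκ hs hρ1)⟩,
      M', fun _ => Eventually.of_forall fun s hs =>
        (hM' s hs).trans (le_mul_rpow_of_nonpos hM0' (by linarith) hs hρ1)⟩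
  induction n with
  | zero => intro φ κ hφ hκ; exact h0 hφ hκ
  | succ n ih =>
    intro φ κ hφ hκ
    exact ⟨fun _ => (contDiff_deriv hφ).1.differentiableOn, h0 hφ hκ,
      ih (contDiff_deriv hφ).2 (by linarith)⟩

/-- The derivatives of a nonsingular function are bounded near `0`. -/
theorem Nonsingular.exists_bound {ℓ : ℕ} {v : ℝ → ℝ} (h : Nonsingular ℓ v) :
    ∃ ρ : ℝ, 0 < ρ ∧ ρ ≤ 1 ∧ ∃ M : ℝ, 0 ≤ M ∧
      ∀ i ≤ ℓ, ∀ s ∈ Ioo (0 : ℝ) ρ, |iteratedDeriv i v s| ≤ M := by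
  choose! L hL using h
  have h1 : ∀ᶠ s in 𝓝[>] (0 : ℝ), ∀ i ∈ Finset.range (ℓ + 1), |iteratedDeriv i v s| ≤ |L i| + 1 := by
    refine (Finset.range (ℓ + 1)).eventually_all.2 fun i hi => ?_
    have := (hL i (by simpa [Nat.lt_succ_iff] using hi)).abs
    filter_upwards [this.eventually (eventually_lt_nhds (lt_add_one _))] with s hs using hs.le
  obtain ⟨ρ, hρ, hs⟩ := mem_nhdsGT_iff_exists_Ioo_subset.1 h1
  refine ⟨min ρ 1, lt_min hρ one_pos, min_le_right _ _,
    ∑ i ∈ Finset.range (ℓ + 1), (|L i| + 1), Finset.sum_nonneg fun i _ => by positivity,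
    fun i hi s hs' => ?_⟩
  have hi' : i ∈ Finset.range (ℓ + 1) := by simpa [Nat.lt_succ_iff] using hi
  exact (hs ⟨hs'.1, hs'.2.trans_le (min_le_left _ _)⟩ i hi').trans
    (Finset.single_le_sum (f := fun i => |L i| + 1) (fun i _ => by positivity) hi')

theorem memD_of_contDiff {m : ℕ} {α T : ℝ} (hα : -1 < α) {φ : ℝ → ℝ} (hφ : ContDiff ℝ (⊤ : ℕ∞) φ)
    (hT : ∀ s, T < s → φ s = 0) : MemD m α φ := by
  have hz : ∀ j, ∀ s, T < s → iteratedDeriv j φ s = 0 := by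
    intro j
    induction j with
    | zero => simpa using hT
    | succ j ih => rw [iteratedDeriv_succ]; exact deriv_eq_zero_of_vanish ih
  have hsm : ∀ j : ℕ, Continuous (iteratedDeriv j φ) := fun j =>
    hφ.continuous_iteratedDeriv j (by exact_mod_cast le_top)
  refine ⟨⟨(contDiff_infty.1 hφ _).contDiffOn,
    locAC_iteratedDeriv (contDiff_infty.1 hφ _).contDiffOn⟩, fun j _ => ?_, ?_⟩
  · refine (tendsto_const_nhds (x := (0 : ℝ))).congr' ?_
    filter_upwards [eventually_gt_atTop T] with s hs using (hz j s hs).symm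
  · obtain ⟨M, hM⟩ := (isCompact_Icc (a := (0 : ℝ)) (b := 1)).exists_bound_of_continuousOn
      ((hsm m).pow 2).continuousOn
    refine integrableOn_of_pow_bound (T := T) (κ := α) (C := M) (ρ := 1) one_pos ?_ ?_ hα
      fun s hs => by rw [hz m s hs]; simp
    · intro a b ha hab
      exact (((hsm m).pow 2).continuousOn.mul
        ((LocAC.rpow α).continuousOn.mono (uIcc_subset_Ioi ha hab))).intervalIntegrable
    · refine Eventually.of_forall fun s hs => ?_
      rw [abs_mul, abs_of_nonneg (Real.rpow_nonneg hs.1.le α)]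
      exact mul_le_mul_of_nonneg_right (hM s (Ioo_subset_Icc_self hs)) (Real.rpow_nonneg hs.1.le α)

/-- Both notions of solution give the equation in the sense of distributions on `[0,∞)`. -/
theorem integral_mul_polyharmonic {m : ℕ} (hm : 1 ≤ m) {α T : ℝ} (hα : α - 2 * (m : ℝ) + 1 > 0)
    {v φ : ℝ → ℝ} (hv : MemD m α v) (hns : Nonsingular (2 * m - 1) v)
    (hsol : IsWeakSolution m α v ∨ IsClassicalSolution m α v)
    (hφ : ContDiff ℝ (⊤ : ℕ∞) φ) (hT : ∀ s, T < s → φ s = 0) :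
    ∫ s in Ioi (0 : ℝ), v s * polyharmonic m α φ s * s ^ α =
      ∫ s in Ioi (0 : ℝ), |v s| ^ (critExp m α - 2) * v s * φ s * s ^ α := by
  have hm1 : (1 : ℝ) ≤ m := by exact_mod_cast hm
  obtain ⟨ρ, hρ, hρ1, M, hM, hb⟩ := hns.exists_bound
  have hφt : ∀ n, Tower (ACBoundDeriv ρ) n 0 (fun _ : Unit => φ) := fun n =>
    tower_of_contDiff hρ1 n hφ le_rfl
  have hφl : ∀ k n : ℕ, Tower (ACBoundDeriv ρ) n (0 - 2 * k) (fun _ : Unit => (lap α)^[k] φ) :=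
    fun k n => Tower.lap_iterate (growthScale_acBoundDeriv ρ) α k (hφt _)
  have hzl : ∀ k, ∀ s, T < s → (lap α)^[k] φ s = 0 := lap_iterate_eq_zero_of_vanish hT
  have hpoly : ∫ s in Ioi (0 : ℝ), v s * polyharmonic m α φ s * s ^ α =
      (-1) ^ m * ∫ s in Ioi (0 : ℝ), v s * (lap α)^[m] φ s * s ^ α := by
    rw [← integral_const_mul]
    congr 1; ext s; rw [polyharmonic_eq]; ring
  rcases hsol with hw | ⟨hc, hcl⟩
  · have hvt : Tower (ACBoundDeriv ρ) (m - 1) 0 (fun _ : Unit => v) :=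
      tower_acBoundDeriv hρ1 hM le_rfl hv.1.1 hv.1.2 fun i hi => hb i (by omega)
    rw [← hw φ (memD_of_contDiff (by linarith) hφ hT), hpoly]
    simp only [grad]
    rcases Nat.even_or_odd' m with ⟨k, rfl | rfl⟩
    · rw [if_pos (by simp), if_pos (by simp), Nat.mul_div_cancel_left k (by norm_num)]
      push_cast at hα
      rw [integral_lap_iterate_mul (T := T) hρ k (hvt.mono (by omega)) (hφl k) (by linarith)
        (hzl k), ← Function.iterate_add_apply, ← two_mul]
      simp
    · have hodd : ¬ Even (2 * k + 1) := by simp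
      rw [if_neg hodd, if_neg hodd, show (2 * k + 1) / 2 = k by omega]
      push_cast at hα
      have hw0 : Tower (ACBoundDeriv ρ) 0 (0 - 2 * k) (fun _ : Unit => (lap α)^[k] v) :=
        Tower.lap_iterate (growthScale_acBoundDeriv ρ) α k (hvt.mono (by omega))
      rw [integral_deriv_mul_deriv (T := T) hρ hw0 (hφl k 1) (by linarith) (hzl k)]
      have h1 := hφl (k + 1)
      rw [Function.iterate_succ_apply'] at h1
      push_cast at h1
      rw [integral_lap_iterate_mul (T := T) hρ k (hvt.mono (by omega)) h1 (by linarith)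
        (lap_eq_zero_of_vanish (hzl k)), ← Function.iterate_succ_apply' (lap α),
        ← Function.iterate_add_apply, show k + k.succ = 2 * k + 1 by omega]
      simp [pow_succ]
  · obtain ⟨n, rfl⟩ : ∃ n, m = n + 1 := ⟨m - 1, by omega⟩
    push_cast at hα
    have hvt : Tower (ACBoundDeriv ρ) (2 * n) 0 (fun _ : Unit => v) :=
      tower_acBoundDeriv hρ1 hM le_rfl (hc.of_le (by norm_cast; omega))
        (locAC_iteratedDeriv (hc.of_le (by norm_cast; omega))) fun i hi => hb i (by omega)
    have hvt' : Tower (ACBound ρ) (1 + 2 * n) 0 (fun _ : Unit => v) :=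
      tower_acBound hρ1 hM le_rfl (hc.of_le (by norm_cast; omega))
        (locAC_iteratedDeriv (hc.of_le (by norm_cast; omega))) fun i hi => hb i (by omega)
    have hw1 : Tower (ACBound ρ) 1 (0 - 2 * n) (fun _ : Unit => (lap α)^[n] v) :=
      Tower.lap_iterate (growthScale_acBound ρ) α n hvt'
    have heq : ∀ s ∈ Ioi (0 : ℝ), |v s| ^ (critExp (n + 1) α - 2) * v s * φ s * s ^ α =
        (-1) ^ (n + 1) * (lap α ((lap α)^[n] v) s * φ s * s ^ α) := by
      intro s hs
      rw [← hcl s hs, polyharmonic_eq, Function.iterate_succ_apply']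
      ring
    have hvc : ContinuousOn v (Ioi 0) := hc.continuousOn
    have hq : 0 ≤ critExp (n + 1) α - 2 := by
      rw [critExp, sub_nonneg, le_div_iff₀ (by push_cast; linarith)]
      push_cast
      linarith
    have hi0 : IntegrableOn (fun s => |v s| ^ (critExp (n + 1) α - 2) * v s * φ s * s ^ α)
        (Ioi 0) := by
      obtain ⟨C, hC⟩ := (hφt 0).1.2
      refine integrableOn_of_pow_bound hρ (T := T) (κ := α)
        (C := M ^ (critExp (n + 1) α - 2) * M * C) ?_ ?_ (by linarith)
        fun s hs => by rw [hT s hs]; simp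
      · intro a b ha hab
        have hsub := uIcc_subset_Ioi ha hab
        refine ContinuousOn.intervalIntegrable ?_
        exact ((((hvc.mono hsub).abs.rpow_const fun s _ => Or.inr hq).mul (hvc.mono hsub)).mul
          hφ.continuous.continuousOn).mul ((LocAC.rpow α).continuousOn.mono hsub)
      · refine Eventually.of_forall fun s hs => ?_
        have h1 := hb 0 (by omega) s hs
        rw [iteratedDeriv_zero] at h1
        have h2 := hC () s hs
        rw [Real.rpow_zero, mul_one] at h2
        rw [abs_mul, abs_mul, abs_mul, abs_of_nonneg (Real.rpow_nonneg hs.1.le α),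
          abs_of_nonneg (Real.rpow_nonneg (abs_nonneg (v s)) _)]
        have h3 := Real.rpow_le_rpow (abs_nonneg _) h1 hq
        have hs0 := Real.rpow_nonneg hs.1.le α
        gcongr
    have hi : IntegrableOn (fun s => lap α ((lap α)^[n] v) s * φ s * s ^ α) (Ioi 0) := by
      refine IntegrableOn.congr_fun (hi0.const_mul ((-1) ^ (n + 1))) (fun s hs => ?_) measurableSet_Ioi
      rw [heq s hs, ← mul_assoc, ← pow_add, Even.neg_one_pow ⟨n + 1, rfl⟩, one_mul]
    rw [setIntegral_congr_fun measurableSet_Ioi heq, integral_const_mul, hpoly]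
    congr 1
    rw [integral_lap_mul (T := T) hρ hw1 (hφt 1) (by linarith) hT hi]
    rw [integral_lap_iterate_mul (T := T) (κ' := 0 - 2) hρ n (hvt.mono (by omega))
      (fun j => (hφt (j + 2)).lap (growthScale_acBoundDeriv ρ) α) (by linarith)
      (lap_eq_zero_of_vanish hT), ← Function.iterate_succ_apply]

end Distrib

/-! ### Averages of regularised Riesz kernels over spheres -/

/-- The square `|se - P|² + δ²`, where `e` is a unit vector at angle `b` from `P` and `|P| = r`. -/
noncomputable def sqDist (r δ s b : ℝ) : ℝ :=
  (s - r * Real.cos b) ^ 2 + (r * Real.sin b) ^ 2 + δ ^ 2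

/-- The average `∫₀^π (s - r cos b)^k (|se - P|² + δ²)^{-β} (sin b)^{α-1} db` over the sphere of
radius `s` in dimension `α + 1`. The exponent `k` makes the family stable under `d/ds`. -/
noncomputable def sphAvg (α r δ β : ℝ) (k : ℕ) (s : ℝ) : ℝ :=
  ∫ b in (0 : ℝ)..Real.pi, (s - r * Real.cos b) ^ k * sqDist r δ s b ^ (-β) * Real.sin b ^ (α - 1)

section SphAvg

variable {α r δ β : ℝ} {k : ℕ} {s : ℝ}

theorem sqDist_pos (hδ : 0 < δ) (s b : ℝ) : 0 < sqDist r δ s b := by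
  unfold sqDist; positivity

theorem continuous_sqDist : Continuous (fun z : ℝ × ℝ => sqDist r δ z.1 z.2) := by
  unfold sqDist; fun_prop

theorem continuous_sqDist_rpow (hδ : 0 < δ) (β : ℝ) :
    Continuous (fun z : ℝ × ℝ => sqDist r δ z.1 z.2 ^ β) :=
  continuous_sqDist.rpow_const fun z => Or.inl (sqDist_pos hδ z.1 z.2).ne'

theorem continuous_sin_rpow (hα : 1 < α) : Continuous (fun b : ℝ => Real.sin b ^ (α - 1)) :=
  Real.continuous_sin.rpow_const fun _ => Or.inr (by linarith)

theorem continuous_sphAvg_integrand (hα : 1 < α) (hδ : 0 < δ) (β : ℝ) (k : ℕ) :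
    Continuous (fun z : ℝ × ℝ => (z.1 - r * Real.cos z.2) ^ k * sqDist r δ z.1 z.2 ^ (-β) *
      Real.sin z.2 ^ (α - 1)) :=
  ((by fun_prop : Continuous fun z : ℝ × ℝ => (z.1 - r * Real.cos z.2) ^ k).mul
    (continuous_sqDist_rpow hδ _)).mul ((continuous_sin_rpow hα).comp continuous_snd)

theorem intervalIntegrable_sphAvg (hα : 1 < α) (hδ : 0 < δ) (β : ℝ) (k : ℕ) (s : ℝ) :
    IntervalIntegrable (fun b => (s - r * Real.cos b) ^ k * sqDist r δ s b ^ (-β) *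
      Real.sin b ^ (α - 1)) volume 0 Real.pi :=
  ((continuous_sphAvg_integrand hα hδ β k).comp (by fun_prop : Continuous fun b : ℝ => (s, b)))
    |>.intervalIntegrable _ _

theorem hasDerivAt_sphAvg (hα : 1 < α) (hδ : 0 < δ) (β : ℝ) (k : ℕ) (s : ℝ) :
    HasDerivAt (sphAvg α r δ β k)
      (k * sphAvg α r δ β (k - 1) s + -2 * β * sphAvg α r δ (β + 1) (k + 1) s) s := by
  set F' : ℝ → ℝ → ℝ := fun s b =>
    k * ((s - r * Real.cos b) ^ (k - 1) * sqDist r δ s b ^ (-β) * Real.sin b ^ (α - 1)) +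
    -2 * β * ((s - r * Real.cos b) ^ (k + 1) * sqDist r δ s b ^ (-(β + 1)) *
      Real.sin b ^ (α - 1)) with hF'
  have hF'c : Continuous (fun z : ℝ × ℝ => F' z.1 z.2) :=
    (continuous_const.mul (continuous_sphAvg_integrand hα hδ β (k - 1))).add
      (continuous_const.mul (continuous_sphAvg_integrand hα hδ (β + 1) (k + 1)))
  obtain ⟨M, hM⟩ := ((isCompact_Icc (a := s - 1) (b := s + 1)).prod
    (isCompact_Icc (a := (0 : ℝ)) (b := Real.pi))).exists_bound_of_continuousOn hF'c.continuousOn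
  have h := (intervalIntegral.hasDerivAt_integral_of_dominated_loc_of_deriv_le (μ := volume)
    (F := fun s b => (s - r * Real.cos b) ^ k * sqDist r δ s b ^ (-β) * Real.sin b ^ (α - 1))
    (F' := F') (x₀ := s) (s := Ioo (s - 1) (s + 1)) (a := 0) (b := Real.pi) (bound := fun _ => M)
    (Ioo_mem_nhds (by linarith) (by linarith)) ?_ (intervalIntegrable_sphAvg hα hδ β k s) ?_ ?_
    (by simp) ?_).2
  · have e : ∫ b in (0 : ℝ)..Real.pi, F' s b =
        k * sphAvg α r δ β (k - 1) s + -2 * β * sphAvg α r δ (β + 1) (k + 1) s := by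
      rw [hF', intervalIntegral.integral_add
        ((intervalIntegrable_sphAvg hα hδ β (k - 1) s).const_mul _)
        ((intervalIntegrable_sphAvg hα hδ (β + 1) (k + 1) s).const_mul _),
        intervalIntegral.integral_const_mul, intervalIntegral.integral_const_mul]
      rfl
    rw [e] at h
    exact h
  · exact Eventually.of_forall fun x => (intervalIntegrable_sphAvg hα hδ β k x).1.aestronglyMeasurable |>.mono_measure (by rw [uIoc_of_le Real.pi_pos.le])
  · exact ((hF'c.comp (by fun_prop : Continuous fun b : ℝ => (s, b)))).aestronglyMeasurable
  · refine Eventually.of_forall fun b hb x hx => hM (x, b) ⟨Ioo_subset_Icc_self hx, ?_⟩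
    rw [uIoc_of_le Real.pi_pos.le] at hb
    exact Ioc_subset_Icc_self hb
  · refine Eventually.of_forall fun b hb x hx => ?_
    have h1 : HasDerivAt (fun x => x - r * Real.cos b) 1 x := (hasDerivAt_id x).sub_const _
    have h2 : HasDerivAt (fun x => sqDist r δ x b) (2 * (x - r * Real.cos b)) x := by
      unfold sqDist
      convert! ((h1.pow 2).add_const _).add_const _ using 1
      simp
    have h3 := h2.rpow_const (p := -β) (Or.inl (sqDist_pos hδ x b).ne')
    have h4 := ((h1.fun_pow k).mul h3).mul_const (Real.sin b ^ (α - 1))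
    convert! h4 using 1
    simp only [hF']
    rw [show -(β + 1) = -β - 1 by ring]
    ring

theorem contDiff_sphAvg (hα : 1 < α) (hδ : 0 < δ) (β : ℝ) (k : ℕ) :
    ContDiff ℝ (⊤ : ℕ∞) (sphAvg α r δ β k) := by
  refine contDiff_infty.2 fun n => ?_
  induction n generalizing β k with
  | zero =>
    exact contDiff_zero.2 (continuous_iff_continuousAt.2 fun s =>
      (hasDerivAt_sphAvg hα hδ β k s).continuousAt)
  | succ n ih =>
    rw [Nat.cast_add, Nat.cast_one, contDiff_succ_iff_deriv]
    refine ⟨fun s => (hasDerivAt_sphAvg hα hδ β k s).differentiableAt, by simp, ?_⟩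
    rw [show deriv (sphAvg α r δ β k) = fun s =>
      k * sphAvg α r δ β (k - 1) s + -2 * β * sphAvg α r δ (β + 1) (k + 1) s from
      funext fun s => (hasDerivAt_sphAvg hα hδ β k s).deriv]
    exact (contDiff_const.mul (ih _ _)).add (contDiff_const.mul (ih _ _))

/-- Integration by parts in the angle. -/
theorem integral_angular_eq_zero (hα : 1 < α) (hδ : 0 < δ) (β s : ℝ) :
    ∫ b in (0 : ℝ)..Real.pi, (α * Real.cos b * sqDist r δ s b ^ (-(β + 1)) -
      2 * (β + 1) * r * s * Real.sin b ^ 2 * sqDist r δ s b ^ (-(β + 2))) *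
      Real.sin b ^ (α - 1) = 0 := by
  have hd : ∀ b ∈ uIcc 0 Real.pi, HasDerivAt
      (fun b => Real.sin b ^ α * sqDist r δ s b ^ (-(β + 1)))
      ((α * Real.cos b * sqDist r δ s b ^ (-(β + 1)) -
      2 * (β + 1) * r * s * Real.sin b ^ 2 * sqDist r δ s b ^ (-(β + 2))) *
      Real.sin b ^ (α - 1)) b := by
    intro b hb
    rw [uIcc_of_le Real.pi_pos.le] at hb
    have hs0 : 0 ≤ Real.sin b := Real.sin_nonneg_of_mem_Icc hb
    have h1 := (Real.hasDerivAt_sin b).rpow_const (p := α) (Or.inr hα.le)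
    have h2 : HasDerivAt (fun b => sqDist r δ s b) (2 * r * s * Real.sin b) b := by
      unfold sqDist
      have h3 := (((Real.hasDerivAt_cos b).const_mul r).const_sub s).fun_pow 2
      have h4 := (((Real.hasDerivAt_sin b).const_mul r)).fun_pow 2
      convert! (h3.add h4).add_const _ using 1
      simp
      ring
    have h3 := h2.rpow_const (p := -(β + 1)) (Or.inl (sqDist_pos hδ s b).ne')
    convert! h1.mul h3 using 1
    rw [show -(β + 1) - 1 = -(β + 2) by ring,
      show Real.sin b ^ α = Real.sin b ^ (α - 1) * Real.sin b by
        rw [← Real.rpow_add_one' hs0 (by linarith), sub_add_cancel]]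
    ring
  rw [intervalIntegral.integral_eq_sub_of_hasDerivAt hd]
  · rw [Real.sin_pi, Real.sin_zero, Real.zero_rpow (by linarith)]
    ring
  · refine Continuous.intervalIntegrable ?_ _ _
    have h1 : ∀ β : ℝ, Continuous fun b => sqDist r δ s b ^ β := fun β =>
      (continuous_sqDist_rpow hδ β).comp (by fun_prop : Continuous fun b : ℝ => (s, b))
    exact (((continuous_const.mul Real.continuous_cos).mul (h1 _)).sub
      ((continuous_const.mul (Real.continuous_sin.pow 2)).mul (h1 _))).mul (continuous_sin_rpow hα)

/-- The radial Laplacian of `(|x - P|² + δ²)^{-β}`, averaged over spheres. -/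
theorem lap_sphAvg (hα : 1 < α) (hδ : 0 < δ) (β : ℝ) (hs : 0 < s) :
    lap α (sphAvg α r δ β 0) s = 2 * β * (2 * β + 1 - α) * sphAvg α r δ (β + 1) 0 s -
      4 * β * (β + 1) * δ ^ 2 * sphAvg α r δ (β + 2) 0 s := by
  have hd : deriv (sphAvg α r δ β 0) = fun s => -2 * β * sphAvg α r δ (β + 1) 1 s := by
    ext s
    rw [(hasDerivAt_sphAvg hα hδ β 0 s).deriv]
    simp
  have hdd : deriv (deriv (sphAvg α r δ β 0)) s = -2 * β * (sphAvg α r δ (β + 1) 0 s +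
      -2 * (β + 1) * sphAvg α r δ (β + 2) 2 s) := by
    rw [hd, deriv_const_mul_field, (hasDerivAt_sphAvg hα hδ (β + 1) 1 s).deriv]
    simp only [Nat.cast_one, one_mul, Nat.sub_self]
    ring_nf
  rw [lap, hdd, hd]
  have hI := fun β k => intervalIntegrable_sphAvg (r := r) hα hδ β k s
  have key : -2 * β * sphAvg α r δ (β + 1) 0 s + 4 * β * (β + 1) * sphAvg α r δ (β + 2) 2 s +
      (-2 * α * β / s) * sphAvg α r δ (β + 1) 1 s +
      (-(2 * β * (2 * β + 1 - α))) * sphAvg α r δ (β + 1) 0 s +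
      4 * β * (β + 1) * δ ^ 2 * sphAvg α r δ (β + 2) 0 s = 0 := by
    unfold sphAvg
    have hm : ∀ (c : ℝ) (f : ℝ → ℝ), c * ∫ b in (0 : ℝ)..Real.pi, f b =
        ∫ b in (0 : ℝ)..Real.pi, c * f b := fun c f =>
      (intervalIntegral.integral_const_mul c f).symm
    simp only [hm]
    rw [← intervalIntegral.integral_add ((hI _ _).const_mul _) ((hI _ _).const_mul _),
      ← intervalIntegral.integral_add (((hI _ _).const_mul _).add ((hI _ _).const_mul _))
        ((hI _ _).const_mul _),
      ← intervalIntegral.integral_add ((((hI _ _).const_mul _).add ((hI _ _).const_mul _)).add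
        ((hI _ _).const_mul _)) ((hI _ _).const_mul _),
      ← intervalIntegral.integral_add (((((hI _ _).const_mul _).add ((hI _ _).const_mul _)).add
        ((hI _ _).const_mul _)).add ((hI _ _).const_mul _)) ((hI _ _).const_mul _)]
    have h0 := integral_angular_eq_zero (r := r) hα hδ β s
    have h0' := hm (2 * β * r / s) fun b =>
      (α * Real.cos b * sqDist r δ s b ^ (-(β + 1)) -
      2 * (β + 1) * r * s * Real.sin b ^ 2 * sqDist r δ s b ^ (-(β + 2))) *
      Real.sin b ^ (α - 1)
    rw [h0, mul_zero] at h0'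
    refine Eq.trans (intervalIntegral.integral_congr fun b _ => ?_) h0'.symm
    have hq := sqDist_pos (r := r) hδ s b
    have e : sqDist r δ s b ^ (-(β + 1)) = sqDist r δ s b * sqDist r δ s b ^ (-(β + 2)) := by
      rw [show -(β + 1) = 1 + -(β + 2) by ring, Real.rpow_add hq, Real.rpow_one]
    have e2 : (s - r * Real.cos b) ^ 2 = sqDist r δ s b - r ^ 2 * Real.sin b ^ 2 - δ ^ 2 := by
      unfold sqDist; ring
    simp only [e, pow_zero, one_mul, pow_one, e2]
    generalize sqDist r δ s b = q
    generalize q ^ (-(β + 2)) = Q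
    generalize Real.sin b ^ (α - 1) = W
    field_simp
    ring
  have e3 : α / s * (-2 * β * sphAvg α r δ (β + 1) 1 s) =
    (-2 * α * β / s) * sphAvg α r δ (β + 1) 1 s := by ring
  rw [e3]
  linear_combination key

theorem sqDist_ge (hδ : 0 < δ) (s b : ℝ) (hr : 0 ≤ r) (hs : 0 ≤ s) :
    δ ^ 2 / (r ^ 2 + δ ^ 2) * s ^ 2 ≤ sqDist r δ s b := by
  have h1 : (s - r) ^ 2 + δ ^ 2 ≤ sqDist r δ s b := by
    have : sqDist r δ s b = (s - r) ^ 2 + δ ^ 2 + 2 * (r * s) * (1 - Real.cos b) := by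
      unfold sqDist
      have := Real.sin_sq_add_cos_sq b
      linear_combination r ^ 2 * this
    rw [this]
    have h2 : 0 ≤ 1 - Real.cos b := by linarith [Real.cos_le_one b]
    have h3 : 0 ≤ r * s := mul_nonneg hr hs
    nlinarith
  refine le_trans ?_ h1
  rw [div_mul_eq_mul_div, div_le_iff₀ (by positivity)]
  nlinarith [sq_nonneg (r * s - (r ^ 2 + δ ^ 2))]

theorem powBound_sphAvg {ι : Type} (hα : 1 < α) (hδ : 0 < δ) (hr : 0 ≤ r) (hβ : 0 < β) (k : ℕ) :
    PowBound (Ici 1) (k - 2 * β) (fun _ : ι => sphAvg α r δ β k) := by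
  set c := δ ^ 2 / (r ^ 2 + δ ^ 2) with hc
  have hc0 : 0 < c := by positivity
  refine ⟨(1 + r) ^ k * c ^ (-β) * |Real.pi - 0|, fun _ s hs => ?_⟩
  have hs1 : 1 ≤ s := hs
  have hs0 : 0 < s := by linarith
  change |sphAvg α r δ β k s| ≤ _
  rw [mul_right_comm, ← Real.norm_eq_abs, sphAvg]
  refine intervalIntegral.norm_integral_le_of_norm_le_const fun b hb => ?_
  rw [uIoc_of_le Real.pi_pos.le] at hb
  have hsin : 0 ≤ Real.sin b := Real.sin_nonneg_of_mem_Icc (Ioc_subset_Icc_self hb)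
  have h1 : |s - r * Real.cos b| ≤ (1 + r) * s := by
    have h2 := Real.abs_cos_le_one b
    calc |s - r * Real.cos b| ≤ |s| + |r * Real.cos b| := abs_sub _ _
      _ ≤ s + r * 1 := by
        rw [abs_of_pos hs0, abs_mul, abs_of_nonneg hr]
        gcongr
      _ ≤ (1 + r) * s := by nlinarith
  have h2 : sqDist r δ s b ^ (-β) ≤ c ^ (-β) * s ^ (-2 * β) := by
    have h3 : s ^ (-2 * β) = (s ^ 2) ^ (-β) := by
      rw [← Real.rpow_natCast s 2, ← Real.rpow_mul hs0.le]; congr 1; push_cast; ring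
    rw [h3, ← Real.mul_rpow hc0.le (by positivity)]
    exact Real.rpow_le_rpow_of_nonpos (by positivity) (sqDist_ge hδ s b hr hs0.le) (by linarith)
  have h3 : Real.sin b ^ (α - 1) ≤ 1 := Real.rpow_le_one hsin (Real.sin_le_one b) (by linarith)
  have hq0 : 0 ≤ sqDist r δ s b ^ (-β) := Real.rpow_nonneg (sqDist_pos hδ s b).le _
  rw [Real.norm_eq_abs, abs_mul, abs_mul, abs_pow, abs_of_nonneg hq0,
    abs_of_nonneg (Real.rpow_nonneg hsin _)]
  calc |s - r * Real.cos b| ^ k * sqDist r δ s b ^ (-β) * Real.sin b ^ (α - 1)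
      ≤ ((1 + r) * s) ^ k * (c ^ (-β) * s ^ (-2 * β)) * 1 := by
        have := Real.rpow_nonneg hsin (α - 1)
        gcongr
    _ = (1 + r) ^ k * c ^ (-β) * s ^ ((k : ℝ) - 2 * β) := by
        rw [show (k : ℝ) - 2 * β = (k : ℝ) + -2 * β by ring, Real.rpow_add hs0, Real.rpow_natCast,
          mul_pow]
        ring

/-- Each derivative of a spherical average is again a combination of such averages, with one order of
decay more. -/
theorem tower_sphAvg {ι : Type} (hα : 1 < α) (hδ : 0 < δ) (hr : 0 ≤ r) (n : ℕ) :
    ∀ {β : ℝ} (_ : 0 < β) (k : ℕ),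
    Tower (PowBound (Ici 1)) n (k - 2 * β) (fun _ : ι => sphAvg α r δ β k) := by
  have hB := growthScale_powBound (ι := ι) (S := Ici 1) fun s (hs : 1 ≤ s) => by
    simp only [mem_Ioi]; linarith
  induction n with
  | zero => intro β hβ k; exact powBound_sphAvg hα hδ hr hβ k
  | succ n ih =>
    intro β hβ k
    refine ⟨fun _ s _ => (hasDerivAt_sphAvg hα hδ β k s).differentiableAt.differentiableWithinAt,
      powBound_sphAvg hα hδ hr hβ k, ?_⟩
    have h2 := (ih (β := β + 1) (by linarith) (k + 1)).const_mul hB (-2 * β)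
    rw [show ((k + 1 : ℕ) : ℝ) - 2 * (β + 1) = k - 2 * β - 1 by push_cast; ring] at h2
    rcases k with _ | k
    · refine h2.congr hB fun _ s _ => ?_
      rw [(hasDerivAt_sphAvg hα hδ β 0 s).deriv]
      simp
    · have h1 := (ih hβ k).const_mul hB ((k + 1 : ℕ) : ℝ)
      rw [show (k : ℝ) - 2 * β = ((k + 1 : ℕ) : ℝ) - 2 * β - 1 by push_cast; ring] at h1
      exact (h1.add hB h2).congr hB fun _ s _ => (hasDerivAt_sphAvg hα hδ β (k + 1) s).deriv.symm

end SphAvg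

/-! ### The polyharmonic operator on Riesz kernels -/

theorem lap_congr {α : ℝ} {U : Set ℝ} (hU : IsOpen U) {f g : ℝ → ℝ} (h : EqOn f g U) :
    EqOn (lap α f) (lap α g) U := by
  intro s hs
  have h1 : ∀ {f g : ℝ → ℝ}, EqOn f g U → EqOn (deriv f) (deriv g) U :=
    fun h s hs => (h.eventuallyEq_of_mem (hU.mem_nhds hs)).deriv_eq
  simp only [lap]
  rw [h1 (h1 h) hs, h1 h hs]

theorem lap_iterate_congr {α : ℝ} {U : Set ℝ} (hU : IsOpen U) (k : ℕ) : ∀ {f g : ℝ → ℝ},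
    EqOn f g U → EqOn ((lap α)^[k] f) ((lap α)^[k] g) U := by
  induction k with
  | zero => intro f g h; exact h
  | succ k ih => intro f g h; exact ih (lap_congr hU h)

theorem contDiffOn_lap {α : ℝ} {f : ℝ → ℝ} (hf : ContDiffOn ℝ (⊤ : ℕ∞) f (Ioi 0)) :
    ContDiffOn ℝ (⊤ : ℕ∞) (lap α f) (Ioi 0) := by
  have h1 := (contDiffOn_infty_iff_deriv_of_isOpen isOpen_Ioi).1 hf
  have h2 := (contDiffOn_infty_iff_deriv_of_isOpen isOpen_Ioi).1 h1.2
  exact h2.2.add ((contDiffOn_const.div contDiffOn_id fun s hs => ne_of_gt hs).mul h1.2)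

theorem lap_linear {α : ℝ} (a b : ℝ) {f g : ℝ → ℝ} (hf : ContDiffOn ℝ (⊤ : ℕ∞) f (Ioi 0))
    (hg : ContDiffOn ℝ (⊤ : ℕ∞) g (Ioi 0)) :
    EqOn (lap α (fun s => a * f s + b * g s)) (fun s => a * lap α f s + b * lap α g s) (Ioi 0) := by
  have hf1 := (contDiffOn_infty_iff_deriv_of_isOpen isOpen_Ioi).1 hf
  have hf2 := (contDiffOn_infty_iff_deriv_of_isOpen isOpen_Ioi).1 hf1.2
  have hg1 := (contDiffOn_infty_iff_deriv_of_isOpen isOpen_Ioi).1 hg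
  have hg2 := (contDiffOn_infty_iff_deriv_of_isOpen isOpen_Ioi).1 hg1.2
  have hd : ∀ {f g : ℝ → ℝ}, DifferentiableOn ℝ f (Ioi 0) → DifferentiableOn ℝ g (Ioi 0) →
      EqOn (deriv fun s => a * f s + b * g s) (fun s => a * deriv f s + b * deriv g s) (Ioi 0) := by
    intro f g hf hg s hs
    have h1 := (hf.differentiableAt (Ioi_mem_nhds hs)).hasDerivAt
    have h2 := (hg.differentiableAt (Ioi_mem_nhds hs)).hasDerivAt
    exact ((h1.const_mul a).add (h2.const_mul b)).deriv
  intro s hs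
  simp only [lap]
  rw [((hd hf1.1 hg1.1).eventuallyEq_of_mem (Ioi_mem_nhds hs)).deriv_eq, hd hf1.1 hg1.1 hs,
    hd hf2.1 hg2.1 hs]
  ring

theorem lap_iterate_linear {α : ℝ} (a b : ℝ) (k : ℕ) : ∀ {f g : ℝ → ℝ},
    ContDiffOn ℝ (⊤ : ℕ∞) f (Ioi 0) → ContDiffOn ℝ (⊤ : ℕ∞) g (Ioi 0) →
    EqOn ((lap α)^[k] (fun s => a * f s + b * g s))
      (fun s => a * (lap α)^[k] f s + b * (lap α)^[k] g s) (Ioi 0) := by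
  induction k with
  | zero => intro f g _ _ s _; rfl
  | succ k ih =>
    intro f g hf hg
    exact (lap_iterate_congr isOpen_Ioi k (lap_linear a b hf hg)).trans
      (ih (contDiffOn_lap hf) (contDiffOn_lap hg))

theorem constP_zero (α : ℝ) : constP 0 α = 1 := by simp [constP]

theorem constP_succ (m : ℕ) (α : ℝ) :
    constP (m + 1) α = (α + 1 - 2 * (m + 1)) * (α + 1 + 2 * m) * constP m α := by
  have e : Finset.Ico (-((m + 1 : ℕ) : ℤ)) ((m + 1 : ℕ) : ℤ) =
      insert (-((m + 1 : ℕ) : ℤ)) (insert (m : ℤ) (Finset.Ico (-(m : ℤ)) (m : ℤ))) := by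
    ext x
    simp only [Finset.mem_Ico, Finset.mem_insert]
    push_cast
    omega
  rw [constP, e, Finset.prod_insert (by
    simp only [Finset.mem_insert, Finset.mem_Ico]; push_cast; omega),
    Finset.prod_insert (by simp), constP]
  push_cast
  ring

theorem constP_pos {m : ℕ} {α : ℝ} (hα : α - 2 * (m : ℝ) + 1 > 0) : 0 < constP m α := by
  refine Finset.prod_pos fun h hh => ?_
  have : (-(m : ℤ) : ℝ) ≤ (h : ℝ) := by exact_mod_cast (Finset.mem_Ico.1 hh).1
  push_cast at this
  linarith

/-- `(-Δ)^m (|x - P|² + δ²)^{-(N/2 - m)} = 𝒫 δ^{2m} (|x - P|² + δ²)^{-(N/2 + m)}`, `N = α + 1`, after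
averaging over spheres. The induction relies on
`-Δ ρ^{-β} = 2β(N - 2 - 2β) ρ^{-β-1} + 4β(β+1) δ² ρ^{-β-2}`, `ρ = |x - P|² + δ²`. -/
theorem lap_iterate_sphAvg {α r δ : ℝ} (hα : 1 < α) (hδ : 0 < δ) (m : ℕ) : ∀ s, 0 < s →
    (lap α)^[m] (sphAvg α r δ ((α + 1) / 2 - m) 0) s =
      (-1) ^ m * constP m α * δ ^ (2 * m) * sphAvg α r δ ((α + 1) / 2 + m) 0 s := by
  induction m using Nat.strong_induction_on with
  | _ m ih =>
  intro s hs
  have hsm : ∀ β, ContDiffOn ℝ (⊤ : ℕ∞) (sphAvg α r δ β 0) (Ioi 0) := fun β =>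
    (contDiff_sphAvg hα hδ β 0).contDiffOn
  rcases m with _ | _ | m
  · simp [constP_zero]
  · rw [Function.iterate_one, lap_sphAvg hα hδ _ hs, constP_succ, constP_zero]
    push_cast
    rw [zero_add, show (α + 1) / 2 - 1 + 2 = (α + 1) / 2 + 1 by ring]
    ring
  · set h := (α + 1) / 2 with hh
    have hα' : α = 2 * h - 1 := by rw [hh]; ring
    have h1 : EqOn (lap α (sphAvg α r δ (h - (m + 1 + 1 : ℕ)) 0))
        (fun s => (-4 * (h - (m + 2)) * (m + 1)) * sphAvg α r δ (h - (m + 1 : ℕ)) 0 s +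
          (-4 * (h - (m + 2)) * (h - (m + 1)) * δ ^ 2) * sphAvg α r δ (h - (m : ℕ)) 0 s) (Ioi 0) := by
      intro s hs
      rw [lap_sphAvg hα hδ _ hs]
      push_cast
      rw [show h - ((m : ℝ) + 1 + 1) + 1 = h - (m + 1) by ring,
        show h - ((m : ℝ) + 1 + 1) + 2 = h - m by ring]
      linear_combination (-(2 * (h - ((m : ℝ) + 1 + 1)) * sphAvg α r δ (h - (m + 1)) 0 s)) * hα'
    rw [Function.iterate_succ_apply, lap_iterate_congr isOpen_Ioi (m + 1) h1 hs,
      lap_iterate_linear _ _ (m + 1) (hsm _) (hsm _) hs]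
    have h2 := ih (m + 1) (by omega) s hs
    have h3 : EqOn ((lap α)^[m] (sphAvg α r δ (h - (m : ℕ)) 0))
        (fun s => ((-1) ^ m * constP m α * δ ^ (2 * m)) * sphAvg α r δ (h + m) 0 s +
          0 * sphAvg α r δ (h + m) 0 s) (Ioi 0) := fun s hs => by
      simp only
      rw [ih m (by omega) s hs]; ring
    simp only
    rw [h2, Function.iterate_succ_apply', lap_congr isOpen_Ioi h3 hs, lap_linear _ _ (hsm _) (hsm _) hs]
    simp only
    rw [lap_sphAvg hα hδ _ hs, constP_succ (m + 1), constP_succ m]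
    push_cast
    rw [show h + (m : ℝ) + 1 = h + (m + 1) by ring, show h + (m : ℝ) + 2 = h + (m + 1 + 1) by ring]
    generalize sphAvg α r δ (h + (m + 1)) 0 s = A
    generalize sphAvg α r δ (h + (m + 1 + 1)) 0 s = A'
    rw [hα']
    ring

/-! ### Decay of functions of finite energy -/

/-- Integrating a bound `|f'| ≤ ε t^{-a-1}` from infinity. -/
theorem abs_le_of_deriv_bound {f f' : ℝ → ℝ} {ε a R : ℝ} (ha : 0 < a) (hR : 0 < R)
    (hf : ∀ t, 0 < t → HasDerivAt f (f' t) t) (hlim : Tendsto f atTop (𝓝 0))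
    (hb : ∀ t, R ≤ t → |f' t| ≤ ε * t ^ (-(a + 1))) :
    ∀ t, R ≤ t → |f t| ≤ (ε / a) * t ^ (-a) := by
  have key : ∀ {f f' : ℝ → ℝ}, (∀ t, 0 < t → HasDerivAt f (f' t) t) → Tendsto f atTop (𝓝 0) →
      (∀ t, R ≤ t → f' t ≤ ε * t ^ (-(a + 1))) → ∀ t, R ≤ t → 0 ≤ f t + (ε / a) * t ^ (-a) := by
    intro f f' hf hlim hb t ht
    have hd : ∀ t, 0 < t → HasDerivAt (fun t => f t + (ε / a) * t ^ (-a))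
        (f' t - ε * t ^ (-(a + 1))) t := by
      intro t ht
      have h := (hf t ht).add ((Real.hasDerivAt_rpow_const (p := -a) (Or.inl ht.ne')).const_mul
        (ε / a))
      convert! h using 1
      rw [show -(a + 1) = -a - 1 by ring]
      field_simp
      ring
    have hanti : AntitoneOn (fun t => f t + (ε / a) * t ^ (-a)) (Ici R) := by
      refine antitoneOn_of_deriv_nonpos (convex_Ici R) (fun t ht =>
        (hd t (hR.trans_le ht)).continuousAt.continuousWithinAt) (fun t ht => ?_) fun t ht => ?_
      · rw [interior_Ici] at ht
        exact (hd t (hR.trans ht)).differentiableAt.differentiableWithinAt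
      · rw [interior_Ici] at ht
        rw [(hd t (hR.trans ht)).deriv]
        linarith [hb t (le_of_lt ht)]
    have hl : Tendsto (fun t => f t + (ε / a) * t ^ (-a)) atTop (𝓝 0) := by
      simpa using hlim.add ((tendsto_rpow_neg_atTop ha).const_mul (ε / a))
    refine le_of_tendsto hl ?_
    filter_upwards [eventually_ge_atTop t] with S hS
    exact hanti ht (ht.trans hS) hS
  intro t ht
  rw [abs_le]
  constructor
  · linarith [key hf hlim (fun t ht => (abs_le.1 (hb t ht)).2) t ht]
  · have := key (f := fun t => -f t) (f' := fun t => -f' t) (fun t ht => (hf t ht).neg)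
      (by simpa using hlim.neg) (fun t ht => by linarith [(abs_le.1 (hb t ht)).1]) t ht
    linarith

/-- Elements of `𝒟^{m,2}_∞(α)` are `o(r^{-(α+1-2m)/2})` at infinity. -/
theorem MemD.isLittleO {m : ℕ} (hm : 1 ≤ m) {α : ℝ} (hα : α - 2 * (m : ℝ) + 1 > 0) {v : ℝ → ℝ}
    (hv : MemD m α v) {ε : ℝ} (hε : 0 < ε) :
    ∃ R : ℝ, 1 ≤ R ∧ ∀ s, R ≤ s → |v s| ≤ ε * s ^ (-((α + 1) / 2 - m)) := by
  obtain ⟨n, rfl⟩ : ∃ n, m = n + 1 := ⟨m - 1, by omega⟩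
  obtain ⟨⟨hc, hac⟩, hlim, hint⟩ := hv
  simp only [Nat.add_sub_cancel] at hc hac hlim
  push_cast at hα ⊢
  set γ := (α + 1) / 2 - ((n : ℝ) + 1) with hγ
  have hγ0 : 0 < γ := by rw [hγ]; linarith
  have hα1 : 0 < α - 1 := by have : (0 : ℝ) ≤ n := Nat.cast_nonneg n; linarith
  have htop : ∀ ε : ℝ, 0 < ε → ∃ R : ℝ, 1 ≤ R ∧ ∀ s, R ≤ s →
      |iteratedDeriv n v s| ≤ ε * s ^ (-(γ + n)) := by
    intro ε hε
    set η := ε / (1 + 1 / (α - 1)) with hη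
    have hη0 : 0 < η := by positivity
    have hηε : η * (1 + 1 / (α - 1)) = ε := by rw [hη]; field_simp
    have htail : Tendsto (fun s => ∫ t in Ioi s, iteratedDeriv (n + 1) v t ^ 2 * t ^ α) atTop
        (𝓝 0) := by
      have h1 := intervalIntegral_tendsto_integral_Ioi 0 hint tendsto_id
      have h2 := h1.const_sub (∫ t in Ioi (0 : ℝ), iteratedDeriv (n + 1) v t ^ 2 * t ^ α)
      rw [sub_self] at h2
      refine h2.congr' ?_
      filter_upwards [eventually_gt_atTop 0] with s hs
      have := intervalIntegral.integral_interval_add_Ioi hint (hint.mono_set (Ioi_subset_Ioi hs.le))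
      simp only [id]
      linarith
    obtain ⟨R, hR⟩ := ((htail.eventually (eventually_lt_nhds (by positivity : 0 < η ^ 2))).and
      (eventually_ge_atTop 1)).exists_forall_of_atTop
    refine ⟨R, (hR R le_rfl).2, fun s hs => ?_⟩
    obtain ⟨hE, hs1⟩ := hR s hs
    have hs0 : 0 < s := by linarith
    set l := s ^ ((1 - α) / 2) with hl
    have hl0 : 0 < l := Real.rpow_pos_of_pos hs0 _
    have hl2 : s ^ (1 - α) = l ^ 2 := by
      rw [hl, ← Real.rpow_natCast, ← Real.rpow_mul hs0.le]; congr 1; push_cast; ring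
    -- `|f'| ≤ (λ f'² t^α + λ⁻¹ t^{-α}) / 2` with `λ = l / η`
    have hdom : IntegrableOn (fun t : ℝ => (l / η) * (iteratedDeriv (n + 1) v t ^ 2 * t ^ α) +
        (η / l) * t ^ (-α)) (Ioi s) :=
      ((hint.mono_set (Ioi_subset_Ioi hs0.le)).const_mul _).add
        ((integrableOn_Ioi_rpow_of_lt (by linarith) hs0).const_mul _)
    have hbd : ∀ S, s ≤ S → |iteratedDeriv n v S - iteratedDeriv n v s| ≤ ε * l := by
      intro S hS
      have h1 := (hac s S hs0 hS).integral_deriv_eq_sub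
      rw [← h1, ← iteratedDeriv_succ, intervalIntegral.integral_of_le hS]
      have h2 : |∫ t in Ioc s S, iteratedDeriv (n + 1) v t| ≤ ∫ t in Ioc s S,
          ((l / η) * (iteratedDeriv (n + 1) v t ^ 2 * t ^ α) + (η / l) * t ^ (-α)) := by
        refine norm_integral_le_of_norm_le (f := iteratedDeriv (n + 1) v) (hdom.mono_set Ioc_subset_Ioi_self) ?_
        filter_upwards [ae_restrict_mem measurableSet_Ioc] with t ht
        have ht0 : 0 < t := hs0.trans ht.1
        set p := t ^ α with hp
        have hp0 : 0 < p := Real.rpow_pos_of_pos ht0 _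
        rw [Real.rpow_neg ht0.le, ← hp, Real.norm_eq_abs, ← sq_abs (iteratedDeriv (n + 1) v t)]
        set y := |iteratedDeriv (n + 1) v t| with hy
        have hy0 : 0 ≤ y := abs_nonneg _
        rw [← sub_nonneg]
        have e : l / η * (y ^ 2 * p) + η / l * p⁻¹ - y = ((l * y * p - η) ^ 2 + l * η * p * y) /
            (l * η * p) := by
          field_simp; ring
        rw [e]
        positivity
      have h3 : ∫ t in Ioc s S, ((l / η) * (iteratedDeriv (n + 1) v t ^ 2 * t ^ α) +
          (η / l) * t ^ (-α)) ≤ ∫ t in Ioi s, ((l / η) * (iteratedDeriv (n + 1) v t ^ 2 * t ^ α) +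
          (η / l) * t ^ (-α)) := by
        refine setIntegral_mono_set hdom ?_ Ioc_subset_Ioi_self.eventuallyLE
        filter_upwards [ae_restrict_mem measurableSet_Ioi] with t ht
        have ht0 : 0 < t := hs0.trans ht
        simp only [Pi.zero_apply]
        positivity
      refine (h2.trans h3).trans ?_
      rw [integral_add ((hint.mono_set (Ioi_subset_Ioi hs0.le)).const_mul _)
        ((integrableOn_Ioi_rpow_of_lt (by linarith) hs0).const_mul _), integral_const_mul,
        integral_const_mul, integral_Ioi_rpow_of_lt (by linarith) hs0,
        show -α + 1 = 1 - α by ring, hl2]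
      have h4 : l / η * ∫ t in Ioi s, iteratedDeriv (n + 1) v t ^ 2 * t ^ α ≤ l / η * η ^ 2 :=
        mul_le_mul_of_nonneg_left hE.le (by positivity)
      have h5 : η / l * (-l ^ 2 / (1 - α)) = l * η * (1 / (α - 1)) := by
        have : 1 - α ≠ 0 := by linarith
        have : α - 1 ≠ 0 := by linarith
        field_simp
        ring
      have h6 : l / η * η ^ 2 = l * η := by field_simp
      rw [h5]
      calc _ ≤ l * η + l * η * (1 / (α - 1)) := by linarith
        _ = ε * l := by rw [← hηε]; ring
    have h7 : Tendsto (fun S => |iteratedDeriv n v S - iteratedDeriv n v s|) atTop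
        (𝓝 |0 - iteratedDeriv n v s|) := ((hlim n le_rfl).sub_const _).abs
    have h8 := le_of_tendsto h7 (by
      filter_upwards [eventually_ge_atTop s] with S hS using hbd S hS)
    rw [zero_sub, abs_neg] at h8
    have e : -(γ + n) = (1 - α) / 2 := by rw [hγ]; ring
    rwa [e]
  have hall : ∀ k ≤ n, ∀ ε : ℝ, 0 < ε → ∃ R : ℝ, 1 ≤ R ∧ ∀ s, R ≤ s →
      |iteratedDeriv (n - k) v s| ≤ ε * s ^ (-(γ + (n - k : ℕ))) := by
    intro k
    induction k with
    | zero => intro _; simpa using htop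
    | succ k ih =>
      intro hk ε hε
      set j := n - (k + 1) with hj
      have hj1 : n - k = j + 1 := by omega
      have ha : 0 < γ + j := by positivity
      obtain ⟨R, hR1, hR⟩ := ih (by omega) (ε * (γ + j)) (by positivity)
      rw [hj1] at hR
      refine ⟨R, hR1, fun s hs => ?_⟩
      have hd : ∀ t, 0 < t → HasDerivAt (iteratedDeriv j v) (iteratedDeriv (j + 1) v t) t := by
        intro t ht
        rw [iteratedDeriv_succ]
        have h1 := hc.differentiableOn_iteratedDerivWithin (m := j) (by norm_cast; omega)
          (uniqueDiffOn_Ioi 0)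
        have h2 : EqOn (iteratedDerivWithin j v (Ioi 0)) (iteratedDeriv j v) (Ioi 0) :=
          iteratedDerivWithin_of_isOpen isOpen_Ioi
        exact ((h1.congr fun x hx => (h2 hx).symm).differentiableAt (Ioi_mem_nhds ht)).hasDerivAt
      have h := abs_le_of_deriv_bound ha (by linarith) hd (hlim j (by omega)) (fun t ht => by
        have := hR t ht
        push_cast at this
        rwa [← add_assoc] at this) s hs
      rwa [mul_div_assoc, div_self ha.ne', mul_one] at h
  have := hall n le_rfl ε hε
  simpa using this

/-! ### The equation tested against a Riesz kernel -/

/-- Rescalings of a smooth function supported in `[1,2]`. -/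
theorem tower_rescale (n : ℕ) : ∀ {g : ℝ → ℝ} (κ : ℝ), ContDiff ℝ (⊤ : ℕ∞) g →
    (∀ x, x ∉ Icc (1 : ℝ) 2 → g x = 0) →
    Tower (PowBound (Ici 1)) n κ (fun (j : ℕ) s => ((j : ℝ) + 1) ^ κ * g (s / (j + 1))) := by
  have h0 : ∀ {g : ℝ → ℝ} (κ : ℝ), Continuous g → (∀ x, x ∉ Icc (1 : ℝ) 2 → g x = 0) →
      PowBound (Ici 1) κ (fun (j : ℕ) s => ((j : ℝ) + 1) ^ κ * g (s / (j + 1))) := by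
    intro g κ hg hz
    obtain ⟨M, hM⟩ := (isCompact_Icc (a := (1 : ℝ)) (b := 2)).exists_bound_of_continuousOn
      (f := fun x => g x * x ^ (-κ)) (hg.continuousOn.mul
      (fun x hx => (Real.continuousAt_rpow_const x (-κ) (Or.inl (by
        have := hx.1; linarith))).continuousWithinAt))
    refine ⟨max M 0, fun j s hs => ?_⟩
    have hs1 : 1 ≤ s := hs
    have hs0 : 0 < s := by linarith
    have hj : (0 : ℝ) < (j : ℝ) + 1 := by positivity
    by_cases hx : s / ((j : ℝ) + 1) ∈ Icc (1 : ℝ) 2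
    · have h1 := hM _ hx
      have h2 : ((j : ℝ) + 1) ^ κ = s ^ κ * (s / ((j : ℝ) + 1)) ^ (-κ) := by
        rw [Real.rpow_neg (by positivity), Real.div_rpow hs0.le hj.le]
        have := Real.rpow_pos_of_pos hs0 κ
        field_simp
      rw [Real.norm_eq_abs] at h1
      simp only
      rw [h2, show s ^ κ * (s / ((j : ℝ) + 1)) ^ (-κ) * g (s / (j + 1)) =
        (g (s / (j + 1)) * (s / ((j : ℝ) + 1)) ^ (-κ)) * s ^ κ by ring, abs_mul,
        abs_of_nonneg (Real.rpow_nonneg hs0.le κ)]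
      exact mul_le_mul_of_nonneg_right (h1.trans (le_max_left _ _)) (Real.rpow_nonneg hs0.le κ)
    · simp only
      rw [hz _ hx, mul_zero, abs_zero]
      exact mul_nonneg (le_max_right _ _) (Real.rpow_nonneg hs0.le κ)
  induction n with
  | zero => intro g κ hg hz; exact h0 κ hg.continuous hz
  | succ n ih =>
    intro g κ hg hz
    have hg' := contDiff_deriv hg
    have hz' : ∀ x, x ∉ Icc (1 : ℝ) 2 → deriv g x = 0 := by
      intro x hx
      have : g =ᶠ[𝓝 x] fun _ => 0 := by
        filter_upwards [isClosed_Icc.isOpen_compl.mem_nhds hx] with y hy using hz y hy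
      rw [this.deriv_eq, deriv_const]
    have hd : ∀ (j : ℕ) (s : ℝ), HasDerivAt (fun s => ((j : ℝ) + 1) ^ κ * g (s / (j + 1)))
        (((j : ℝ) + 1) ^ (κ - 1) * deriv g (s / (j + 1))) s := by
      intro j s
      have hj : (0 : ℝ) < (j : ℝ) + 1 := by positivity
      have h1 := ((hg'.1 (s / (j + 1))).hasDerivAt.comp s
        ((hasDerivAt_id s).div_const ((j : ℝ) + 1))).const_mul (((j : ℝ) + 1) ^ κ)
      convert! h1 using 1
      rw [Real.rpow_sub_one hj.ne']
      ring
    exact ⟨fun j s _ => (hd j s).differentiableAt.differentiableWithinAt, h0 κ hg.continuous hz,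
      (ih (κ - 1) hg'.2 hz').congr (growthScale_powBound fun s (hs : 1 ≤ s) => by
        simp only [mem_Ioi]; linarith) fun j s _ => (hd j s).deriv.symm⟩

/-- A smooth cutoff, equal to `1` on `(-∞,1]` and to `0` on `[2,∞)`. -/
noncomputable def cutoff (x : ℝ) : ℝ := Real.smoothTransition (2 - x)

theorem contDiff_cutoff : ContDiff ℝ (⊤ : ℕ∞) cutoff :=
  Real.smoothTransition.contDiff.comp (contDiff_const.sub contDiff_id)

theorem cutoff_eq_one {x : ℝ} (hx : x ≤ 1) : cutoff x = 1 :=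
  Real.smoothTransition.one_of_one_le (by linarith)

theorem cutoff_eq_zero {x : ℝ} (hx : 2 ≤ x) : cutoff x = 0 :=
  Real.smoothTransition.zero_of_nonpos (by linarith)

theorem abs_cutoff_le (x : ℝ) : |cutoff x| ≤ 1 := by
  rw [cutoff, abs_of_nonneg (Real.smoothTransition.nonneg _)]
  exact Real.smoothTransition.le_one _

theorem tower_cutoff (n : ℕ) :
    Tower (PowBound (Ici 1)) n 0 (fun (j : ℕ) s => cutoff (s / (j + 1))) := by
  have h0 : PowBound (Ici 1) 0 (fun (j : ℕ) s => cutoff (s / (j + 1))) :=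
    ⟨1, fun j s _ => by simpa using abs_cutoff_le _⟩
  rcases n with _ | n
  · exact h0
  have hd : ∀ (j : ℕ) (s : ℝ), HasDerivAt (fun s => cutoff (s / (j + 1)))
      (((j : ℝ) + 1) ^ (0 - 1 : ℝ) * deriv cutoff (s / (j + 1))) s := by
    intro j s
    have h1 := ((contDiff_deriv contDiff_cutoff).1 (s / (j + 1))).hasDerivAt.comp s
      ((hasDerivAt_id s).div_const ((j : ℝ) + 1))
    convert! h1 using 1
    rw [zero_sub, Real.rpow_neg_one]
    ring
  have hz : ∀ x, x ∉ Icc (1 : ℝ) 2 → deriv cutoff x = 0 := by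
    intro x hx
    rcases lt_or_ge x 1 with h | h
    · have : cutoff =ᶠ[𝓝 x] fun _ => 1 := by
        filter_upwards [Iio_mem_nhds h] with y hy using cutoff_eq_one (le_of_lt hy)
      rw [this.deriv_eq, deriv_const]
    · have h2 : 2 < x := not_le.1 fun h' => hx ⟨h, h'⟩
      have : cutoff =ᶠ[𝓝 x] fun _ => 0 := by
        filter_upwards [Ioi_mem_nhds h2] with y hy using cutoff_eq_zero (le_of_lt hy)
      rw [this.deriv_eq, deriv_const]
  exact ⟨fun j s _ => (hd j s).differentiableAt.differentiableWithinAt, h0,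
    (tower_rescale n (0 - 1) (contDiff_deriv contDiff_cutoff).2 hz).congr
      (growthScale_powBound fun s (hs : 1 ≤ s) => by simp only [mem_Ioi]; linarith)
      fun j s _ => (hd j s).deriv.symm⟩

/-- Dominated convergence on the half-line, with the dominating function `C s^α` on `(0,1)` and
`C s^{-γ-1}` on `[1,∞)`. -/
theorem tendsto_integral_of_pow_bounds {α γ C : ℝ} (hα : -1 < α) (hγ : 0 < γ) {F : ℕ → ℝ → ℝ}
    {G : ℝ → ℝ} (hF : ∀ n, ContinuousOn (F n) (Ioi 0))
    (h0 : ∀ n, ∀ s ∈ Ioo (0 : ℝ) 1, |F n s| ≤ C * s ^ α)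
    (h1 : ∀ n s, 1 ≤ s → |F n s| ≤ C * s ^ (-γ - 1))
    (hlim : ∀ s, 0 < s → Tendsto (fun n => F n s) atTop (𝓝 (G s))) :
    Tendsto (fun n => ∫ s in Ioi (0 : ℝ), F n s) atTop (𝓝 (∫ s in Ioi (0 : ℝ), G s)) ∧
      IntegrableOn G (Ioi 0) := by
  set b : ℝ → ℝ := fun s => (Ioo (0 : ℝ) 1).indicator (fun s => C * s ^ α) s +
    (Ici (1 : ℝ)).indicator (fun s => C * s ^ (-γ - 1)) s with hb
  have hbi : IntegrableOn b (Ioi 0) := by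
    refine Integrable.add ?_ ?_
    · refine (integrable_indicator_iff measurableSet_Ioo).2 ?_ |>.mono_measure Measure.restrict_le_self
      exact (((intervalIntegral.intervalIntegrable_rpow' hα (a := 0) (b := 1)).const_mul C).1).mono_set
        Ioo_subset_Ioc_self
    · refine (integrable_indicator_iff measurableSet_Ici).2 ?_ |>.mono_measure Measure.restrict_le_self
      have h := (integrableOn_Ioi_rpow_of_lt (by linarith : -γ - 1 < -1)
        (by norm_num : (0 : ℝ) < 1 / 2)).const_mul C
      exact IntegrableOn.mono_set h fun s (hs : 1 ≤ s) => by simp only [mem_Ioi]; linarith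
  have hle : ∀ n s, 0 < s → ‖F n s‖ ≤ b s := by
    intro n s hs
    simp only [hb]
    rcases lt_or_ge s 1 with h | h
    · rw [indicator_of_mem (show s ∈ Ioo (0 : ℝ) 1 from ⟨hs, h⟩),
        indicator_of_notMem (by simpa using h), add_zero]
      exact h0 n s ⟨hs, h⟩
    · rw [indicator_of_notMem (by simp [h]), indicator_of_mem (show s ∈ Ici (1 : ℝ) from h), zero_add]
      exact h1 n s h
  have hm : ∀ n, AEStronglyMeasurable (F n) (volume.restrict (Ioi 0)) := fun n =>
    (hF n).aestronglyMeasurable measurableSet_Ioi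
  have hlim' : ∀ᵐ s ∂(volume.restrict (Ioi (0 : ℝ))), Tendsto (fun n => F n s) atTop (𝓝 (G s)) := by
    filter_upwards [ae_restrict_mem measurableSet_Ioi] with s hs using hlim s hs
  refine ⟨tendsto_integral_of_dominated_convergence b hm hbi (fun n => by
    filter_upwards [ae_restrict_mem measurableSet_Ioi] with s hs using hle n s hs) hlim', ?_⟩
  refine Integrable.mono' hbi (aestronglyMeasurable_of_tendsto_ae _ hm hlim') ?_
  filter_upwards [ae_restrict_mem measurableSet_Ioi] with s hs
  exact le_of_tendsto (hlim s hs).norm (Eventually.of_forall fun n => hle n s hs)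

/-- The equation for `v`, tested against the average of `(|x - P|² + δ²)^{-(N/2 - m)}`. -/
theorem integral_mul_sphAvg {m : ℕ} (hm : 1 ≤ m) {α : ℝ} (hα : α - 2 * (m : ℝ) + 1 > 0)
    {v : ℝ → ℝ} (hv : MemD m α v) (hns : Nonsingular (2 * m - 1) v)
    (hsol : IsWeakSolution m α v ∨ IsClassicalSolution m α v) {M : ℝ}
    (hM : ∀ s, 0 < s → |v s| ≤ M) (hM' : ∀ s, 1 ≤ s → |v s| ≤ M * s ^ (-((α + 1) / 2 - m)))
    {r δ : ℝ} (hr : 0 ≤ r) (hδ : 0 < δ) :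
    IntegrableOn (fun s => v s * sphAvg α r δ ((α + 1) / 2 + m) 0 s * s ^ α) (Ioi 0) ∧
    IntegrableOn (fun s => |v s| ^ (critExp m α - 2) * v s *
      sphAvg α r δ ((α + 1) / 2 - m) 0 s * s ^ α) (Ioi 0) ∧
    constP m α * δ ^ (2 * m) *
      ∫ s in Ioi (0 : ℝ), v s * sphAvg α r δ ((α + 1) / 2 + m) 0 s * s ^ α =
    ∫ s in Ioi (0 : ℝ), |v s| ^ (critExp m α - 2) * v s *
      sphAvg α r δ ((α + 1) / 2 - m) 0 s * s ^ α := by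
  have hm1 : (1 : ℝ) ≤ m := by exact_mod_cast hm
  have hα1 : 1 < α := by linarith
  set γ := (α + 1) / 2 - m with hγ
  have hγ0 : 0 < γ := by rw [hγ]; linarith
  have hM0 : 0 ≤ M := (abs_nonneg _).trans (hM 1 one_pos)
  set q := critExp m α - 2 with hq
  have hqγ : γ * q = 2 * m := by
    rw [hq, hγ, critExp]
    have : α - 2 * m + 1 ≠ 0 := hα.ne'
    field_simp
    ring
  have hq0 : 0 ≤ q := by
    by_contra h
    have := mul_neg_of_pos_of_neg hγ0 (not_le.1 h)
    linarith
  have hvc : ContinuousOn v (Ioi 0) := hv.1.1.continuousOn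
  set A := sphAvg α r δ γ 0 with hA
  have hAs : ContDiff ℝ (⊤ : ℕ∞) A := contDiff_sphAvg hα1 hδ γ 0
  set φ : ℕ → ℝ → ℝ := fun n s => cutoff (s / (n + 1)) * A s with hφ
  have hφs : ∀ n, ContDiff ℝ (⊤ : ℕ∞) (φ n) := fun n =>
    (contDiff_cutoff.comp (contDiff_id.div_const _)).mul hAs
  have hφz : ∀ n : ℕ, ∀ s, 2 * ((n : ℝ) + 1) < s → φ n s = 0 := by
    intro n s hs
    have hj : (0 : ℝ) < (n : ℝ) + 1 := by positivity
    simp only [hφ]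
    rw [cutoff_eq_zero ((le_div_iff₀ hj).2 hs.le), zero_mul]
  have hφA : ∀ n : ℕ, EqOn (φ n) A (Iio ((n : ℝ) + 1)) := by
    intro n s hs
    have hj : (0 : ℝ) < (n : ℝ) + 1 := by positivity
    simp only [hφ]
    rw [cutoff_eq_one ((div_le_one hj).2 (le_of_lt hs)), one_mul]
  have hB := growthScale_powBound (ι := ℕ) (S := Ici 1) fun s (hs : 1 ≤ s) => by
    simp only [mem_Ioi]; linarith
  have hφt : Tower (PowBound (Ici 1)) (0 + 2 * m) (0 + (((0 : ℕ) : ℝ) - 2 * γ)) φ :=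
    (tower_cutoff _).mul hB (tower_sphAvg hα1 hδ hr _ hγ0 0)
  obtain ⟨C₁, hC₁⟩ := hφt.base
  obtain ⟨C₂, hC₂⟩ := hφt.lap_iterate hB α m
  obtain ⟨C₃, hC₃⟩ := (isCompact_Icc (a := (0 : ℝ)) (b := 1)).exists_bound_of_continuousOn
    hAs.continuous.continuousOn
  obtain ⟨C₄, hC₄⟩ := (isCompact_Icc (a := (0 : ℝ)) (b := 1)).exists_bound_of_continuousOn
    (continuous_const.mul (contDiff_sphAvg (r := r) hα1 hδ ((α + 1) / 2 + m) 0).continuous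
      : Continuous fun s => constP m α * δ ^ (2 * m) * sphAvg α r δ ((α + 1) / 2 + m) 0 s).continuousOn
  have hlapA : ∀ s, 0 < s → polyharmonic m α A s =
      constP m α * δ ^ (2 * m) * sphAvg α r δ ((α + 1) / 2 + m) 0 s := by
    intro s hs
    rw [polyharmonic_eq, hA, hγ, lap_iterate_sphAvg hα1 hδ m s hs, ← mul_assoc, ← mul_assoc,
      ← mul_assoc, ← pow_add, Even.neg_one_pow ⟨m, rfl⟩, one_mul]
  have hlapφ : ∀ n : ℕ, ∀ s, s < (n : ℝ) + 1 → polyharmonic m α (φ n) s = polyharmonic m α A s := by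
    intro n s hs
    rw [polyharmonic_eq, polyharmonic_eq, lap_iterate_congr isOpen_Iio m (hφA n) hs]
  have hlapc : ∀ n, ContinuousOn (polyharmonic m α (φ n)) (Ioi 0) := by
    intro n
    have h : ∀ k, ContDiffOn ℝ (⊤ : ℕ∞) ((lap α)^[k] (φ n)) (Ioi 0) := by
      intro k
      induction k with
      | zero => exact (hφs n).contDiffOn
      | succ k ih => rw [Function.iterate_succ_apply']; exact contDiffOn_lap ih
    exact (continuousOn_const.mul (h m).continuousOn).congr fun s _ => polyharmonic_eq m α (φ n) s
  have hev : ∀ s : ℝ, ∀ᶠ n : ℕ in atTop, s < (n : ℝ) + 1 := fun s => by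
    obtain ⟨k, hk⟩ := exists_nat_gt s
    filter_upwards [eventually_ge_atTop k] with n hn
    have : (k : ℝ) ≤ n := by exact_mod_cast hn
    linarith
  have hrp : ContinuousOn (fun s : ℝ => s ^ α) (Ioi 0) := (LocAC.rpow α).continuousOn
  have hlt1 : ∀ (n : ℕ) (s : ℝ), s < 1 → s < (n : ℝ) + 1 := fun n s hs =>
    hs.trans_le (by linarith [(Nat.cast_nonneg n : (0 : ℝ) ≤ n)])
  -- on `[1,∞)` both integrands are `O(s^{-γ-1})`
  have hL := tendsto_integral_of_pow_bounds (α := α) (γ := γ) (C := M * max C₄ C₂)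
    (F := fun n s => v s * polyharmonic m α (φ n) s * s ^ α)
    (G := fun s => v s * polyharmonic m α A s * s ^ α) (by linarith) hγ0
    (fun n => (hvc.mul (hlapc n)).mul hrp) (fun n s hs => by
      rw [abs_mul, abs_mul, abs_of_nonneg (Real.rpow_nonneg hs.1.le α),
        hlapφ n s (hlt1 n s hs.2), hlapA s hs.1]
      refine mul_le_mul_of_nonneg_right (mul_le_mul (hM s hs.1)
        ((hC₄ s (Ioo_subset_Icc_self hs)).trans (le_max_left _ _)) (abs_nonneg _) hM0)
        (Real.rpow_nonneg hs.1.le α))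
    (fun n s hs => by
      have hs0 : 0 < s := by linarith
      have h1 : |polyharmonic m α (φ n) s| ≤ max C₄ C₂ * s ^ (-2 * γ - 2 * m) := by
        rw [polyharmonic_eq, abs_mul, abs_pow, abs_neg, abs_one, one_pow, one_mul]
        have := hC₂ n s hs
        rw [show (0 : ℝ) + (((0 : ℕ) : ℝ) - 2 * γ) - 2 * m = -2 * γ - 2 * m by push_cast; ring] at this
        exact this.trans (mul_le_mul_of_nonneg_right (le_max_right _ _) (Real.rpow_nonneg hs0.le _))
      have e : s ^ (-γ - 1) = s ^ (-γ) * s ^ (-2 * γ - 2 * m) * s ^ α := by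
        rw [← Real.rpow_add hs0, ← Real.rpow_add hs0]; congr 1; rw [hγ]; ring
      rw [abs_mul, abs_mul, abs_of_nonneg (Real.rpow_nonneg hs0.le α), e, ← mul_assoc]
      refine mul_le_mul_of_nonneg_right ?_ (Real.rpow_nonneg hs0.le α)
      rw [show M * max C₄ C₂ * (s ^ (-γ) * s ^ (-2 * γ - 2 * m)) =
        (M * s ^ (-γ)) * (max C₄ C₂ * s ^ (-2 * γ - 2 * m)) by ring]
      exact mul_le_mul (hM' s hs) h1 (abs_nonneg _) ((abs_nonneg _).trans (hM' s hs)))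
    (fun s _ => by
      refine tendsto_const_nhds.congr' ?_
      filter_upwards [hev s] with n hn
      rw [hlapφ n s hn])
  have hvq : ∀ s, ‖|v s| ^ q * v s‖ = |v s| ^ q * |v s| := fun s => by
    rw [Real.norm_eq_abs, abs_mul, abs_of_nonneg (Real.rpow_nonneg (abs_nonneg _) _)]
  have hR := tendsto_integral_of_pow_bounds (α := α) (γ := γ) (C := M ^ q * M * max C₃ C₁)
    (F := fun n s => |v s| ^ q * v s * φ n s * s ^ α)
    (G := fun s => |v s| ^ q * v s * A s * s ^ α) (by linarith) hγ0
    (fun n => (((hvc.abs.rpow_const fun s _ => Or.inr hq0).mul hvc).mul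
      (hφs n).continuous.continuousOn).mul hrp) (fun n s hs => by
      rw [abs_mul, abs_mul, abs_of_nonneg (Real.rpow_nonneg hs.1.le α),
        hφA n (hlt1 n s hs.2), ← Real.norm_eq_abs, hvq s]
      have h3 := Real.rpow_le_rpow (abs_nonneg _) (hM s hs.1) hq0
      exact mul_le_mul_of_nonneg_right (mul_le_mul (mul_le_mul h3 (hM s hs.1) (abs_nonneg _)
        (Real.rpow_nonneg hM0 _)) ((hC₃ s (Ioo_subset_Icc_self hs)).trans (le_max_left _ _))
        (abs_nonneg _) (mul_nonneg (Real.rpow_nonneg hM0 _) hM0)) (Real.rpow_nonneg hs.1.le α))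
    (fun n s hs => by
      have hs0 : 0 < s := by linarith
      have h1 : |φ n s| ≤ max C₃ C₁ * s ^ (-2 * γ) := by
        have := hC₁ n s hs
        rw [show (0 : ℝ) + (((0 : ℕ) : ℝ) - 2 * γ) = -2 * γ by push_cast; ring] at this
        exact this.trans (mul_le_mul_of_nonneg_right (le_max_right _ _) (Real.rpow_nonneg hs0.le _))
      have e : s ^ (-γ - 1) = s ^ (-2 * (m : ℝ)) * s ^ (-γ) * s ^ (-2 * γ) * s ^ α := by
        rw [← Real.rpow_add hs0, ← Real.rpow_add hs0, ← Real.rpow_add hs0]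
        congr 1; rw [hγ]; ring
      have h2 := hM' s hs
      have h3 := Real.rpow_le_rpow (abs_nonneg _) h2 hq0
      rw [Real.mul_rpow hM0 (Real.rpow_nonneg hs0.le _), ← Real.rpow_mul hs0.le,
        show -γ * q = -2 * (m : ℝ) by linarith] at h3
      rw [abs_mul, abs_mul, abs_of_nonneg (Real.rpow_nonneg hs0.le α), e, ← mul_assoc,
        ← Real.norm_eq_abs (|v s| ^ q * v s), hvq s]
      refine mul_le_mul_of_nonneg_right ?_ (Real.rpow_nonneg hs0.le α)
      rw [show M ^ q * M * max C₃ C₁ * (s ^ (-2 * (m : ℝ)) * s ^ (-γ) * s ^ (-2 * γ)) =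
        ((M ^ q * s ^ (-2 * (m : ℝ))) * (M * s ^ (-γ))) * (max C₃ C₁ * s ^ (-2 * γ)) by ring]
      have h4 := (Real.rpow_nonneg (abs_nonneg (v s)) q).trans h3
      have h5 := (abs_nonneg (v s)).trans h2
      exact mul_le_mul (mul_le_mul h3 h2 (abs_nonneg _) h4) h1 (abs_nonneg _) (mul_nonneg h4 h5))
    (fun s _ => by
      refine tendsto_const_nhds.congr' ?_
      filter_upwards [hev s] with n hn
      rw [hφA n hn])
  have hlim := tendsto_nhds_unique (hL.1.congr fun n =>
    integral_mul_polyharmonic hm hα hv hns hsol (hφs n) (hφz n)) hR.1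
  have hP : 0 < constP m α * δ ^ (2 * m) := mul_pos (constP_pos hα) (by positivity)
  have hcongr : ∀ s ∈ Ioi (0 : ℝ), v s * polyharmonic m α A s * s ^ α = constP m α * δ ^ (2 * m) *
      (v s * sphAvg α r δ ((α + 1) / 2 + m) 0 s * s ^ α) := by
    intro s hs
    rw [hlapA s hs]; ring
  refine ⟨?_, hR.2, ?_⟩
  · have h := (hL.2.congr_fun hcongr measurableSet_Ioi).const_mul (constP m α * δ ^ (2 * m))⁻¹
    refine IntegrableOn.congr_fun h (fun s _ => ?_) measurableSet_Ioi
    rw [inv_mul_cancel_left₀ hP.ne']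
  · rw [← hlim, setIntegral_congr_fun measurableSet_Ioi hcongr, integral_const_mul]

/-! ### A model of the space of dimension `α + 1` -/

/-- Polar coordinates in the upper half-plane. -/
theorem lintegral_halfPlane_polar (g : ℝ × ℝ → ℝ≥0∞) :
    ∫⁻ p, g p ∂((volume : Measure ℝ).prod (volume.restrict (Ioi 0))) =
      ∫⁻ p, ENNReal.ofReal p.1 * g (p.1 * Real.cos p.2, p.1 * Real.sin p.2)
        ∂((volume.restrict (Ioi (0 : ℝ))).prod (volume.restrict (Ioo 0 Real.pi))) := by
  have h := lintegral_comp_polarCoord_symm ((univ ×ˢ Ioi (0 : ℝ)).indicator g)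
  have hm : MeasurableSet ((univ : Set ℝ) ×ˢ Ioi (0 : ℝ)) := MeasurableSet.univ.prod measurableSet_Ioi
  rw [lintegral_indicator hm, Measure.volume_eq_prod, ← Measure.prod_restrict,
    Measure.restrict_univ] at h
  rw [← h, Measure.prod_restrict, polarCoord_target, ← lintegral_indicator (measurableSet_Ioi.prod
    measurableSet_Ioo), ← lintegral_indicator (measurableSet_Ioi.prod measurableSet_Ioo)]
  refine lintegral_congr fun p => ?_
  by_cases hp1 : 0 < p.1
  · by_cases hp2 : p.2 ∈ Ioo (-Real.pi) Real.pi
    · rw [indicator_of_mem (s := Ioi (0 : ℝ) ×ˢ Ioo (-Real.pi) Real.pi) ⟨hp1, hp2⟩]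
      rw [polarCoord_symm_apply, smul_eq_mul]
      by_cases hp3 : 0 < p.2
      · rw [indicator_of_mem (s := Ioi (0 : ℝ) ×ˢ Ioo 0 Real.pi) ⟨hp1, hp3, hp2.2⟩, indicator_of_mem]
        exact ⟨mem_univ _, mul_pos hp1 (Real.sin_pos_of_pos_of_lt_pi hp3 hp2.2)⟩
      · rw [indicator_of_notMem (s := Ioi (0 : ℝ) ×ˢ Ioo 0 Real.pi) (fun h => hp3 h.2.1),
          indicator_of_notMem, mul_zero]
        intro h
        have h1 : Real.sin p.2 ≤ 0 :=
          Real.sin_nonpos_of_nonpos_of_neg_pi_le (not_lt.1 hp3) hp2.1.le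
        have h2 : 0 < p.1 * Real.sin p.2 := h.2
        nlinarith
    · rw [indicator_of_notMem (s := Ioi (0 : ℝ) ×ˢ Ioo (-Real.pi) Real.pi) (fun h => hp2 h.2),
        indicator_of_notMem]
      exact fun h => hp2 ⟨by linarith [h.2.1, Real.pi_pos], h.2.2⟩
  · rw [indicator_of_notMem (fun h => hp1 h.1), indicator_of_notMem (fun h => hp1 h.1)]

/-- Functions on the space of dimension `N = α + 1` which depend on two coordinates, written
as a complex number, and on the norm `z` of the remaining `N - 2` coordinates, are integrated against
the measure `z^{α-2} dζ dz` on `ℂ × (0,∞)`. -/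
noncomputable def spaceMeasure (α : ℝ) : Measure (ℂ × ℝ) :=
  (volume : Measure ℂ).prod
    ((volume.restrict (Ioi (0 : ℝ))).withDensity fun z => ENNReal.ofReal (z ^ (α - 2)))

/-- The measure `sin^{α-1} b sin^{α-2} θ db dθ` of the unit sphere in spherical coordinates. -/
noncomputable def sphereMeasure (α : ℝ) : Measure (ℝ × ℝ) :=
  ((volume.restrict (Ioo 0 Real.pi)).withDensity fun b => ENNReal.ofReal (Real.sin b ^ (α - 1))).prod
    ((volume.restrict (Ioo 0 Real.pi)).withDensity fun b => ENNReal.ofReal (Real.sin b ^ (α - 2)))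

/-- The point of the unit sphere with spherical coordinates `(b, θ)`. -/
noncomputable def spherePoint (y : ℝ × ℝ) : ℂ × ℝ :=
  (Real.cos y.1 + Real.sin y.1 * Real.cos y.2 * Complex.I, Real.sin y.1 * Real.sin y.2)

theorem continuous_spherePoint : Continuous spherePoint := by
  unfold spherePoint; fun_prop

theorem measurable_ofReal_rpow (a : ℝ) : Measurable fun z : ℝ => ENNReal.ofReal (z ^ a) :=
  (measurable_id.pow_const a).ennreal_ofReal

theorem measurable_ofReal_sin_rpow (a : ℝ) :
    Measurable fun z : ℝ => ENNReal.ofReal (Real.sin z ^ a) :=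
  (Real.measurable_sin.pow_const a).ennreal_ofReal

instance (α : ℝ) : SFinite (sphereMeasure α) := by unfold sphereMeasure; infer_instance

theorem lintegral_sphereMeasure (α : ℝ) {G : ℝ × ℝ → ℝ≥0∞} (hG : Measurable G) :
    ∫⁻ y, G y ∂(sphereMeasure α) = ∫⁻ b in Ioo 0 Real.pi, ∫⁻ θ in Ioo 0 Real.pi,
      ENNReal.ofReal (Real.sin b ^ (α - 1)) * ENNReal.ofReal (Real.sin θ ^ (α - 2)) * G (b, θ) := by
  rw [sphereMeasure, lintegral_prod _ hG.aemeasurable,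
    lintegral_withDensity_eq_lintegral_mul _ (measurable_ofReal_sin_rpow _) hG.lintegral_prod_right']
  refine lintegral_congr fun b => ?_
  simp only [Pi.mul_apply]
  have hGb : Measurable fun θ => G (b, θ) := hG.comp measurable_prodMk_left
  rw [lintegral_withDensity_eq_lintegral_mul _ (measurable_ofReal_sin_rpow _) hGb,
    ← lintegral_const_mul' _ _ ENNReal.ofReal_ne_top]
  simp only [Pi.mul_apply, mul_assoc]

/-- Spherical coordinates for `spaceMeasure`. -/
theorem lintegral_spaceMeasure_polar (α : ℝ) {F : ℂ × ℝ → ℝ≥0∞} (hF : Measurable F) :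
    ∫⁻ q, F q ∂(spaceMeasure α) = ∫⁻ s in Ioi (0 : ℝ), ENNReal.ofReal (s ^ α) *
      ∫⁻ y, F (s * (spherePoint y).1, s * (spherePoint y).2) ∂(sphereMeasure α) := by
  set w : ℝ → ℝ≥0∞ := fun z => ENNReal.ofReal (z ^ (α - 2)) with hw
  have hwm : Measurable w := measurable_ofReal_rpow _
  have h1 : ∫⁻ q, F q ∂(spaceMeasure α) =
      ∫⁻ ζ : ℂ, ∫⁻ z in Ioi (0 : ℝ), w z * F (ζ, z) := by
    rw [spaceMeasure, lintegral_prod _ hF.aemeasurable]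
    refine lintegral_congr fun ζ => ?_
    have hFζ : Measurable fun z => F (ζ, z) := hF.comp measurable_prodMk_left
    rw [← hw, lintegral_withDensity_eq_lintegral_mul _ hwm hFζ]
    rfl
  have h2 : ∫⁻ ζ : ℂ, ∫⁻ z in Ioi (0 : ℝ), w z * F (ζ, z) =
      ∫⁻ x : ℝ, ∫⁻ y : ℝ, ∫⁻ z in Ioi (0 : ℝ), w z * F (x + y * Complex.I, z) := by
    have hm : Measurable fun ζ : ℂ => ∫⁻ z in Ioi (0 : ℝ), w z * F (ζ, z) :=
      Measurable.lintegral_prod_right' (f := fun p : ℂ × ℝ => w p.2 * F p)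
        ((hwm.comp measurable_snd).mul hF)
    have hm' : Measurable fun p : ℝ × ℝ => ∫⁻ z in Ioi (0 : ℝ),
        w z * F (Complex.measurableEquivRealProd.symm p, z) :=
      hm.comp Complex.measurableEquivRealProd.symm.measurable
    rw [← (Complex.volume_preserving_equiv_real_prod.symm).lintegral_comp hm,
      Measure.volume_eq_prod, lintegral_prod _ hm'.aemeasurable]
    refine lintegral_congr fun x => lintegral_congr fun y => lintegral_congr fun z => ?_
    rw [Complex.measurableEquivRealProd_symm_apply, Complex.mk_eq_add_mul_I]
  have h3 : ∀ x : ℝ, ∫⁻ y : ℝ, ∫⁻ z in Ioi (0 : ℝ), w z * F (x + y * Complex.I, z) =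
      ∫⁻ σ in Ioi (0 : ℝ), ∫⁻ θ in Ioo 0 Real.pi, ENNReal.ofReal σ * (w (σ * Real.sin θ) *
        F (x + (σ * Real.cos θ : ℝ) * Complex.I, σ * Real.sin θ)) := by
    intro x
    have hm : Measurable fun p : ℝ × ℝ => w p.2 * F (x + p.1 * Complex.I, p.2) :=
      (hwm.comp measurable_snd).mul (hF.comp (Continuous.measurable (by fun_prop)))
    have h := lintegral_halfPlane_polar fun p : ℝ × ℝ => w p.2 * F (x + p.1 * Complex.I, p.2)
    rw [lintegral_prod _ hm.aemeasurable, lintegral_prod] at h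
    · exact h
    · exact (measurable_fst.ennreal_ofReal.mul (hm.comp
        (Continuous.measurable (by fun_prop)))).aemeasurable
  set g : ℝ × ℝ → ℝ≥0∞ := fun p => ∫⁻ θ in Ioo 0 Real.pi, ENNReal.ofReal p.2 *
    (w (p.2 * Real.sin θ) * F (p.1 + (p.2 * Real.cos θ : ℝ) * Complex.I, p.2 * Real.sin θ)) with hg
  have hgm : Measurable g := by
    refine Measurable.lintegral_prod_right' (f := fun r : (ℝ × ℝ) × ℝ => ENNReal.ofReal r.1.2 *
      (w (r.1.2 * Real.sin r.2) * F (r.1.1 + (r.1.2 * Real.cos r.2 : ℝ) * Complex.I,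
        r.1.2 * Real.sin r.2))) ?_
    refine (measurable_fst.snd.ennreal_ofReal).mul ((hwm.comp ?_).mul (hF.comp ?_))
    · exact Continuous.measurable (by fun_prop)
    · exact Continuous.measurable (by fun_prop)
  have h4 := lintegral_halfPlane_polar g
  have hgm' : Measurable fun p : ℝ × ℝ => ENNReal.ofReal p.1 *
      g (p.1 * Real.cos p.2, p.1 * Real.sin p.2) :=
    measurable_fst.ennreal_ofReal.mul (hgm.comp (Continuous.measurable (by fun_prop)))
  rw [lintegral_prod _ hgm.aemeasurable, lintegral_prod _ hgm'.aemeasurable] at h4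
  rw [h1, h2, lintegral_congr h3, h4]
  refine setLIntegral_congr_fun measurableSet_Ioi fun s hs => ?_
  have hs0 : 0 < s := hs
  simp only
  rw [lintegral_sphereMeasure α (G := fun y => F (s * (spherePoint y).1, s * (spherePoint y).2))
    (hF.comp (((continuous_const.mul continuous_spherePoint.fst).prodMk
      (continuous_const.mul continuous_spherePoint.snd)).measurable)),
    ← lintegral_const_mul']
  swap
  · exact ENNReal.ofReal_ne_top
  refine setLIntegral_congr_fun measurableSet_Ioo fun b hb => ?_
  simp only [hg]
  rw [← lintegral_const_mul' _ _ ENNReal.ofReal_ne_top, ← lintegral_const_mul' _ _ ENNReal.ofReal_ne_top]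
  refine setLIntegral_congr_fun measurableSet_Ioo fun θ hθ => ?_
  have hb0 : 0 < Real.sin b := Real.sin_pos_of_mem_Ioo hb
  have hθ0 : 0 < Real.sin θ := Real.sin_pos_of_mem_Ioo hθ
  simp only [hw, spherePoint]
  rw [← mul_assoc, ← mul_assoc, ← mul_assoc, ← mul_assoc]
  congr 1
  · rw [← ENNReal.ofReal_mul hs0.le, ← ENNReal.ofReal_mul (by positivity),
      ← ENNReal.ofReal_mul (by positivity), ← ENNReal.ofReal_mul (by positivity)]
    congr 1
    rw [Real.mul_rpow (by positivity) hθ0.le, Real.mul_rpow hs0.le hb0.le,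
      show s ^ α = s * s * s ^ (α - 2) by
        rw [← pow_two, ← Real.rpow_natCast s 2, ← Real.rpow_add hs0]; congr 1; push_cast; ring,
      show Real.sin b ^ (α - 1) = Real.sin b * Real.sin b ^ (α - 2) by
        nth_rewrite 2 [← Real.rpow_one (Real.sin b)]
        rw [← Real.rpow_add hb0]; congr 1; ring]
    ring
  · congr 1
    refine Prod.ext ?_ ?_
    · push_cast; ring
    · simp only; ring

theorem lintegral_sin_rpow_lt_top {a : ℝ} (ha : -1 < a) :
    ∫⁻ θ in Ioo 0 Real.pi, ENNReal.ofReal (Real.sin θ ^ a) < ⊤ := by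
  have hπ := Real.pi_pos
  have h1 : IntervalIntegrable (fun θ : ℝ => θ ^ a) volume 0 Real.pi :=
    intervalIntegral.intervalIntegrable_rpow' ha
  have h2 : IntervalIntegrable (fun θ : ℝ => (Real.pi - θ) ^ a) volume 0 Real.pi := by
    simpa using (h1.comp_sub_left Real.pi).symm
  have h3 : IntegrableOn (fun θ : ℝ => 1 + (2 / Real.pi) ^ a * (θ ^ a + (Real.pi - θ) ^ a))
      (Ioo 0 Real.pi) := by
    have := (intervalIntegrable_const (c := (1 : ℝ))).add ((h1.add h2).const_mul ((2 / Real.pi) ^ a))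
    exact ((intervalIntegrable_iff_integrableOn_Ioo_of_le hπ.le).1 this)
  refine lt_of_le_of_lt ?_ h3.lintegral_lt_top
  refine setLIntegral_mono' measurableSet_Ioo fun θ hθ => ENNReal.ofReal_le_ofReal ?_
  have hs : 0 < Real.sin θ := Real.sin_pos_of_mem_Ioo hθ
  have hb : 0 < Real.pi - θ := by linarith [hθ.2]
  have e1 : 0 ≤ (2 / Real.pi) ^ a * θ ^ a := mul_nonneg (by positivity) (Real.rpow_nonneg hθ.1.le _)
  have e2 : 0 ≤ (2 / Real.pi) ^ a * (Real.pi - θ) ^ a :=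
    mul_nonneg (by positivity) (Real.rpow_nonneg hb.le _)
  rw [mul_add]
  rcases le_total 0 a with h0 | h0
  · linarith [Real.rpow_le_one hs.le (Real.sin_le_one θ) h0]
  · rcases le_total θ (Real.pi / 2) with h | h
    · have := Real.rpow_le_rpow_of_nonpos (by have := hθ.1; positivity) (Real.mul_le_sin hθ.1.le h) h0
      rw [Real.mul_rpow (by positivity) hθ.1.le] at this
      linarith
    · have := Real.rpow_le_rpow_of_nonpos (by positivity)
        (Real.mul_le_sin hb.le (by linarith)) h0
      rw [Real.mul_rpow (by positivity) hb.le, Real.sin_pi_sub] at this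
      linarith

theorem lintegral_sin_rpow_ne_zero (a : ℝ) :
    ∫⁻ θ in Ioo 0 Real.pi, ENNReal.ofReal (Real.sin θ ^ a) ≠ 0 := by
  refine (setLIntegral_pos_iff (measurable_ofReal_sin_rpow a)).2 ?_ |>.ne'
  rw [inter_eq_right.2]
  · rw [Real.volume_Ioo]; simpa using Real.pi_pos
  · intro θ hθ
    simpa using Real.rpow_pos_of_pos (Real.sin_pos_of_mem_Ioo hθ) a

theorem sphereMeasure_univ (α : ℝ) : sphereMeasure α univ =
    (∫⁻ b in Ioo 0 Real.pi, ENNReal.ofReal (Real.sin b ^ (α - 1))) *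
      ∫⁻ θ in Ioo 0 Real.pi, ENNReal.ofReal (Real.sin θ ^ (α - 2)) := by
  rw [sphereMeasure, ← univ_prod_univ, Measure.prod_prod, withDensity_apply _ MeasurableSet.univ,
    withDensity_apply _ MeasurableSet.univ, Measure.restrict_univ]

theorem sphereMeasure_univ_ne_top {α : ℝ} (hα : 1 < α) : sphereMeasure α univ ≠ ⊤ := by
  rw [sphereMeasure_univ]
  exact ENNReal.mul_ne_top (lintegral_sin_rpow_lt_top (by linarith)).ne
    (lintegral_sin_rpow_lt_top (by linarith)).ne

theorem sphereMeasure_univ_ne_zero (α : ℝ) : sphereMeasure α univ ≠ 0 := by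
  rw [sphereMeasure_univ]
  exact mul_ne_zero (lintegral_sin_rpow_ne_zero _) (lintegral_sin_rpow_ne_zero _)

theorem ae_sphereMeasure_mem (α : ℝ) :
    ∀ᵐ y ∂(sphereMeasure α), y ∈ Ioo 0 Real.pi ×ˢ Ioo 0 Real.pi := by
  have h : ∀ a : ℝ, ∀ᵐ b ∂((volume.restrict (Ioo 0 Real.pi)).withDensity fun b =>
      ENNReal.ofReal (Real.sin b ^ a)), b ∈ Ioo 0 Real.pi := fun a =>
    (withDensity_absolutelyContinuous _ _).ae_le (ae_restrict_mem measurableSet_Ioo)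
  have h1 := (Measure.quasiMeasurePreserving_fst (μ := (volume.restrict (Ioo 0 Real.pi)).withDensity
    fun b => ENNReal.ofReal (Real.sin b ^ (α - 1))) (ν := (volume.restrict (Ioo 0 Real.pi)).withDensity
    fun b => ENNReal.ofReal (Real.sin b ^ (α - 2)))).ae (h _)
  have h2 := (Measure.quasiMeasurePreserving_snd (μ := (volume.restrict (Ioo 0 Real.pi)).withDensity
    fun b => ENNReal.ofReal (Real.sin b ^ (α - 1))) (ν := (volume.restrict (Ioo 0 Real.pi)).withDensity
    fun b => ENNReal.ofReal (Real.sin b ^ (α - 2)))).ae (h _)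
  unfold sphereMeasure
  filter_upwards [h1, h2] with y h1 h2 using ⟨h1, h2⟩

/-- The point with spherical coordinates `(e^t, b, θ)`. -/
noncomputable def expPoint (x : ℝ × (ℝ × ℝ)) : ℂ × ℝ :=
  (Real.exp x.1 * (spherePoint x.2).1, Real.exp x.1 * (spherePoint x.2).2)

theorem continuous_expPoint : Continuous expPoint := by
  have := continuous_spherePoint
  unfold expPoint; fun_prop

/-- The square of the distance of `P`, in the plane of the two distinguished coordinates, to `q`. -/
noncomputable def distSq (P : ℂ) (q : ℂ × ℝ) : ℝ := ‖P - q.1‖ ^ 2 + q.2 ^ 2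

theorem continuous_distSq (P : ℂ) : Continuous (distSq P) := by
  unfold distSq; fun_prop

theorem distSq_nonneg (P : ℂ) (q : ℂ × ℝ) : 0 ≤ distSq P q := by
  unfold distSq; positivity

theorem sq_norm_eq (x y : ℝ) : ‖(x + y * Complex.I : ℂ)‖ ^ 2 = x ^ 2 + y ^ 2 := by
  rw [← Complex.normSq_eq_norm_sq, Complex.normSq_add_mul_I]

theorem distSq_ofReal_mul_spherePoint (r s : ℝ) (y : ℝ × ℝ) :
    distSq r (s * (spherePoint y).1, s * (spherePoint y).2) =
      (s - r * Real.cos y.1) ^ 2 + (r * Real.sin y.1) ^ 2 := by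
  have : (r : ℂ) - s * (spherePoint y).1 = ((r - s * Real.cos y.1 : ℝ) : ℂ) +
      ((-(s * Real.sin y.1 * Real.cos y.2) : ℝ) : ℂ) * Complex.I := by
    unfold spherePoint; push_cast; ring
  rw [distSq, this, sq_norm_eq]
  simp only [spherePoint]
  linear_combination (s ^ 2 * Real.sin y.1 ^ 2) * Real.sin_sq_add_cos_sq y.2 +
    (s ^ 2 - r ^ 2) * Real.sin_sq_add_cos_sq y.1

theorem distSq_zero_expPoint (x : ℝ × (ℝ × ℝ)) : distSq 0 (expPoint x) = Real.exp x.1 ^ 2 := by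
  have := distSq_ofReal_mul_spherePoint 0 (Real.exp x.1) x.2
  simpa [expPoint] using this

/-- Spherical coordinates for `spaceMeasure`, with a logarithmic radial variable. -/
theorem lintegral_spaceMeasure_expPoint (α : ℝ) {F : ℂ × ℝ → ℝ≥0∞} (hF : Measurable F) :
    ∫⁻ q, F q ∂(spaceMeasure α) = ∫⁻ x, ENNReal.ofReal (Real.exp ((α + 1) * x.1)) * F (expPoint x)
      ∂((volume : Measure ℝ).prod (sphereMeasure α)) := by
  have hm : Measurable fun x : ℝ × (ℝ × ℝ) =>
      ENNReal.ofReal (Real.exp ((α + 1) * x.1)) * F (expPoint x) :=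
    (Continuous.measurable (by fun_prop)).ennreal_ofReal.mul (hF.comp continuous_expPoint.measurable)
  rw [lintegral_prod _ hm.aemeasurable, lintegral_spaceMeasure_polar α hF]
  have h := lintegral_image_eq_lintegral_abs_deriv_mul (f := Real.exp) (f' := Real.exp)
    MeasurableSet.univ (fun x _ => (Real.hasDerivAt_exp x).hasDerivWithinAt) Real.exp_injective.injOn
    (fun s => ENNReal.ofReal (s ^ α) *
      ∫⁻ y, F (s * (spherePoint y).1, s * (spherePoint y).2) ∂(sphereMeasure α))
  rw [image_univ, Real.range_exp, Measure.restrict_univ] at h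
  rw [h]
  refine lintegral_congr fun t => ?_
  rw [← mul_assoc, ← ENNReal.ofReal_mul (abs_nonneg _), abs_of_pos (Real.exp_pos t),
    ← Real.exp_mul, ← Real.exp_add, ← lintegral_const_mul' _ _ ENNReal.ofReal_ne_top,
    show t + t * α = (α + 1) * t by ring]
  rfl

/-- `spaceMeasure` is invariant under isometries of the distinguished plane. -/
theorem lintegral_spaceMeasure_comp (α : ℝ) {F : ℂ × ℝ → ℝ≥0∞} (hF : Measurable F) {e : ℂ → ℂ}
    (he : MeasurePreserving e) :
    ∫⁻ q, F (e q.1, q.2) ∂(spaceMeasure α) = ∫⁻ q, F q ∂(spaceMeasure α) :=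
  (he.prod (MeasurePreserving.id _)).lintegral_comp hF

theorem ae_spaceMeasure_snd_pos (α : ℝ) : ∀ᵐ q ∂(spaceMeasure α), 0 < q.2 := by
  unfold spaceMeasure
  exact Measure.quasiMeasurePreserving_snd.ae
    ((withDensity_absolutelyContinuous _ _).ae_le (ae_restrict_mem measurableSet_Ioi))

/-- Integrals of a radial function against a power of the distance to a point reduce to
one-dimensional integrals against the spherical averages `sphAvg`. -/
theorem lintegral_spaceMeasure_radial {α : ℝ} (hα : 1 < α) {f : ℝ → ℝ≥0∞} (hf : Measurable f) (r : ℝ)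
    {δ : ℝ} (hδ : 0 < δ) (β : ℝ) :
    ∫⁻ q, ENNReal.ofReal ((distSq r q + δ ^ 2) ^ (-β)) * f (√(distSq 0 q)) ∂(spaceMeasure α) =
      (∫⁻ θ in Ioo 0 Real.pi, ENNReal.ofReal (Real.sin θ ^ (α - 2))) *
        ∫⁻ s in Ioi (0 : ℝ), f s * ENNReal.ofReal (sphAvg α r δ β 0 s * s ^ α) := by
  have hF : Measurable fun q : ℂ × ℝ =>
      ENNReal.ofReal ((distSq r q + δ ^ 2) ^ (-β)) * f (√(distSq 0 q)) :=
    (((continuous_distSq _).measurable.add_const _).pow_const _).ennreal_ofReal.mul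
      (hf.comp (continuous_distSq 0).measurable.sqrt)
  rw [lintegral_spaceMeasure_polar α hF,
    ← lintegral_const_mul' _ _ (lintegral_sin_rpow_lt_top (by linarith)).ne]
  refine setLIntegral_congr_fun measurableSet_Ioi fun s hs => ?_
  have hs0 : 0 < s := hs
  have hq : ∀ y, distSq r (s * (spherePoint y).1, s * (spherePoint y).2) + δ ^ 2 =
      sqDist r δ s y.1 := fun y => by rw [distSq_ofReal_mul_spherePoint, sqDist]
  have hq0 : ∀ y, √(distSq 0 (s * (spherePoint y).1, s * (spherePoint y).2)) = s := fun y => by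
    have := distSq_ofReal_mul_spherePoint 0 s y
    simp only [Complex.ofReal_zero, zero_mul, sub_zero, ne_eq, OfNat.ofNat_ne_zero,
      not_false_eq_true, zero_pow, add_zero] at this
    rw [this, Real.sqrt_sq hs0.le]
  simp only [hq, hq0]
  have hc : Continuous fun b => sqDist r δ s b ^ (-β) * Real.sin b ^ (α - 1) := by
    have h1 : Continuous fun b => sqDist r δ s b := by unfold sqDist; fun_prop
    exact (h1.rpow_const fun b => Or.inl (sqDist_pos hδ s b).ne').mul
      (Real.continuous_sin.rpow_const fun b => Or.inr (by linarith))
  have hA : ENNReal.ofReal (sphAvg α r δ β 0 s) = ∫⁻ b in Ioo 0 Real.pi,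
      ENNReal.ofReal (sqDist r δ s b ^ (-β)) * ENNReal.ofReal (Real.sin b ^ (α - 1)) := by
    rw [sphAvg, intervalIntegral.integral_of_le Real.pi_pos.le, integral_Ioc_eq_integral_Ioo,
      ofReal_integral_eq_lintegral_ofReal]
    · refine setLIntegral_congr_fun measurableSet_Ioo fun b hb => ?_
      simp only [pow_zero, one_mul]
      exact ENNReal.ofReal_mul (Real.rpow_nonneg (sqDist_pos hδ s b).le _)
    · simp only [pow_zero, one_mul]
      exact (hc.integrableOn_Icc (a := 0) (b := Real.pi)).mono_set Ioo_subset_Icc_self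
    · filter_upwards [ae_restrict_mem measurableSet_Ioo] with b hb
      simp only [pow_zero, one_mul, Pi.zero_apply]
      exact mul_nonneg (Real.rpow_nonneg (sqDist_pos hδ s b).le _)
        (Real.rpow_nonneg (Real.sin_pos_of_mem_Ioo hb).le _)
  have hp := lintegral_prod_mul
    (μ := (volume.restrict (Ioo 0 Real.pi)).withDensity fun b => ENNReal.ofReal (Real.sin b ^ (α - 1)))
    (ν := (volume.restrict (Ioo 0 Real.pi)).withDensity fun b => ENNReal.ofReal (Real.sin b ^ (α - 2)))
    (f := fun b => ENNReal.ofReal (sqDist r δ s b ^ (-β)) * f s) (g := fun _ => 1)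
    (Measurable.aemeasurable ((Measurable.pow_const (by unfold sqDist; fun_prop)
      _).ennreal_ofReal.mul_const _)) aemeasurable_const
  simp only [mul_one] at hp
  have hm : Measurable fun b => ENNReal.ofReal (sqDist r δ s b ^ (-β)) :=
    (Measurable.pow_const (by unfold sqDist; fun_prop) _).ennreal_ofReal
  rw [sphereMeasure, hp, lintegral_mul_const _ hm,
    lintegral_withDensity_eq_lintegral_mul _ (measurable_ofReal_sin_rpow _) hm, lintegral_one,
    withDensity_apply _ MeasurableSet.univ, Measure.restrict_univ, mul_comm (sphAvg α r δ β 0 s),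
    ENNReal.ofReal_mul (Real.rpow_nonneg hs0.le α), hA]
  simp only [Pi.mul_apply, mul_comm (ENNReal.ofReal (Real.sin _ ^ (α - 1)))]
  ring

/-! ### The integral equation -/

/-- The properties of the solution, extended to an even continuous function on the line, on which the
method of moving planes depends. The last one is the equation tested against the
spherical averages of `(|x - P|² + δ²)^{-((α+1)/2-m)}`. -/
structure RadialProfile (m : ℕ) (α : ℝ) (u : ℝ → ℝ) : Prop where
  continuous : Continuous u
  nonneg : ∀ s, 0 ≤ u s
  pos : ∀ s, 0 < s → 0 < u s
  bounded : ∃ M, ∀ s, u s ≤ M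
  decay : ∀ ε, 0 < ε → ∃ R, 1 ≤ R ∧ ∀ s, R ≤ s → u s ≤ ε * s ^ (-((α + 1) / 2 - m))
  identity : ∀ r δ, 0 ≤ r → 0 < δ →
    IntegrableOn (fun s => u s * sphAvg α r δ ((α + 1) / 2 + m) 0 s * s ^ α) (Ioi 0) ∧
    IntegrableOn (fun s => u s ^ (critExp m α - 1) * sphAvg α r δ ((α + 1) / 2 - m) 0 s * s ^ α)
      (Ioi 0) ∧
    constP m α * δ ^ (2 * m) *
      ∫ s in Ioi (0 : ℝ), u s * sphAvg α r δ ((α + 1) / 2 + m) 0 s * s ^ α =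
    ∫ s in Ioi (0 : ℝ), u s ^ (critExp m α - 1) * sphAvg α r δ ((α + 1) / 2 - m) 0 s * s ^ α

/-- Only the values at norms of points enter below, so the solution is extended to `s ≤ 0` by
its limit at `0` and by parity, which makes it continuous and bounded on the whole line. -/
theorem exists_radialProfile {m : ℕ} (hm : 1 ≤ m) {α : ℝ} (hα : α - 2 * (m : ℝ) + 1 > 0)
    {v : ℝ → ℝ} (hv : MemD m α v) (hpos : ∀ r : ℝ, 0 < r → 0 < v r)
    (hsol : IsWeakSolution m α v ∨ IsClassicalSolution m α v) (hns : Nonsingular (2 * m - 1) v) :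
    ∃ u, RadialProfile m α u ∧ ∀ r, 0 < r → u r = v r := by
  obtain ⟨L, hL⟩ := hns 0 (Nat.zero_le _)
  rw [iteratedDeriv_zero] at hL
  have hvc : ContinuousOn v (Ioi 0) := hv.1.1.continuousOn
  set u : ℝ → ℝ := fun s => if s = 0 then L else v |s| with hu
  have hne : ∀ s, s ≠ 0 → u s = v |s| := fun s hs => if_neg hs
  have hup : ∀ r, 0 < r → u r = v r := fun r hr => by rw [hne r hr.ne', abs_of_pos hr]
  have hL0 : 0 ≤ L := ge_of_tendsto hL (by
    filter_upwards [self_mem_nhdsWithin] with s hs using (hpos s hs).le)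
  have hnn : ∀ s, 0 ≤ u s := by
    intro s
    by_cases h : s = 0
    · simp [hu, h, hL0]
    · rw [hne s h]; exact (hpos _ (abs_pos.2 h)).le
  have huc : Continuous u := by
    rw [continuous_iff_continuousAt]
    intro s
    by_cases h : s = 0
    · subst h
      rw [continuousAt_iff_punctured_nhds, show u 0 = L from if_pos rfl]
      have h1 : Tendsto (fun s : ℝ => |s|) (𝓝[≠] 0) (𝓝[>] 0) := by
        refine tendsto_nhdsWithin_of_tendsto_nhds_of_eventually_within _ ?_ ?_
        · simpa using (continuous_abs.tendsto (0 : ℝ)).mono_left nhdsWithin_le_nhds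
        · filter_upwards [self_mem_nhdsWithin] with s hs using abs_pos.2 hs
      refine (hL.comp h1).congr' ?_
      filter_upwards [self_mem_nhdsWithin] with s hs using (hne s hs).symm
    · have h1 : ContinuousAt (fun s => v |s|) s :=
        (hvc.continuousAt (Ioi_mem_nhds (abs_pos.2 h))).comp continuous_abs.continuousAt
      refine h1.congr ?_
      filter_upwards [isOpen_ne.mem_nhds h] with x hx using (hne x hx).symm
  have hγ : 0 < (α + 1) / 2 - m := by linarith
  have hdec : ∀ ε, 0 < ε → ∃ R, 1 ≤ R ∧ ∀ s, R ≤ s → u s ≤ ε * s ^ (-((α + 1) / 2 - m)) := by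
    intro ε hε
    obtain ⟨R, hR1, hR⟩ := MemD.isLittleO hm hα hv hε
    refine ⟨R, hR1, fun s hs => ?_⟩
    rw [hup s (by linarith)]
    exact (le_abs_self _).trans (hR s hs)
  obtain ⟨R, hR1, hR⟩ := hdec 1 one_pos
  obtain ⟨C, hC⟩ := (isCompact_Icc (a := (0 : ℝ)) (b := R)).exists_bound_of_continuousOn
    huc.continuousOn
  have hC0 : 0 ≤ C := (norm_nonneg _).trans (hC 0 ⟨le_rfl, by linarith⟩)
  set γ := (α + 1) / 2 - m with hγd
  have hRγ : 1 ≤ R ^ γ := Real.one_le_rpow hR1 hγ.le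
  have hM' : ∀ s, 1 ≤ s → u s ≤ max 1 (C * R ^ γ) * s ^ (-γ) := by
    intro s hs
    have hs0 : 0 < s := by linarith
    have hsp : 0 < s ^ (-γ) := Real.rpow_pos_of_pos hs0 _
    rcases le_total R s with h | h
    · exact (hR s h).trans (mul_le_mul_of_nonneg_right (le_max_left _ _) hsp.le)
    · refine le_trans ?_ (mul_le_mul_of_nonneg_right (le_max_right _ _) hsp.le)
      have h1 : u s ≤ C := (le_abs_self _).trans (hC s ⟨hs0.le, h⟩)
      have h2 : 1 ≤ R ^ γ * s ^ (-γ) := by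
        rw [Real.rpow_neg hs0.le, ← div_eq_mul_inv, one_le_div (Real.rpow_pos_of_pos hs0 _)]
        exact Real.rpow_le_rpow hs0.le h hγ.le
      rw [mul_assoc]
      nlinarith
  have hM : ∀ s, 0 < s → u s ≤ max 1 (C * R ^ γ) := by
    intro s hs
    rcases le_total 1 s with h | h
    · refine (hM' s h).trans (mul_le_of_le_one_right (by positivity) ?_)
      exact Real.rpow_le_one_of_one_le_of_nonpos h (by linarith)
    · have h1 : u s ≤ C := (le_abs_self _).trans (hC s ⟨hs.le, by linarith⟩)
      exact h1.trans ((le_mul_of_one_le_right hC0 hRγ).trans (le_max_right _ _))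
  refine ⟨u, ⟨huc, hnn, fun s hs => by rw [hup s hs]; exact hpos s hs,
    ⟨max C (max 1 (C * R ^ γ)), fun s => ?_⟩, hdec, fun r δ hr hδ => ?_⟩, hup⟩
  · by_cases h : s = 0
    · rw [h]
      exact (le_abs_self _).trans ((hC 0 ⟨le_rfl, by linarith⟩).trans (le_max_left _ _))
    · have h1 : u s = u |s| := by rw [hne s h, hup _ (abs_pos.2 h)]
      rw [h1]
      exact (hM _ (abs_pos.2 h)).trans (le_max_right _ _)
  · obtain ⟨h1, h2, h3⟩ := integral_mul_sphAvg hm hα hv hns hsol (M := max 1 (C * R ^ γ))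
      (fun s hs => by rw [abs_of_pos (hpos s hs), ← hup s hs]; exact hM s hs)
      (fun s hs => by
        have hs0 : 0 < s := by linarith
        rw [abs_of_pos (hpos s hs0), ← hup s hs0]; exact hM' s hs) hr hδ
    have e1 : EqOn (fun s => v s * sphAvg α r δ ((α + 1) / 2 + m) 0 s * s ^ α)
        (fun s => u s * sphAvg α r δ ((α + 1) / 2 + m) 0 s * s ^ α) (Ioi 0) := fun s hs => by
      simp only [hup s hs]
    have e2 : EqOn (fun s => |v s| ^ (critExp m α - 2) * v s *
          sphAvg α r δ ((α + 1) / 2 - m) 0 s * s ^ α)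
        (fun s => u s ^ (critExp m α - 1) * sphAvg α r δ ((α + 1) / 2 - m) 0 s * s ^ α)
        (Ioi 0) := fun s hs => by
      simp only [hup s hs]
      have h := hpos s hs
      rw [abs_of_pos h, show critExp m α - 1 = (critExp m α - 2) + 1 by ring, Real.rpow_add_one h.ne']
    rw [setIntegral_congr_fun measurableSet_Ioi e1, setIntegral_congr_fun measurableSet_Ioi e2] at h3
    exact ⟨h1.congr_fun e1 measurableSet_Ioi, h2.congr_fun e2 measurableSet_Ioi, h3⟩

theorem sphAvg_nonneg (α r : ℝ) {δ : ℝ} (hδ : 0 < δ) (β s : ℝ) : 0 ≤ sphAvg α r δ β 0 s := by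
  rw [sphAvg, intervalIntegral.integral_of_le Real.pi_pos.le, integral_Ioc_eq_integral_Ioo]
  refine setIntegral_nonneg measurableSet_Ioo fun b hb => ?_
  simp only [pow_zero, one_mul]
  exact mul_nonneg (Real.rpow_nonneg (sqDist_pos hδ s b).le _)
    (Real.rpow_nonneg (Real.sin_pos_of_mem_Ioo hb).le _)

/-- The equation tested against a regularised Riesz kernel centered at any point of the plane. The
integrals are Lebesgue integrals of nonnegative functions, so no integrability has to be carried along. -/
theorem RadialProfile.lintegral_identity {m : ℕ} {α : ℝ} {u : ℝ → ℝ} (hu : RadialProfile m α u)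
    (hα1 : 1 < α) (hα : α - 2 * (m : ℝ) + 1 > 0) (P : ℂ) {δ : ℝ} (hδ : 0 < δ) :
    ENNReal.ofReal (constP m α * δ ^ (2 * m)) * ∫⁻ q, ENNReal.ofReal
      ((distSq P q + δ ^ 2) ^ (-((α + 1) / 2 + m))) * ENNReal.ofReal (u (√(distSq 0 q)))
        ∂(spaceMeasure α) =
    ∫⁻ q, ENNReal.ofReal ((distSq P q + δ ^ 2) ^ (-((α + 1) / 2 - m))) *
      ENNReal.ofReal (u (√(distSq 0 q)) ^ (critExp m α - 1)) ∂(spaceMeasure α) := by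
  -- rotation of `P` to the real axis
  have hrot : ∀ (β : ℝ) (f : ℝ → ℝ≥0∞), Measurable f →
      ∫⁻ q, ENNReal.ofReal ((distSq P q + δ ^ 2) ^ (-β)) * f (√(distSq 0 q)) ∂(spaceMeasure α) =
      ∫⁻ q, ENNReal.ofReal ((distSq ‖P‖ q + δ ^ 2) ^ (-β)) * f (√(distSq 0 q)) ∂(spaceMeasure α) := by
    intro β f hf
    have hF : Measurable fun q : ℂ × ℝ =>
        ENNReal.ofReal ((distSq P q + δ ^ 2) ^ (-β)) * f (√(distSq 0 q)) :=
      (((continuous_distSq _).measurable.add_const _).pow_const _).ennreal_ofReal.mul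
        (hf.comp (continuous_distSq 0).measurable.sqrt)
    set e := rotation (Circle.exp (Complex.arg P)) with he
    have heP : e (‖P‖ : ℂ) = P := by
      rw [he, rotation_apply, Circle.coe_exp, mul_comm, Complex.norm_mul_exp_arg_mul_I]
    rw [← lintegral_spaceMeasure_comp α hF e.measurePreserving]
    refine lintegral_congr fun q => ?_
    have h1 : distSq P (e q.1, q.2) = distSq ‖P‖ q := by
      simp only [distSq]
      rw [← heP, ← map_sub, e.norm_map, heP]
    have h2 : distSq 0 (e q.1, q.2) = distSq 0 q := by
      simp only [distSq, zero_sub, norm_neg, e.norm_map]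
    rw [h1, h2]
  have hm1 := hu.continuous.measurable.ennreal_ofReal
  have hm2 := (hu.continuous.measurable.pow_const (critExp m α - 1)).ennreal_ofReal
  rw [hrot _ (fun s => ENNReal.ofReal (u s)) hm1,
    hrot _ (fun s => ENNReal.ofReal (u s ^ (critExp m α - 1))) hm2,
    lintegral_spaceMeasure_radial hα1 hm1 _ hδ, lintegral_spaceMeasure_radial hα1 hm2 _ hδ,
    mul_left_comm]
  congr 1
  obtain ⟨h1, h2, h3⟩ := hu.identity ‖P‖ δ (norm_nonneg _) hδ
  have hcv : ∀ (β : ℝ) (f : ℝ → ℝ), (∀ s, 0 ≤ f s) →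
      IntegrableOn (fun s => f s * sphAvg α ‖P‖ δ β 0 s * s ^ α) (Ioi 0) →
      ∫⁻ s in Ioi (0 : ℝ), ENNReal.ofReal (f s) * ENNReal.ofReal (sphAvg α ‖P‖ δ β 0 s * s ^ α) =
        ENNReal.ofReal (∫ s in Ioi (0 : ℝ), f s * sphAvg α ‖P‖ δ β 0 s * s ^ α) := by
    intro β f hf hi
    rw [ofReal_integral_eq_lintegral_ofReal hi]
    · refine lintegral_congr fun s => ?_
      rw [mul_assoc, ENNReal.ofReal_mul (hf s)]
    · filter_upwards [ae_restrict_mem measurableSet_Ioi] with s hs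
      exact mul_nonneg (mul_nonneg (hf s) (sphAvg_nonneg α _ hδ β s))
        (Real.rpow_nonneg (le_of_lt hs) _)
  rw [hcv _ u hu.nonneg h1, hcv _ (fun s => u s ^ (critExp m α - 1))
    (fun s => Real.rpow_nonneg (hu.nonneg s) _) h2, ← h3,
    ← ENNReal.ofReal_mul (mul_nonneg (constP_pos hα).le (pow_nonneg hδ.le _))]

/-- The approximate identity `δ^{2m} (|q|² + δ²)^{-((α+1)/2+m)}` has finite mass. -/
theorem lintegral_bump_lt_top {m : ℕ} (hm : 1 ≤ m) {α : ℝ} (hα : 1 < α) :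
    ∫⁻ t : ℝ, ENNReal.ofReal (Real.exp ((α + 1) * t) *
      (Real.exp t ^ 2 + 1) ^ (-((α + 1) / 2 + m))) < ⊤ := by
  have hm1 : (1 : ℝ) ≤ m := by exact_mod_cast hm
  have hβ : -((α + 1) / 2 + m) ≤ 0 := by linarith
  have hle : ∀ t : ℝ, (Real.exp t ^ 2 + 1) ^ (-((α + 1) / 2 + m)) ≤ 1 := fun t =>
    Real.rpow_le_one_of_one_le_of_nonpos (by nlinarith [Real.exp_pos t]) hβ
  have hle' : ∀ t : ℝ, (Real.exp t ^ 2 + 1) ^ (-((α + 1) / 2 + m)) ≤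
      Real.exp (-(α + 1 + 2 * m) * t) := fun t => by
    have := Real.rpow_le_rpow_of_nonpos (pow_pos (Real.exp_pos t) 2)
      (by linarith : Real.exp t ^ 2 ≤ Real.exp t ^ 2 + 1) hβ
    refine this.trans (le_of_eq ?_)
    rw [← Real.exp_nat_mul, ← Real.exp_mul]
    congr 1; push_cast; ring
  have hc : Continuous fun t : ℝ => Real.exp ((α + 1) * t) *
      (Real.exp t ^ 2 + 1) ^ (-((α + 1) / 2 + m)) :=
    (by fun_prop : Continuous fun t : ℝ => Real.exp ((α + 1) * t)).mul
      ((by fun_prop : Continuous fun t : ℝ => Real.exp t ^ 2 + 1).rpow_const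
        fun t => Or.inl (by positivity))
  have hI : Integrable fun t : ℝ => Real.exp ((α + 1) * t) *
      (Real.exp t ^ 2 + 1) ^ (-((α + 1) / 2 + m)) := by
    rw [← integrableOn_univ, ← Iic_union_Ioi (a := (0 : ℝ))]
    refine IntegrableOn.union ?_ ?_
    · refine Integrable.mono' (integrableOn_exp_mul_Iic (a := α + 1) (by linarith) 0)
        hc.aestronglyMeasurable (Eventually.of_forall fun t => ?_)
      rw [Real.norm_of_nonneg (by positivity)]
      exact mul_le_of_le_one_right (Real.exp_pos _).le (hle t)
    · refine Integrable.mono' (integrableOn_exp_mul_Ioi (a := -2 * (m : ℝ)) (by linarith) 0)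
        hc.aestronglyMeasurable (Eventually.of_forall fun t => ?_)
      rw [Real.norm_of_nonneg (by positivity)]
      refine (mul_le_mul_of_nonneg_left (hle' t) (Real.exp_pos _).le).trans (le_of_eq ?_)
      rw [← Real.exp_add]; congr 1; ring
  exact hI.lintegral_lt_top

/-- The solution is a Riesz potential of its power: the integral equation equivalent to
the polyharmonic one. -/
theorem RadialProfile.representation {m : ℕ} (hm : 1 ≤ m) {α : ℝ} {u : ℝ → ℝ}
    (hu : RadialProfile m α u) (hα : α - 2 * (m : ℝ) + 1 > 0) :
    ∃ c : ℝ, 0 < c ∧ ∀ P : ℂ, ENNReal.ofReal (c * u ‖P‖) =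
      ∫⁻ q, ENNReal.ofReal (distSq P q ^ (-((α + 1) / 2 - m))) *
        ENNReal.ofReal (u (√(distSq 0 q)) ^ (critExp m α - 1)) ∂(spaceMeasure α) := by
  have hm1 : (1 : ℝ) ≤ m := by exact_mod_cast hm
  have hα1 : 1 < α := by linarith
  have hP := constP_pos hα
  set w : ℝ → ℝ := fun t => Real.exp ((α + 1) * t) *
    (Real.exp t ^ 2 + 1) ^ (-((α + 1) / 2 + m)) with hw
  have hw0 : ∀ t, 0 < w t := fun t => mul_pos (Real.exp_pos _) (Real.rpow_pos_of_pos (by positivity) _)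
  have hwm : Measurable w := Measurable.mul (Continuous.measurable (by fun_prop))
    (Measurable.pow_const (Continuous.measurable (by fun_prop)) _)
  set K : ℝ≥0∞ := ∫⁻ x, ENNReal.ofReal (w x.1) ∂((volume : Measure ℝ).prod (sphereMeasure α)) with hK
  have hKe : K = (∫⁻ t : ℝ, ENNReal.ofReal (w t)) * sphereMeasure α univ := by
    have := lintegral_prod_mul (μ := (volume : Measure ℝ)) (ν := sphereMeasure α)
      (f := fun t => ENNReal.ofReal (w t)) (g := fun _ => 1) hwm.ennreal_ofReal.aemeasurable
      aemeasurable_const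
    simpa using this
  have hKt : K ≠ ⊤ := by
    rw [hKe]
    exact ENNReal.mul_ne_top (lintegral_bump_lt_top hm hα1).ne (sphereMeasure_univ_ne_top hα1)
  have hK0 : K ≠ 0 := by
    rw [hKe]
    refine mul_ne_zero (fun h => ?_) (sphereMeasure_univ_ne_zero α)
    rw [lintegral_eq_zero_iff hwm.ennreal_ofReal] at h
    obtain ⟨t, ht⟩ := h.exists
    simp only [Pi.zero_apply, ENNReal.ofReal_eq_zero] at ht
    exact absurd (hw0 t) (not_lt.2 ht)
  refine ⟨constP m α * K.toReal, mul_pos hP (ENNReal.toReal_pos hK0 hKt), fun P => ?_⟩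
  obtain ⟨M, hM⟩ := hu.bounded
  set δ : ℕ → ℝ := fun n => 1 / ((n : ℝ) + 1) with hδ
  have hδ0 : ∀ n, 0 < δ n := fun n => by simp only [hδ]; positivity
  have hδl : Tendsto δ atTop (𝓝 0) := tendsto_one_div_add_atTop_nhds_zero_nat
  have hδa : Antitone δ := fun a b hab => by
    simp only [hδ]
    exact one_div_le_one_div_of_le (by positivity) (by exact_mod_cast Nat.succ_le_succ hab)
  have hRHS : Tendsto (fun n => ∫⁻ q, ENNReal.ofReal
      ((distSq P q + δ n ^ 2) ^ (-((α + 1) / 2 - m))) *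
      ENNReal.ofReal (u (√(distSq 0 q)) ^ (critExp m α - 1)) ∂(spaceMeasure α)) atTop
      (𝓝 (∫⁻ q, ENNReal.ofReal (distSq P q ^ (-((α + 1) / 2 - m))) *
        ENNReal.ofReal (u (√(distSq 0 q)) ^ (critExp m α - 1)) ∂(spaceMeasure α))) := by
    refine lintegral_tendsto_of_tendsto_of_monotone (fun n => Measurable.aemeasurable ?_) ?_ ?_
    · exact (((continuous_distSq _).measurable.add_const _).pow_const _).ennreal_ofReal.mul
        ((hu.continuous.measurable.comp (continuous_distSq 0).measurable.sqrt).pow_const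
          _).ennreal_ofReal
    · refine Eventually.of_forall fun q a b hab => ?_
      refine mul_le_mul_left (ENNReal.ofReal_le_ofReal ?_) _
      refine Real.rpow_le_rpow_of_nonpos (add_pos_of_nonneg_of_pos (distSq_nonneg P q)
        (pow_pos (hδ0 b) 2)) ?_ (by linarith)
      have := pow_le_pow_left₀ (hδ0 b).le (hδa hab) 2
      linarith
    · filter_upwards [ae_spaceMeasure_snd_pos α] with q hq
      have h0 : 0 < distSq P q := by unfold distSq; positivity
      refine ENNReal.Tendsto.mul_const (ENNReal.tendsto_ofReal ?_) (Or.inr ENNReal.ofReal_ne_top)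
      have h1 : Tendsto (fun n => distSq P q + δ n ^ 2) atTop (𝓝 (distSq P q)) := by
        simpa using (hδl.pow 2).const_add (distSq P q)
      exact h1.rpow_const (Or.inl h0.ne')
  -- in logarithmic coordinates around `P`, a change of `δ` is a translation
  have hLeq : ∀ n, ENNReal.ofReal (constP m α * δ n ^ (2 * m)) * ∫⁻ q, ENNReal.ofReal
      ((distSq P q + δ n ^ 2) ^ (-((α + 1) / 2 + m))) * ENNReal.ofReal (u (√(distSq 0 q)))
        ∂(spaceMeasure α) = ENNReal.ofReal (constP m α) * ∫⁻ x, ENNReal.ofReal (w x.1) *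
        ENNReal.ofReal (u (√(distSq 0 (δ n * (expPoint x).1 + P, δ n * (expPoint x).2))))
        ∂((volume : Measure ℝ).prod (sphereMeasure α)) := by
    intro n
    have hd := hδ0 n
    have hF : Measurable fun q : ℂ × ℝ => ENNReal.ofReal
        ((distSq P q + δ n ^ 2) ^ (-((α + 1) / 2 + m))) * ENNReal.ofReal (u (√(distSq 0 q))) :=
      (((continuous_distSq _).measurable.add_const _).pow_const _).ennreal_ofReal.mul
        (hu.continuous.measurable.comp (continuous_distSq 0).measurable.sqrt).ennreal_ofReal
    have hF' : Measurable fun q : ℂ × ℝ => ENNReal.ofReal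
        ((distSq P (q.1 + P, q.2) + δ n ^ 2) ^ (-((α + 1) / 2 + m))) *
          ENNReal.ofReal (u (√(distSq 0 (q.1 + P, q.2)))) :=
      hF.comp (Continuous.measurable (by fun_prop))
    rw [← lintegral_spaceMeasure_comp α hF (measurePreserving_add_right volume P),
      lintegral_spaceMeasure_expPoint α hF']
    have hsh := (measurePreserving_add_right (volume : Measure ℝ) (Real.log (δ n))).prod
      (MeasurePreserving.id (sphereMeasure α))
    have hG : Measurable fun x : ℝ × (ℝ × ℝ) => ENNReal.ofReal (Real.exp ((α + 1) * x.1)) *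
        (ENNReal.ofReal ((distSq P ((expPoint x).1 + P, (expPoint x).2) + δ n ^ 2) ^
          (-((α + 1) / 2 + m))) *
          ENNReal.ofReal (u (√(distSq 0 ((expPoint x).1 + P, (expPoint x).2))))) :=
      (Continuous.measurable (by fun_prop)).ennreal_ofReal.mul
        (hF'.comp continuous_expPoint.measurable)
    rw [← hsh.lintegral_comp hG,
      ENNReal.ofReal_mul hP.le, mul_assoc, ← lintegral_const_mul' _ _ ENNReal.ofReal_ne_top]
    congr 1
    refine lintegral_congr fun x => ?_
    have hexp : Real.exp (x.1 + Real.log (δ n)) = δ n * Real.exp x.1 := by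
      rw [Real.exp_add, Real.exp_log hd, mul_comm]
    have h1 : expPoint (Prod.map (fun t => t + Real.log (δ n)) id x) =
        (δ n * (expPoint x).1, δ n * (expPoint x).2) := by
      simp only [expPoint, Prod.map_fst, Prod.map_snd, id, hexp]
      push_cast
      rw [mul_assoc, mul_assoc]
    have h2 : distSq P (δ n * (expPoint x).1 + P, δ n * (expPoint x).2) = (δ n * Real.exp x.1) ^ 2 := by
      have h3 := distSq_zero_expPoint x
      simp only [distSq, zero_sub, norm_neg] at h3 ⊢
      rw [show P - (δ n * (expPoint x).1 + P) = -(δ n * (expPoint x).1) by ring, norm_neg, norm_mul,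
        Complex.norm_real, Real.norm_of_nonneg hd.le, mul_pow, mul_pow, mul_pow, ← h3]
      ring
    simp only [h1, h2]
    rw [← mul_assoc, ← mul_assoc]
    congr 1
    rw [← ENNReal.ofReal_mul (by positivity), ← ENNReal.ofReal_mul (by positivity)]
    congr 1
    have e1 : (δ n * Real.exp x.1) ^ 2 + δ n ^ 2 = δ n ^ 2 * (Real.exp x.1 ^ 2 + 1) := by ring
    simp only [hw, Prod.map_fst]
    rw [e1, Real.mul_rpow (by positivity) (by positivity), mul_add, Real.exp_add,
      mul_comm (α + 1) (Real.log _), Real.exp_mul (Real.log _), Real.exp_log hd, ← Real.rpow_natCast (δ n) 2,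
      ← Real.rpow_natCast (δ n) (2 * m), ← Real.rpow_mul hd.le]
    have e2 : δ n ^ ((2 * m : ℕ) : ℝ) * δ n ^ (α + 1) * δ n ^ (((2 : ℕ) : ℝ) * -((α + 1) / 2 + m)) = 1 := by
      rw [← Real.rpow_add hd, ← Real.rpow_add hd, ← Real.rpow_zero (δ n)]
      congr 1; push_cast; ring
    linear_combination (Real.exp ((α + 1) * x.1) *
      (Real.exp x.1 ^ 2 + 1) ^ (-((α + 1) / 2 + m))) * e2
  have hLHS : Tendsto (fun n => ENNReal.ofReal (constP m α) * ∫⁻ x, ENNReal.ofReal (w x.1) *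
        ENNReal.ofReal (u (√(distSq 0 (δ n * (expPoint x).1 + P, δ n * (expPoint x).2))))
        ∂((volume : Measure ℝ).prod (sphereMeasure α))) atTop
      (𝓝 (ENNReal.ofReal (constP m α) * ∫⁻ x, ENNReal.ofReal (w x.1) *
        ENNReal.ofReal (u ‖P‖) ∂((volume : Measure ℝ).prod (sphereMeasure α)))) := by
    refine ENNReal.Tendsto.const_mul ?_ (Or.inr ENNReal.ofReal_ne_top)
    refine tendsto_lintegral_of_dominated_convergence
      (fun x => ENNReal.ofReal (w x.1) * ENNReal.ofReal M) (fun n => ?_) (fun n => ?_) ?_ ?_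
    · have hc : Continuous fun x => √(distSq 0 (δ n * (expPoint x).1 + P, δ n * (expPoint x).2)) := by
        have h1 := continuous_distSq 0
        have h2 := continuous_expPoint
        fun_prop
      exact (hwm.comp measurable_fst).ennreal_ofReal.mul
        (hu.continuous.comp hc).measurable.ennreal_ofReal
    · exact Eventually.of_forall fun x => by
        refine mul_le_mul_right (ENNReal.ofReal_le_ofReal (hM _)) _
    · rw [lintegral_mul_const' _ _ ENNReal.ofReal_ne_top]
      exact ENNReal.mul_ne_top hKt ENNReal.ofReal_ne_top
    · refine Eventually.of_forall fun x => ?_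
      refine ENNReal.Tendsto.const_mul (ENNReal.tendsto_ofReal ?_) (Or.inr ENNReal.ofReal_ne_top)
      have hc : Continuous fun d : ℝ => u (√(distSq 0 (d * (expPoint x).1 + P, d * (expPoint x).2))) := by
        have h1 := continuous_distSq 0
        have h2 := hu.continuous
        fun_prop
      have := (hc.tendsto 0).comp hδl
      simpa [Function.comp_def, distSq, Real.sqrt_sq (norm_nonneg P)] using this
  have hfin := tendsto_nhds_unique (hLHS.congr fun n => by
    rw [← hLeq n, hu.lintegral_identity hα1 hα P (hδ0 n)]) hRHS
  rw [← hfin, lintegral_mul_const' _ _ ENNReal.ofReal_ne_top, ← hK,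
    ENNReal.ofReal_mul (by positivity), ENNReal.ofReal_mul hP.le, ENNReal.ofReal_toReal hKt, mul_assoc]

/-! ### The integral equation on a cylinder -/

/-- The cosine of the angle between the points of the unit sphere with spherical coordinates `(b, 0)`
and `y`. -/
noncomputable def cosAngle (b : ℝ) (y : ℝ × ℝ) : ℝ :=
  Real.cos b * Real.cos y.1 + Real.sin b * Real.sin y.1 * Real.cos y.2

/-- The kernel `|P - q|^{-2γ}` in logarithmic coordinates, after conjugation with `|P|^γ`:
it depends only on the difference `s` of the logarithms of the radii and on the angle. -/
noncomputable def cylKernel (γ b s : ℝ) (y : ℝ × ℝ) : ℝ :=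
  (2 * Real.cosh s - 2 * cosAngle b y) ^ (-γ)

/-- The point `e^t e^{ib}` of the distinguished plane. -/
noncomputable def expPlane (t b : ℝ) : ℂ :=
  ((Real.exp t * Real.cos b : ℝ) : ℂ) + ((Real.exp t * Real.sin b : ℝ) : ℂ) * Complex.I

/-- A sum of squares, the last of which vanishes only for `y` on the edges of the coordinate square. -/
theorem two_cosh_sub_eq (b s : ℝ) (y : ℝ × ℝ) :
    2 * Real.cosh s - 2 * cosAngle b y = 2 * (Real.cosh s - 1) +
      ((Real.cos b - Real.cos y.1) ^ 2 + (Real.sin b - Real.sin y.1 * Real.cos y.2) ^ 2 +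
        (Real.sin y.1 * Real.sin y.2) ^ 2) := by
  unfold cosAngle
  linear_combination (-1 : ℝ) * Real.sin_sq_add_cos_sq b - Real.sin_sq_add_cos_sq y.1 -
    Real.sin y.1 ^ 2 * Real.sin_sq_add_cos_sq y.2

theorem two_cosh_sub_nonneg (b s : ℝ) (y : ℝ × ℝ) : 0 ≤ 2 * Real.cosh s - 2 * cosAngle b y := by
  rw [two_cosh_sub_eq]
  have := Real.one_le_cosh s
  have : 0 ≤ Real.cosh s - 1 := by linarith
  positivity

theorem two_cosh_sub_pos (b s : ℝ) {y : ℝ × ℝ} (hy : y ∈ Ioo 0 Real.pi ×ˢ Ioo 0 Real.pi) :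
    0 < 2 * Real.cosh s - 2 * cosAngle b y := by
  rw [two_cosh_sub_eq]
  have := Real.one_le_cosh s
  have : 0 ≤ Real.cosh s - 1 := by linarith
  have h1 := Real.sin_pos_of_mem_Ioo hy.1
  have h2 := Real.sin_pos_of_mem_Ioo hy.2
  positivity

theorem cylKernel_nonneg (γ b s : ℝ) (y : ℝ × ℝ) : 0 ≤ cylKernel γ b s y :=
  Real.rpow_nonneg (two_cosh_sub_nonneg b s y) _

theorem cylKernel_congr (γ b : ℝ) {s s' : ℝ} (h : |s| = |s'|) (y : ℝ × ℝ) :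
    cylKernel γ b s y = cylKernel γ b s' y := by
  rw [cylKernel, cylKernel, ← Real.cosh_abs s, h, Real.cosh_abs]

theorem cylKernel_lt {γ : ℝ} (hγ : 0 < γ) (b : ℝ) {s s' : ℝ} (h : |s| < |s'|) {y : ℝ × ℝ}
    (hy : y ∈ Ioo 0 Real.pi ×ˢ Ioo 0 Real.pi) : cylKernel γ b s' y < cylKernel γ b s y := by
  refine Real.rpow_lt_rpow_of_neg (two_cosh_sub_pos b s hy) ?_ (by linarith)
  linarith [Real.cosh_lt_cosh.2 h]

theorem measurable_cylKernel (γ b : ℝ) {f : ℝ × (ℝ × ℝ) → ℝ} (hf : Measurable f) :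
    Measurable fun x : ℝ × (ℝ × ℝ) => cylKernel γ b (f x) x.2 := by
  unfold cylKernel cosAngle
  exact Measurable.pow_const (by fun_prop) _

theorem distSq_expPlane_expPoint (t b : ℝ) (x : ℝ × (ℝ × ℝ)) :
    distSq (expPlane t b) (expPoint x) =
      Real.exp (t + x.1) * (2 * Real.cosh (t - x.1) - 2 * cosAngle b x.2) := by
  have h : expPlane t b - (expPoint x).1 =
      ((Real.exp t * Real.cos b - Real.exp x.1 * Real.cos x.2.1 : ℝ) : ℂ) +
        ((Real.exp t * Real.sin b - Real.exp x.1 * (Real.sin x.2.1 * Real.cos x.2.2) : ℝ) : ℂ) *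
          Complex.I := by
    unfold expPlane expPoint spherePoint; push_cast; ring
  have e1 : Real.exp (t + x.1) * Real.exp (t - x.1) = Real.exp t ^ 2 := by
    rw [← Real.exp_add, ← Real.exp_nat_mul]; congr 1; push_cast; ring
  have e2 : Real.exp (t + x.1) * Real.exp (-(t - x.1)) = Real.exp x.1 ^ 2 := by
    rw [← Real.exp_add, ← Real.exp_nat_mul]; congr 1; push_cast; ring
  rw [distSq, h, sq_norm_eq, Real.cosh_eq, cosAngle]
  simp only [expPoint, spherePoint]
  linear_combination -e1 - e2 + (2 * (Real.cos b * Real.cos x.2.1 +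
    Real.sin b * Real.sin x.2.1 * Real.cos x.2.2)) * Real.exp_add t x.1 +
    Real.exp t ^ 2 * Real.sin_sq_add_cos_sq b + Real.exp x.1 ^ 2 * Real.sin_sq_add_cos_sq x.2.1 +
    Real.exp x.1 ^ 2 * Real.sin x.2.1 ^ 2 * Real.sin_sq_add_cos_sq x.2.2

theorem distSq_expPlane_rpow (γ t b : ℝ) (x : ℝ × (ℝ × ℝ)) :
    distSq (expPlane t b) (expPoint x) ^ (-γ) =
      Real.exp (-γ * t) * Real.exp (-γ * x.1) * cylKernel γ b (t - x.1) x.2 := by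
  rw [distSq_expPlane_expPoint, Real.mul_rpow (Real.exp_pos _).le (two_cosh_sub_nonneg _ _ _),
    ← Real.exp_mul, ← Real.exp_add, cylKernel]
  congr 2; ring

/-- The integral of the kernel over a cylindrical set `I × sphere` is small, uniformly in the pole, when
the set has small measure. -/
theorem exists_lintegral_cylKernel_le {m : ℕ} (hm : 1 ≤ m) {α : ℝ} (hα : α - 2 * (m : ℝ) + 1 > 0)
    {ε : ℝ} (hε : 0 < ε) : ∃ δ, 0 < δ ∧ ∀ I : Set ℝ,
      ∫⁻ t in I, ENNReal.ofReal (Real.exp ((α + 1) * t)) ≤ ENNReal.ofReal δ → ∀ t b : ℝ,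
      ∫⁻ x, ENNReal.ofReal (Real.exp ((α + 1) * x.1)) *
        ENNReal.ofReal (distSq (expPlane t b) (expPoint x) ^ (-((α + 1) / 2 - m)))
        ∂((volume.restrict I).prod (sphereMeasure α)) ≤ ENNReal.ofReal ε := by
  have hm1 : (1 : ℝ) ≤ m := by exact_mod_cast hm
  set γ := (α + 1) / 2 - m with hγ
  have hγ0 : 0 < γ := by rw [hγ]; linarith
  set V := (sphereMeasure α univ).toReal with hV
  have hVe : sphereMeasure α univ = ENNReal.ofReal V :=
    (ENNReal.ofReal_toReal (sphereMeasure_univ_ne_top (by linarith))).symm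
  have hV0 : 0 ≤ V := ENNReal.toReal_nonneg
  obtain ⟨k, hk⟩ : ∃ k : ℝ, Real.exp (2 * m * k) / (2 * m) * V ≤ ε / 2 := by
    have h1 : Tendsto (fun k : ℝ => Real.exp (2 * m * k) / (2 * m) * V) atBot (𝓝 0) := by
      have := (Real.tendsto_exp_atBot.comp
        (tendsto_id.const_mul_atBot (by linarith : (0 : ℝ) < 2 * m))).div_const (2 * (m : ℝ))
      simpa using this.mul_const V
    exact (h1.eventually_le_const (half_pos hε)).exists
  refine ⟨ε / (2 * (V + 1)) * Real.exp (2 * γ * k), by positivity, fun I hIδ t b => ?_⟩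
  set η := Real.exp k ^ 2 with hη
  have hη0 : 0 < η := by positivity
  set g : ℝ → ℝ := (Iio η).indicator fun d => d ^ (-γ) with hg
  have hgm : Measurable g := (measurable_id.pow_const _).indicator measurableSet_Iio
  have hg0 : ∀ d, 0 ≤ d → 0 ≤ g d := fun d hd => by
    rw [hg, indicator_apply]
    split_ifs
    · exact Real.rpow_nonneg hd _
    · exact le_rfl
  have hG : Measurable fun q => ENNReal.ofReal (g (distSq (expPlane t b) q)) :=
    (hgm.comp (continuous_distSq _).measurable).ennreal_ofReal
  have hG' : Measurable fun q => ENNReal.ofReal (g (distSq 0 q)) :=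
    (hgm.comp (continuous_distSq _).measurable).ennreal_ofReal
  -- the contribution of the ball of radius `e^k` around the pole
  have hnear : ∫⁻ q, ENNReal.ofReal (g (distSq (expPlane t b) q)) ∂(spaceMeasure α) ≤
      ENNReal.ofReal (ε / 2) := by
    rw [← lintegral_spaceMeasure_comp α hG (measurePreserving_add_right volume (expPlane t b))]
    have e1 : ∀ q : ℂ × ℝ, distSq (expPlane t b) (q.1 + expPlane t b, q.2) = distSq 0 q := fun q => by
      simp only [distSq, sub_add_cancel_right, zero_sub]
    simp only [e1]
    rw [lintegral_spaceMeasure_expPoint α hG']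
    have e2 : ∀ x : ℝ × (ℝ × ℝ), ENNReal.ofReal (Real.exp ((α + 1) * x.1)) *
        ENNReal.ofReal (g (distSq 0 (expPoint x))) =
        (Iio k).indicator (fun t => ENNReal.ofReal (Real.exp (2 * m * t))) x.1 * 1 := fun x => by
      rw [distSq_zero_expPoint, hg, mul_one]
      by_cases hx : x.1 < k
      · have : Real.exp x.1 ^ 2 < η := pow_lt_pow_left₀ (Real.exp_lt_exp.2 hx) (Real.exp_pos _).le (by simp)
        rw [indicator_of_mem (mem_Iio.2 this), indicator_of_mem (mem_Iio.2 hx),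
          ← ENNReal.ofReal_mul (Real.exp_pos _).le, ← Real.exp_nat_mul, ← Real.exp_mul, ← Real.exp_add]
        congr 2; rw [hγ]; push_cast; ring
      · have : ¬ Real.exp x.1 ^ 2 < η :=
          not_lt.2 (pow_le_pow_left₀ (Real.exp_pos _).le (Real.exp_le_exp.2 (not_lt.1 hx)) _)
        rw [indicator_of_notMem (by simpa using this), indicator_of_notMem (by simpa using hx),
          ENNReal.ofReal_zero, mul_zero]
    simp only [e2]
    rw [lintegral_prod_mul (f := (Iio k).indicator fun t => ENNReal.ofReal (Real.exp (2 * m * t)))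
      (g := fun _ => 1) (Measurable.aemeasurable ((Continuous.measurable
        (by fun_prop)).ennreal_ofReal.indicator measurableSet_Iio)) aemeasurable_const,
      lintegral_indicator measurableSet_Iio, lintegral_one, hVe,
      setLIntegral_congr Iio_ae_eq_Iic, ← ofReal_integral_eq_lintegral_ofReal
        (integrableOn_exp_mul_Iic (by linarith) k) (Eventually.of_forall fun t => (Real.exp_pos _).le),
      integral_exp_mul_Iic (by linarith), ← ENNReal.ofReal_mul (by positivity)]
    exact ENNReal.ofReal_le_ofReal hk
  have hfar : ∫⁻ x, ENNReal.ofReal (Real.exp ((α + 1) * x.1)) * ENNReal.ofReal (η ^ (-γ))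
      ∂((volume.restrict I).prod (sphereMeasure α)) ≤ ENNReal.ofReal (ε / 2) := by
    have e1 := lintegral_prod_mul (μ := volume.restrict I) (ν := sphereMeasure α)
      (f := fun t => ENNReal.ofReal (Real.exp ((α + 1) * t))) (g := fun _ => ENNReal.ofReal (η ^ (-γ)))
      (Measurable.aemeasurable (Continuous.measurable (by fun_prop)).ennreal_ofReal) aemeasurable_const
    rw [e1, lintegral_const, hVe]
    refine (mul_le_mul_left hIδ _).trans ?_
    rw [← ENNReal.ofReal_mul (by positivity), ← ENNReal.ofReal_mul (by positivity)]
    refine ENNReal.ofReal_le_ofReal ?_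
    have e2 : Real.exp (2 * γ * k) * η ^ (-γ) = 1 := by
      rw [hη, ← Real.exp_nat_mul, ← Real.exp_mul, ← Real.exp_add, ← Real.exp_zero]
      congr 1; push_cast; ring
    calc ε / (2 * (V + 1)) * Real.exp (2 * γ * k) * (η ^ (-γ) * V)
        = ε / (2 * (V + 1)) * V * (Real.exp (2 * γ * k) * η ^ (-γ)) := by ring
      _ = ε / 2 * (V / (V + 1)) := by rw [e2]; field_simp
      _ ≤ ε / 2 := mul_le_of_le_one_right (by positivity) ((div_le_one (by positivity)).2 (by linarith))
  have hmw : Measurable fun x : ℝ × (ℝ × ℝ) => ENNReal.ofReal (Real.exp ((α + 1) * x.1)) :=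
    (Continuous.measurable (by fun_prop)).ennreal_ofReal
  have hle : (volume.restrict I).prod (sphereMeasure α) ≤ (volume : Measure ℝ).prod (sphereMeasure α) := by
    have := Measure.prod_restrict (μ := (volume : Measure ℝ)) (ν := sphereMeasure α) I univ
    rw [Measure.restrict_univ] at this
    rw [this]
    exact Measure.restrict_le_self
  calc _ ≤ ∫⁻ x, (ENNReal.ofReal (Real.exp ((α + 1) * x.1)) *
          ENNReal.ofReal (g (distSq (expPlane t b) (expPoint x))) +
          ENNReal.ofReal (Real.exp ((α + 1) * x.1)) * ENNReal.ofReal (η ^ (-γ)))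
          ∂((volume.restrict I).prod (sphereMeasure α)) := by
        refine lintegral_mono fun x => ?_
        rw [← mul_add, ← ENNReal.ofReal_add (hg0 _ (distSq_nonneg _ _))
          (Real.rpow_nonneg hη0.le _)]
        refine mul_le_mul_right (ENNReal.ofReal_le_ofReal ?_) _
        by_cases hx : distSq (expPlane t b) (expPoint x) < η
        · rw [hg, indicator_of_mem (mem_Iio.2 hx)]
          linarith [Real.rpow_nonneg hη0.le (-γ)]
        · rw [hg, indicator_of_notMem (by simpa using hx), zero_add]
          exact Real.rpow_le_rpow_of_nonpos hη0 (not_lt.1 hx) (by linarith)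
    _ = ∫⁻ x, ENNReal.ofReal (Real.exp ((α + 1) * x.1)) *
          ENNReal.ofReal (g (distSq (expPlane t b) (expPoint x)))
          ∂((volume.restrict I).prod (sphereMeasure α)) + ∫⁻ x,
          ENNReal.ofReal (Real.exp ((α + 1) * x.1)) * ENNReal.ofReal (η ^ (-γ))
          ∂((volume.restrict I).prod (sphereMeasure α)) :=
        lintegral_add_right _ (hmw.mul_const _)
    _ ≤ ENNReal.ofReal (ε / 2) + ENNReal.ofReal (ε / 2) := by
        refine add_le_add ((lintegral_mono' hle le_rfl).trans ?_) hfar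
        rw [← lintegral_spaceMeasure_expPoint α hG]
        exact hnear
    _ = ENNReal.ofReal ε := by
        rw [← ENNReal.ofReal_add (half_pos hε).le (half_pos hε).le, add_halves]

/-- The distance to the origin of the point `x₀ + e^t e^{ib}`. -/
noncomputable def cylRadius (x₀ t b : ℝ) : ℝ :=
  √((x₀ + Real.exp t * Real.cos b) ^ 2 + (Real.exp t * Real.sin b) ^ 2)

theorem cylRadius_eq_norm (x₀ t b : ℝ) : cylRadius x₀ t b = ‖expPlane t b + x₀‖ := by
  rw [cylRadius, ← sq_norm_eq, Real.sqrt_sq (norm_nonneg _), expPlane]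
  congr 1; push_cast; ring

theorem sqrt_distSq_expPoint_add (x₀ : ℝ) (x : ℝ × (ℝ × ℝ)) :
    √(distSq 0 ((expPoint x).1 + x₀, (expPoint x).2)) = cylRadius x₀ x.1 x.2.1 := by
  rw [cylRadius]
  congr 1
  have h : (0 : ℂ) - ((expPoint x).1 + x₀) =
      ((-(x₀ + Real.exp x.1 * Real.cos x.2.1) : ℝ) : ℂ) +
        ((-(Real.exp x.1 * (Real.sin x.2.1 * Real.cos x.2.2)) : ℝ) : ℂ) * Complex.I := by
    unfold expPoint spherePoint; push_cast; ring
  simp only [distSq]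
  rw [h, sq_norm_eq]
  simp only [expPoint, spherePoint]
  linear_combination (Real.exp x.1 ^ 2 * Real.sin x.2.1 ^ 2) * Real.sin_sq_add_cos_sq x.2.2

/-- The hypotheses of the method of moving planes for a function `Φ(t, b)` on the cylinder: the
integral equation, and growth conditions which are not symmetric in `t`. -/
structure CylProfile (m : ℕ) (α : ℝ) (Φ : ℝ → ℝ → ℝ) : Prop where
  continuous : Continuous fun z : ℝ × ℝ => Φ z.1 z.2
  nonneg : ∀ t b, 0 ≤ Φ t b
  pos : 0 < Φ 0 0
  bounded : ∃ M, 0 ≤ M ∧ ∀ t b, Φ t b ≤ M * Real.exp (((α + 1) / 2 - m) * t)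
  tendsto : Tendsto (fun t => Φ t 0) atTop (𝓝 0)
  equation : ∃ c : ℝ, 0 < c ∧ ∀ t b, ENNReal.ofReal (c * Φ t b) =
    ∫⁻ x, ENNReal.ofReal (cylKernel ((α + 1) / 2 - m) b (t - x.1) x.2) *
      ENNReal.ofReal (Φ x.1 x.2.1 ^ (critExp m α - 1))
      ∂((volume : Measure ℝ).prod (sphereMeasure α))

/-- Criticality of the exponent: it makes the weights in `e^t` cancel in logarithmic coordinates. -/
theorem mul_critExp_sub_one {m : ℕ} {α : ℝ} (hα : α - 2 * (m : ℝ) + 1 > 0) :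
    ((α + 1) / 2 - m) * (critExp m α - 1) = (α + 1) / 2 + m := by
  rw [critExp]
  field_simp
  ring

/-- Logarithmic polar coordinates centered at the point `x₀` of the axis. The growth bounds of
`CylProfile` express that `u` is bounded and that `u = o(r^{-γ})` at infinity. -/
theorem RadialProfile.cylProfile {m : ℕ} (hm : 1 ≤ m) {α : ℝ} {u : ℝ → ℝ}
    (hu : RadialProfile m α u) (hα : α - 2 * (m : ℝ) + 1 > 0) {x₀ : ℝ} (hx₀ : 0 < x₀) :
    CylProfile m α fun t b => Real.exp (((α + 1) / 2 - m) * t) * u (cylRadius x₀ t b) := by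
  set γ := (α + 1) / 2 - m with hγ
  have hγ0 : 0 < γ := by rw [hγ]; linarith
  set p := critExp m α - 1 with hp
  have hrc : Continuous fun z : ℝ × ℝ => cylRadius x₀ z.1 z.2 := by unfold cylRadius; fun_prop
  have hr0 : ∀ t, cylRadius x₀ t 0 = x₀ + Real.exp t := fun t => by
    rw [cylRadius, Real.cos_zero, Real.sin_zero, mul_one, mul_zero, zero_pow two_ne_zero, add_zero,
      Real.sqrt_sq (by positivity)]
  refine ⟨?_, fun t b => mul_nonneg (Real.exp_pos _).le (hu.nonneg _), ?_, ?_, ?_, ?_⟩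
  · exact (by fun_prop : Continuous fun z : ℝ × ℝ => Real.exp (γ * z.1)).mul (hu.continuous.comp hrc)
  · rw [hr0]
    exact mul_pos (Real.exp_pos _) (hu.pos _ (by positivity))
  · obtain ⟨M, hM⟩ := hu.bounded
    refine ⟨M, (hu.nonneg 0).trans (hM 0), fun t b => ?_⟩
    rw [mul_comm]
    exact mul_le_mul_of_nonneg_right (hM _) (Real.exp_pos _).le
  · rw [Metric.tendsto_atTop]
    intro ε hε
    obtain ⟨R, hR1, hR⟩ := hu.decay (ε / 2) (half_pos hε)
    refine ⟨Real.log R, fun t ht => ?_⟩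
    have h1 : R ≤ Real.exp t := by
      rw [← Real.exp_log (by linarith : 0 < R)]; exact Real.exp_le_exp.2 ht
    rw [Real.dist_0_eq_abs, abs_of_nonneg (mul_nonneg (Real.exp_pos _).le (hu.nonneg _)), hr0]
    have h2 := hR (x₀ + Real.exp t) (by linarith)
    have h3 : (x₀ + Real.exp t) ^ (-γ) ≤ Real.exp t ^ (-γ) :=
      Real.rpow_le_rpow_of_nonpos (Real.exp_pos t) (by linarith) (by linarith)
    have h4 : Real.exp (γ * t) * Real.exp t ^ (-γ) = 1 := by
      rw [← Real.exp_mul, ← Real.exp_add, ← Real.exp_zero]; congr 1; ring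
    calc Real.exp (γ * t) * u (x₀ + Real.exp t)
        ≤ Real.exp (γ * t) * (ε / 2 * Real.exp t ^ (-γ)) :=
          mul_le_mul_of_nonneg_left (h2.trans (mul_le_mul_of_nonneg_left h3 (half_pos hε).le))
            (Real.exp_pos _).le
      _ = ε / 2 * (Real.exp (γ * t) * Real.exp t ^ (-γ)) := by ring
      _ < ε := by rw [h4]; linarith
  · obtain ⟨c, hc, hrep⟩ := hu.representation hm hα
    refine ⟨c, hc, fun t b => ?_⟩
    have hF : Measurable fun q : ℂ × ℝ => ENNReal.ofReal (distSq (expPlane t b + x₀) q ^ (-γ)) *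
        ENNReal.ofReal (u (√(distSq 0 q)) ^ p) :=
      ((continuous_distSq _).measurable.pow_const _).ennreal_ofReal.mul
        ((hu.continuous.measurable.comp (continuous_distSq 0).measurable.sqrt).pow_const
          _).ennreal_ofReal
    have e1 : ∀ q : ℂ × ℝ, distSq (expPlane t b + x₀) (q.1 + x₀, q.2) = distSq (expPlane t b) q :=
      fun q => by simp only [distSq, add_sub_add_right_eq_sub]
    have hF' : Measurable fun q : ℂ × ℝ => ENNReal.ofReal (distSq (expPlane t b) q ^ (-γ)) *
        ENNReal.ofReal (u (√(distSq 0 (q.1 + x₀, q.2))) ^ p) := by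
      have := hF.comp
        (by fun_prop : Continuous fun q : ℂ × ℝ => (q.1 + (x₀ : ℂ), q.2)).measurable
      simpa only [Function.comp_def, e1] using this
    rw [cylRadius_eq_norm, mul_left_comm, ENNReal.ofReal_mul (Real.exp_pos _).le, hrep,
      ← lintegral_spaceMeasure_comp α hF (measurePreserving_add_right volume (x₀ : ℂ))]
    simp only [e1]
    rw [lintegral_spaceMeasure_expPoint α hF', ← lintegral_const_mul' _ _ ENNReal.ofReal_ne_top]
    refine lintegral_congr fun x => ?_
    rw [sqrt_distSq_expPoint_add, distSq_expPlane_rpow, ← mul_assoc, ← mul_assoc,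
      ← ENNReal.ofReal_mul (Real.exp_pos _).le, ← ENNReal.ofReal_mul (by positivity),
      ← ENNReal.ofReal_mul (by have := cylKernel_nonneg γ b (t - x.1) x.2; positivity),
      ← ENNReal.ofReal_mul (cylKernel_nonneg _ _ _ _), Real.mul_rpow (Real.exp_pos _).le (hu.nonneg _),
      ← Real.exp_mul]
    congr 1
    have e3 : γ * x.1 * p = (α + 1) * x.1 + -γ * x.1 := by
      have := mul_critExp_sub_one (m := m) hα
      rw [mul_right_comm, hp, this, hγ]; ring
    have e4 : Real.exp (γ * t) * Real.exp (-γ * t) = 1 := by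
      rw [← Real.exp_add, ← Real.exp_zero]; congr 1; ring
    rw [e3, Real.exp_add]
    linear_combination (Real.exp ((α + 1) * x.1) * Real.exp (-γ * x.1) *
      cylKernel γ b (t - x.1) x.2 * u (cylRadius x₀ x.1 x.2.1) ^ p) * e4

/-! ### The method of moving planes -/

theorem restrict_prod_eq (α : ℝ) (s : Set ℝ) : (volume.restrict s).prod (sphereMeasure α) =
    ((volume : Measure ℝ).prod (sphereMeasure α)).restrict (s ×ˢ univ) := by
  rw [← Measure.prod_restrict, Measure.restrict_univ]

/-- Folding an integral over the cylinder along the section `t = τ`. -/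
theorem lintegral_fold (α τ : ℝ) {F : ℝ × (ℝ × ℝ) → ℝ≥0∞} (hF : Measurable F) :
    ∫⁻ x, F x ∂((volume : Measure ℝ).prod (sphereMeasure α)) =
      ∫⁻ x, (F x + F (2 * τ - x.1, x.2)) ∂((volume.restrict (Iio τ)).prod (sphereMeasure α)) := by
  have hF' : Measurable fun x : ℝ × (ℝ × ℝ) => F (2 * τ - x.1, x.2) :=
    hF.comp (Continuous.measurable (by fun_prop))
  have hg : Measurable fun t => ∫⁻ y, F (t, y) ∂(sphereMeasure α) := hF.lintegral_prod_right'
  have hR := (Measure.measurePreserving_sub_left (volume : Measure ℝ)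
    (2 * τ)).setLIntegral_comp_preimage (measurableSet_Ioi (a := τ)) hg
  have hpre : (fun t => 2 * τ - t) ⁻¹' Ioi τ = Iio τ := by
    ext t; simp only [mem_preimage, mem_Ioi, mem_Iio]; constructor <;> intro h <;> linarith
  rw [hpre] at hR
  rw [lintegral_add_left hF, lintegral_prod _ hF.aemeasurable, lintegral_prod _ hF.aemeasurable,
    lintegral_prod _ hF'.aemeasurable, hR, ← lintegral_add_compl _ (measurableSet_Iio (a := τ)),
    compl_Iio, setLIntegral_congr Ioi_ae_eq_Ici]

/-- The integral equation as an integral over the half-cylinder `t < τ`, where the values of `Φ` and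
of its reflection occur with the two kernels `κ(t - t') ≥ κ(2τ - t - t')`. The value of `Φ` at `2τ - t`
is obtained by exchanging the kernels. -/
theorem CylProfile.exists_fold {m : ℕ} {α : ℝ} {Φ : ℝ → ℝ → ℝ} (hΦ : CylProfile m α Φ) :
    ∃ c : ℝ, 0 < c ∧ ∀ τ t b, ENNReal.ofReal (c * Φ t b) =
      ∫⁻ x, ENNReal.ofReal
        (cylKernel ((α + 1) / 2 - m) b (t - x.1) x.2 * Φ x.1 x.2.1 ^ (critExp m α - 1) +
          cylKernel ((α + 1) / 2 - m) b (2 * τ - t - x.1) x.2 *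
            Φ (2 * τ - x.1) x.2.1 ^ (critExp m α - 1))
        ∂((volume.restrict (Iio τ)).prod (sphereMeasure α)) := by
  obtain ⟨c, hc, h⟩ := hΦ.equation
  refine ⟨c, hc, fun τ t b => ?_⟩
  have hm : Measurable fun x : ℝ × (ℝ × ℝ) => Φ x.1 x.2.1 :=
    (hΦ.continuous.comp (by fun_prop : Continuous fun x : ℝ × (ℝ × ℝ) => (x.1, x.2.1))).measurable
  have hF : Measurable fun x : ℝ × (ℝ × ℝ) =>
      ENNReal.ofReal (cylKernel ((α + 1) / 2 - m) b (t - x.1) x.2) *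
        ENNReal.ofReal (Φ x.1 x.2.1 ^ (critExp m α - 1)) :=
    (measurable_cylKernel _ _ (by fun_prop)).ennreal_ofReal.mul (hm.pow_const _).ennreal_ofReal
  rw [h, lintegral_fold α τ hF]
  refine lintegral_congr fun x => ?_
  have e : cylKernel ((α + 1) / 2 - m) b (t - (2 * τ - x.1)) x.2 =
      cylKernel ((α + 1) / 2 - m) b (2 * τ - t - x.1) x.2 :=
    cylKernel_congr _ _ (by rw [← abs_neg]; congr 1; ring) _
  rw [e, ← ENNReal.ofReal_mul (cylKernel_nonneg _ _ _ _), ← ENNReal.ofReal_mul (cylKernel_nonneg _ _ _ _),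
    ← ENNReal.ofReal_add
      (mul_nonneg (cylKernel_nonneg _ _ _ _) (Real.rpow_nonneg (hΦ.nonneg _ _) _))
      (mul_nonneg (cylKernel_nonneg _ _ _ _) (Real.rpow_nonneg (hΦ.nonneg _ _) _))]

theorem ae_mem_half (α τ : ℝ) : ∀ᵐ x ∂((volume.restrict (Iio τ)).prod (sphereMeasure α)),
    x.1 < τ ∧ x.2 ∈ Ioo 0 Real.pi ×ˢ Ioo 0 Real.pi := by
  filter_upwards [Measure.quasiMeasurePreserving_fst.ae (ae_restrict_mem (measurableSet_Iio (a := τ))),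
    Measure.quasiMeasurePreserving_snd.ae (ae_sphereMeasure_mem α)] with x h1 h2 using ⟨h1, h2⟩

theorem abs_sub_lt_abs_reflect {τ t s : ℝ} (ht : t < τ) (hs : s < τ) : |t - s| < |2 * τ - t - s| := by
  rw [abs_of_pos (by linarith : 0 < 2 * τ - t - s), abs_lt]
  constructor <;> linarith

theorem rpow_sub_rpow_le {a b p : ℝ} (hb : 0 ≤ b) (hab : b ≤ a) (hp : 1 ≤ p) :
    a ^ p - b ^ p ≤ p * a ^ (p - 1) * (a - b) := by
  rcases (hb.trans hab).eq_or_lt with h | h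
  · obtain rfl : b = 0 := le_antisymm (by rwa [h]) hb
    rw [← h]; simp
  · have h1 := one_add_mul_self_le_rpow_one_add (s := (b - a) / a) (p := p)
      (by rw [le_div_iff₀ h]; linarith) hp
    rw [show 1 + (b - a) / a = b / a by field_simp; ring, Real.div_rpow hb h.le,
      le_div_iff₀ (Real.rpow_pos_of_pos h p)] at h1
    have h2 : a ^ p = a ^ (p - 1) * a := by
      rw [← Real.rpow_add_one h.ne']; congr 1; ring
    have h3 : (1 + p * ((b - a) / a)) * a ^ p = a ^ p - p * a ^ (p - 1) * (a - b) := by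
      rw [h2]; field_simp; ring
    linarith

/-- The function lies below its reflection on the left of `τ`. -/
def BelowReflection (Φ : ℝ → ℝ → ℝ) (τ : ℝ) : Prop :=
  ∀ t, t < τ → ∀ b ∈ Icc 0 Real.pi, Φ t b ≤ Φ (2 * τ - t) b

/-- The maximum principle in sets of small measure: to lie below the reflection it is enough to do so
outside a cylindrical set of small measure. Otherwise the integral equation would bound the supremum of
`e^{-γ t} (Φ(t) - Φ(2τ - t))` by half of itself. -/
theorem CylProfile.exists_small {m : ℕ} (hm : 1 ≤ m) {α : ℝ} (hα : α - 2 * (m : ℝ) + 1 > 0)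
    {Φ : ℝ → ℝ → ℝ} (hΦ : CylProfile m α Φ) : ∃ δ, 0 < δ ∧ ∀ (τ : ℝ) (I : Set ℝ), MeasurableSet I →
      ∫⁻ t in I, ENNReal.ofReal (Real.exp ((α + 1) * t)) ≤ ENNReal.ofReal δ →
      (∀ t, t < τ → t ∉ I → ∀ b ∈ Icc 0 Real.pi, Φ t b ≤ Φ (2 * τ - t) b) →
      BelowReflection Φ τ := by
  obtain ⟨c, hc, hfold⟩ := hΦ.exists_fold
  obtain ⟨M, hM0, hM⟩ := hΦ.bounded
  have hpγ := mul_critExp_sub_one hα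
  set γ := (α + 1) / 2 - m with hγ
  have hγ0 : 0 < γ := by rw [hγ]; linarith
  set p := critExp m α - 1 with hp
  have hm1 : (1 : ℝ) ≤ m := by exact_mod_cast hm
  have hp1 : 1 ≤ p := by
    refine le_of_mul_le_mul_left ?_ hγ0
    rw [hpγ, mul_one, hγ]; linarith
  set D := p * M ^ (p - 1) with hD
  have hD0 : 0 ≤ D := mul_nonneg (by linarith) (Real.rpow_nonneg hM0 _)
  obtain ⟨δ, hδ, hsmall⟩ := exists_lintegral_cylKernel_le hm hα
    (ε := c / (2 * (D + 1))) (by positivity)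
  refine ⟨δ, hδ, fun τ I hI hIδ hout => ?_⟩
  -- a bound for the excess over the reflection can be halved
  have hstep : ∀ S : ℝ, 0 ≤ S →
      (∀ t, t < τ → ∀ b ∈ Icc 0 Real.pi, Φ t b - Φ (2 * τ - t) b ≤ S * Real.exp (γ * t)) →
      ∀ t, t < τ → ∀ b ∈ Icc 0 Real.pi, Φ t b - Φ (2 * τ - t) b ≤ S / 2 * Real.exp (γ * t) := by
    intro S hS hb t ht b hbI
    set H := (volume.restrict (Iio τ)).prod (sphereMeasure α) with hH
    set k : ℝ × (ℝ × ℝ) → ℝ := fun x => cylKernel γ b (t - x.1) x.2 with hk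
    set k' : ℝ × (ℝ × ℝ) → ℝ := fun x => cylKernel γ b (2 * τ - t - x.1) x.2 with hk'
    set A : ℝ × (ℝ × ℝ) → ℝ := fun x => Φ x.1 x.2.1 ^ p with hA
    set B : ℝ × (ℝ × ℝ) → ℝ := fun x => Φ (2 * τ - x.1) x.2.1 ^ p with hB
    have hk0 : ∀ x, 0 ≤ k x := fun x => cylKernel_nonneg _ _ _ _
    have hk'0 : ∀ x, 0 ≤ k' x := fun x => cylKernel_nonneg _ _ _ _
    have hA0 : ∀ x, 0 ≤ A x := fun x => Real.rpow_nonneg (hΦ.nonneg _ _) _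
    have hB0 : ∀ x, 0 ≤ B x := fun x => Real.rpow_nonneg (hΦ.nonneg _ _) _
    have h1 : ENNReal.ofReal (c * Φ t b) = ∫⁻ x, ENNReal.ofReal (k x * A x + k' x * B x) ∂H :=
      hfold τ t b
    have h2 : ENNReal.ofReal (c * Φ (2 * τ - t) b) =
        ∫⁻ x, ENNReal.ofReal (k' x * A x + k x * B x) ∂H := by
      have := hfold τ (2 * τ - t) b
      rwa [sub_sub_cancel] at this
    have hcA : Continuous fun x : ℝ × (ℝ × ℝ) => Φ x.1 x.2.1 :=
      hΦ.continuous.comp (by fun_prop : Continuous fun x : ℝ × (ℝ × ℝ) => (x.1, x.2.1))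
    have hcB : Continuous fun x : ℝ × (ℝ × ℝ) => Φ (2 * τ - x.1) x.2.1 :=
      hΦ.continuous.comp (by fun_prop : Continuous fun x : ℝ × (ℝ × ℝ) => (2 * τ - x.1, x.2.1))
    have hmeas : Measurable fun x => ENNReal.ofReal (k' x * A x + k x * B x) :=
      (((measurable_cylKernel _ _ (by fun_prop)).mul (hcA.measurable.pow_const _)).add
        ((measurable_cylKernel _ _ (by fun_prop)).mul (hcB.measurable.pow_const _))).ennreal_ofReal
    -- rearrangement inequality where `A ≤ B`; elsewhere the excess `k (A - B)` is added
    have h3 : ∫⁻ x, ENNReal.ofReal (k x * A x + k' x * B x) ∂H ≤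
        ∫⁻ x, ENNReal.ofReal (k' x * A x + k x * B x) ∂H +
          ∫⁻ x, ENNReal.ofReal (k x * max (A x - B x) 0) ∂H := by
      rw [← lintegral_add_left hmeas]
      refine lintegral_mono_ae ?_
      filter_upwards [ae_mem_half α τ] with x hx
      have hkk : k' x ≤ k x := (cylKernel_lt hγ0 b (abs_sub_lt_abs_reflect ht hx.1) hx.2).le
      rw [← ENNReal.ofReal_add (add_nonneg (mul_nonneg (hk'0 x) (hA0 x)) (mul_nonneg (hk0 x) (hB0 x)))
        (mul_nonneg (hk0 x) (le_max_right _ _))]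
      refine ENNReal.ofReal_le_ofReal ?_
      rcases le_total (A x) (B x) with h | h
      · rw [max_eq_right (by linarith)]
        nlinarith
      · rw [max_eq_left (by linarith)]
        nlinarith [mul_nonneg (hk'0 x) (sub_nonneg.2 h)]
    have h4 : ∫⁻ x, ENNReal.ofReal (k x * max (A x - B x) 0) ∂H ≤
        ENNReal.ofReal (D * S * Real.exp (γ * t)) * ENNReal.ofReal (c / (2 * (D + 1))) := by
      have hle : ∀ᵐ x ∂H, ENNReal.ofReal (k x * max (A x - B x) 0) ≤
          (I ×ˢ univ).indicator (fun x : ℝ × (ℝ × ℝ) => ENNReal.ofReal (D * S * Real.exp (γ * t)) *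
            (ENNReal.ofReal (Real.exp ((α + 1) * x.1)) *
              ENNReal.ofReal (distSq (expPlane t b) (expPoint x) ^ (-γ)))) x := by
        filter_upwards [ae_mem_half α τ] with x hx
        have hxI : x.2.1 ∈ Icc 0 Real.pi := Ioo_subset_Icc_self hx.2.1
        by_cases hxm : x.1 ∈ I
        · rw [indicator_of_mem (show x ∈ I ×ˢ univ from ⟨hxm, mem_univ _⟩),
            ← ENNReal.ofReal_mul (Real.exp_pos _).le, ← ENNReal.ofReal_mul (by positivity)]
          refine ENNReal.ofReal_le_ofReal ?_
          have hmax : max (A x - B x) 0 ≤ D * S * Real.exp (γ * x.1 * p) := by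
            refine max_le ?_ (by positivity)
            rcases le_total (Φ x.1 x.2.1) (Φ (2 * τ - x.1) x.2.1) with h | h
            · have : A x ≤ B x := Real.rpow_le_rpow (hΦ.nonneg _ _) h (by linarith)
              have : 0 ≤ D * S * Real.exp (γ * x.1 * p) := by positivity
              linarith
            · have e1 := rpow_sub_rpow_le (hΦ.nonneg (2 * τ - x.1) x.2.1) h hp1
              have e2 := Real.rpow_le_rpow (hΦ.nonneg _ _) (hM x.1 x.2.1) (by linarith : 0 ≤ p - 1)
              rw [Real.mul_rpow hM0 (Real.exp_pos _).le, ← Real.exp_mul] at e2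
              have e3 := hb x.1 hx.1 x.2.1 hxI
              calc A x - B x ≤ p * Φ x.1 x.2.1 ^ (p - 1) * (Φ x.1 x.2.1 - Φ (2 * τ - x.1) x.2.1) := e1
                _ ≤ p * (M ^ (p - 1) * Real.exp (γ * x.1 * (p - 1))) * (S * Real.exp (γ * x.1)) :=
                  mul_le_mul (mul_le_mul_of_nonneg_left e2 (by linarith)) e3 (by linarith)
                    (by have := Real.rpow_nonneg hM0 (p - 1); positivity)
                _ = D * S * Real.exp (γ * x.1 * p) := by
                  rw [show γ * x.1 * p = γ * x.1 * (p - 1) + γ * x.1 by ring, Real.exp_add, hD]; ring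
          refine (mul_le_mul_of_nonneg_left hmax (hk0 x)).trans (le_of_eq ?_)
          rw [distSq_expPlane_rpow]
          have e4 : γ * x.1 * p = (α + 1) * x.1 + -γ * x.1 := by
            rw [mul_right_comm, hpγ, hγ]; ring
          have e5 : Real.exp (γ * t) * Real.exp (-γ * t) = 1 := by
            rw [← Real.exp_add, ← Real.exp_zero]; congr 1; ring
          rw [e4, Real.exp_add]
          linear_combination (-k x * D * S * Real.exp ((α + 1) * x.1) * Real.exp (-γ * x.1)) * e5
        · rw [indicator_of_notMem (fun h => hxm h.1)]
          have : A x ≤ B x := Real.rpow_le_rpow (hΦ.nonneg _ _) (hout _ hx.1 hxm _ hxI) (by linarith)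
          rw [max_eq_right (by linarith), mul_zero, ENNReal.ofReal_zero]
      refine (lintegral_mono_ae hle).trans ?_
      rw [hH, restrict_prod_eq]
      refine (lintegral_mono' Measure.restrict_le_self le_rfl).trans ?_
      rw [lintegral_indicator (hI.prod MeasurableSet.univ), ← restrict_prod_eq,
        lintegral_const_mul' _ _ ENNReal.ofReal_ne_top]
      exact mul_le_mul_right (hsmall I hIδ t b) _
    rw [← h1, ← h2] at h3
    have h5 := h3.trans (add_le_add_right h4 _)
    rw [← ENNReal.ofReal_mul (by positivity), ← ENNReal.ofReal_add (mul_nonneg hc.le (hΦ.nonneg _ _))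
      (by positivity), ENNReal.ofReal_le_ofReal_iff
      (add_nonneg (mul_nonneg hc.le (hΦ.nonneg _ _)) (by positivity))] at h5
    have h6 : D * S * Real.exp (γ * t) * (c / (2 * (D + 1))) ≤ c * (S / 2 * Real.exp (γ * t)) := by
      have h7 : D / (D + 1) ≤ 1 := (div_le_one (by positivity)).2 (by linarith)
      calc _ = c * (S / 2 * Real.exp (γ * t)) * (D / (D + 1)) := by field_simp
        _ ≤ _ := mul_le_of_le_one_right (by positivity) h7
    have h8 : c * (Φ t b - Φ (2 * τ - t) b) ≤ c * (S / 2 * Real.exp (γ * t)) := by linarith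
    exact le_of_mul_le_mul_left h8 hc
  have hiter : ∀ n : ℕ, ∀ t, t < τ → ∀ b ∈ Icc 0 Real.pi,
      Φ t b - Φ (2 * τ - t) b ≤ M * (1 / 2) ^ n * Real.exp (γ * t) := by
    intro n
    induction n with
    | zero =>
      intro t _ b _
      have := hM t b
      have := hΦ.nonneg (2 * τ - t) b
      rw [pow_zero, mul_one]
      linarith
    | succ n ih =>
      intro t ht b hb
      have := hstep _ (by positivity) ih t ht b hb
      rwa [show M * (1 / 2) ^ n / 2 = M * (1 / 2) ^ (n + 1) by ring] at this
  intro t ht b hb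
  have hlim : Tendsto (fun n : ℕ => M * (1 / 2 : ℝ) ^ n * Real.exp (γ * t)) atTop (𝓝 0) := by
    have := ((tendsto_pow_atTop_nhds_zero_of_lt_one (by norm_num : (0 : ℝ) ≤ 1 / 2)
      (by norm_num)).const_mul M).mul_const (Real.exp (γ * t))
    simpa using this
  have := ge_of_tendsto' hlim fun n => hiter n t ht b hb
  linarith

theorem ae_Ioo_of_ae_sphereMeasure {α : ℝ} {Q : ℝ → Prop} (h : ∀ᵐ y ∂(sphereMeasure α), Q y.1) :
    ∀ᵐ b ∂(volume.restrict (Ioo 0 Real.pi)), Q b := by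
  have h1 := Measure.ae_ae_of_ae_prod h
  have hne : ((volume.restrict (Ioo 0 Real.pi)).withDensity
      fun b => ENNReal.ofReal (Real.sin b ^ (α - 2))) ≠ 0 := by
    intro h0
    refine lintegral_sin_rpow_ne_zero (α - 2) ?_
    have := congrArg (fun ν => ν univ) h0
    simpa [withDensity_apply _ MeasurableSet.univ] using this
  have : (ae ((volume.restrict (Ioo 0 Real.pi)).withDensity
      fun b => ENNReal.ofReal (Real.sin b ^ (α - 2)))).NeBot := ae_neBot.2 hne
  rw [ae_withDensity_iff (measurable_ofReal_sin_rpow _)] at h1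
  filter_upwards [h1, ae_restrict_mem measurableSet_Ioo] with b hb hb'
  have h2 := hb (by simpa using Real.rpow_pos_of_pos (Real.sin_pos_of_mem_Ioo hb') _)
  exact h2.exists.choose_spec

/-- The strong maximum principle: a function below its reflection which touches it coincides with it. -/
theorem CylProfile.eq_reflection {m : ℕ} {α : ℝ} (hα : α - 2 * (m : ℝ) + 1 > 0)
    {Φ : ℝ → ℝ → ℝ} (hΦ : CylProfile m α Φ) {τ : ℝ} (hτ : BelowReflection Φ τ) {t₀ b₀ : ℝ}
    (ht₀ : t₀ < τ) (heq : Φ t₀ b₀ = Φ (2 * τ - t₀) b₀) :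
    ∀ t, t < τ → ∀ b ∈ Icc 0 Real.pi, Φ t b = Φ (2 * τ - t) b := by
  obtain ⟨c, hc, hfold⟩ := hΦ.exists_fold
  have hpγ := mul_critExp_sub_one hα
  set γ := (α + 1) / 2 - m with hγ
  have hγ0 : 0 < γ := by rw [hγ]; linarith
  set p := critExp m α - 1 with hp
  have hp0 : 0 < p := by
    have h : 0 < γ * p := by rw [hpγ]; linarith [(Nat.cast_nonneg m : (0 : ℝ) ≤ m)]
    exact pos_of_mul_pos_right h hγ0.le
  have hcA : Continuous fun x : ℝ × (ℝ × ℝ) => Φ x.1 x.2.1 :=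
    hΦ.continuous.comp (by fun_prop : Continuous fun x : ℝ × (ℝ × ℝ) => (x.1, x.2.1))
  have hcB : Continuous fun x : ℝ × (ℝ × ℝ) => Φ (2 * τ - x.1) x.2.1 :=
    hΦ.continuous.comp (by fun_prop : Continuous fun x : ℝ × (ℝ × ℝ) => (2 * τ - x.1, x.2.1))
  set H := (volume.restrict (Iio τ)).prod (sphereMeasure α) with hH
  set k : ℝ × (ℝ × ℝ) → ℝ := fun x => cylKernel γ b₀ (t₀ - x.1) x.2 with hk
  set k' : ℝ × (ℝ × ℝ) → ℝ := fun x => cylKernel γ b₀ (2 * τ - t₀ - x.1) x.2 with hk'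
  set A : ℝ × (ℝ × ℝ) → ℝ := fun x => Φ x.1 x.2.1 ^ p with hA
  set B : ℝ × (ℝ × ℝ) → ℝ := fun x => Φ (2 * τ - x.1) x.2.1 ^ p with hB
  have hk'0 : ∀ x, 0 ≤ k' x := fun x => cylKernel_nonneg _ _ _ _
  have hA0 : ∀ x, 0 ≤ A x := fun x => Real.rpow_nonneg (hΦ.nonneg _ _) _
  have hB0 : ∀ x, 0 ≤ B x := fun x => Real.rpow_nonneg (hΦ.nonneg _ _) _
  have h1 : ENNReal.ofReal (c * Φ t₀ b₀) = ∫⁻ x, ENNReal.ofReal (k x * A x + k' x * B x) ∂H :=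
    hfold τ t₀ b₀
  have h2 : ENNReal.ofReal (c * Φ (2 * τ - t₀) b₀) =
      ∫⁻ x, ENNReal.ofReal (k' x * A x + k x * B x) ∂H := by
    have := hfold τ (2 * τ - t₀) b₀
    rwa [sub_sub_cancel] at this
  have hmeas : Measurable fun x => ENNReal.ofReal (k' x * A x + k x * B x) :=
    (((measurable_cylKernel _ _ (by fun_prop)).mul (hcA.measurable.pow_const _)).add
      ((measurable_cylKernel _ _ (by fun_prop)).mul (hcB.measurable.pow_const _))).ennreal_ofReal
  have hgood : ∀ᵐ x ∂H, k' x < k x ∧ Φ x.1 x.2.1 ≤ Φ (2 * τ - x.1) x.2.1 := by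
    filter_upwards [ae_mem_half α τ] with x hx
    exact ⟨cylKernel_lt hγ0 b₀ (abs_sub_lt_abs_reflect ht₀ hx.1) hx.2,
      hτ _ hx.1 _ (Ioo_subset_Icc_self hx.2.1)⟩
  have hae : (fun x => ENNReal.ofReal (k x * A x + k' x * B x)) =ᵐ[H]
      fun x => ENNReal.ofReal (k' x * A x + k x * B x) := by
    refine ae_eq_of_ae_le_of_lintegral_le ?_ (by rw [← h1]; exact ENNReal.ofReal_ne_top)
      hmeas.aemeasurable (by rw [← h1, ← h2, heq])
    filter_upwards [hgood] with x hx
    have hAB : A x ≤ B x := Real.rpow_le_rpow (hΦ.nonneg _ _) hx.2 hp0.le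
    refine ENNReal.ofReal_le_ofReal ?_
    nlinarith [hx.1]
  have haeq : ∀ᵐ x ∂H, Φ x.1 x.2.1 = Φ (2 * τ - x.1) x.2.1 := by
    filter_upwards [hgood, hae] with x hx he
    have hk0 : 0 ≤ k x := (hk'0 x).trans hx.1.le
    rw [ENNReal.ofReal_eq_ofReal_iff
      (add_nonneg (mul_nonneg hk0 (hA0 x)) (mul_nonneg (hk'0 x) (hB0 x)))
      (add_nonneg (mul_nonneg (hk'0 x) (hA0 x)) (mul_nonneg hk0 (hB0 x)))] at he
    have h3 : (k x - k' x) * (A x - B x) = 0 := by linarith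
    have h4 : A x = B x := by
      rcases mul_eq_zero.1 h3 with h | h
      · exact absurd h (by linarith [hx.1])
      · linarith
    exact (Real.rpow_left_inj (hΦ.nonneg _ _) (hΦ.nonneg _ _) hp0.ne').1 h4
  have hcont : ∀ t, Continuous (Φ t) := fun t =>
    hΦ.continuous.comp (by fun_prop : Continuous fun b : ℝ => (t, b))
  have hae1 : ∀ᵐ t ∂(volume.restrict (Iio τ)), EqOn (Φ t) (Φ (2 * τ - t)) (Icc 0 Real.pi) := by
    filter_upwards [Measure.ae_ae_of_ae_prod haeq] with t ht
    have h5 := Measure.eqOn_open_of_ae_eq (ae_Ioo_of_ae_sphereMeasure ht) isOpen_Ioo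
      (hcont t).continuousOn (hcont (2 * τ - t)).continuousOn
    have h6 := h5.closure (hcont t) (hcont (2 * τ - t))
    rwa [closure_Ioo Real.pi_pos.ne] at h6
  intro t ht b hb
  have hc1 : Continuous fun s => Φ s b :=
    hΦ.continuous.comp (by fun_prop : Continuous fun s : ℝ => (s, b))
  have hc2 : Continuous fun s => Φ (2 * τ - s) b :=
    hΦ.continuous.comp (by fun_prop : Continuous fun s : ℝ => (2 * τ - s, b))
  have hae2 : (fun s => Φ s b) =ᵐ[volume.restrict (Iio τ)] fun s => Φ (2 * τ - s) b := by
    filter_upwards [hae1] with s hs using hs hb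
  exact Measure.eqOn_open_of_ae_eq hae2 isOpen_Iio hc1.continuousOn hc2.continuousOn ht

theorem lintegral_exp_Iio {a : ℝ} (ha : 0 < a) (k : ℝ) :
    ∫⁻ t in Iio k, ENNReal.ofReal (Real.exp (a * t)) = ENNReal.ofReal (Real.exp (a * k) / a) := by
  rw [setLIntegral_congr Iio_ae_eq_Iic, ← ofReal_integral_eq_lintegral_ofReal
    (integrableOn_exp_mul_Iic ha k) (Eventually.of_forall fun t => (Real.exp_pos _).le),
    integral_exp_mul_Iic ha]

/-- The method of moving planes on the cylinder. -/
theorem CylProfile.exists_symmetric {m : ℕ} (hm : 1 ≤ m) {α : ℝ} (hα : α - 2 * (m : ℝ) + 1 > 0)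
    {Φ : ℝ → ℝ → ℝ} (hΦ : CylProfile m α Φ) :
    ∃ τ, ∀ t, ∀ b ∈ Icc 0 Real.pi, Φ (2 * τ - t) b = Φ t b := by
  have hm1 : (1 : ℝ) ≤ m := by exact_mod_cast hm
  have hα1 : 0 < α + 1 := by linarith
  obtain ⟨δ, hδ, hsmall⟩ := hΦ.exists_small hm hα
  have hlim : ∀ η : ℝ, 0 < η → ∃ k : ℝ, ∀ k' ≤ k,
      ∫⁻ t in Iio k', ENNReal.ofReal (Real.exp ((α + 1) * t)) ≤ ENNReal.ofReal η := by
    intro η hη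
    have h1 : Tendsto (fun k : ℝ => Real.exp ((α + 1) * k) / (α + 1)) atBot (𝓝 0) := by
      simpa using (Real.tendsto_exp_atBot.comp (tendsto_id.const_mul_atBot hα1)).div_const (α + 1)
    obtain ⟨k, hk⟩ := eventually_atBot.1 (h1.eventually_le_const hη)
    exact ⟨k, fun k' hk' => by
      rw [lintegral_exp_Iio hα1]; exact ENNReal.ofReal_le_ofReal (hk k' hk')⟩
  set Λ : Set ℝ := {τ | ∀ τ' ≤ τ, BelowReflection Φ τ'} with hΛ
  have hne : Λ.Nonempty := by
    obtain ⟨k, hk⟩ := hlim δ hδ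
    exact ⟨k, fun τ' hτ' => hsmall τ' (Iio τ') measurableSet_Iio (hk τ' hτ')
      fun t ht hnt => absurd ht hnt⟩
  have hbdd : BddAbove Λ := by
    obtain ⟨T, hT⟩ := eventually_atTop.1 (hΦ.tendsto.eventually_lt_const hΦ.pos)
    refine ⟨max T 1, fun τ hτ => not_lt.1 fun h => ?_⟩
    have h1 := hτ τ le_rfl 0 (by linarith [le_max_right T 1]) 0 ⟨le_rfl, Real.pi_pos.le⟩
    have h2 := hT (2 * τ - 0) (by linarith [le_max_left T 1, le_max_right T 1])
    linarith
  set τ := sSup Λ with hτ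
  have hlt : ∀ τ' < τ, BelowReflection Φ τ' := fun τ' h => by
    obtain ⟨σ, hσ, hσ'⟩ := exists_lt_of_lt_csSup hne h
    exact hσ τ' hσ'.le
  have hbelow : BelowReflection Φ τ := by
    intro t ht b hb
    have hc : Continuous fun s => Φ (2 * s - t) b :=
      hΦ.continuous.comp (by fun_prop : Continuous fun s : ℝ => (2 * s - t, b))
    refine ge_of_tendsto ((hc.tendsto τ).mono_left (nhdsWithin_le_nhds (s := Iio τ))) ?_
    filter_upwards [Ioo_mem_nhdsLT ht] with s hs using hlt s hs.2 t hs.1 b hb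
  -- otherwise strict inequality on a compact set, and `exists_small` on its complement, would
  -- allow to move the section further
  have htouch : ∃ t, t < τ ∧ ∃ b ∈ Icc 0 Real.pi, Φ t b = Φ (2 * τ - t) b := by
    by_contra! hno
    have hstrict : ∀ t, t < τ → ∀ b ∈ Icc 0 Real.pi, Φ t b < Φ (2 * τ - t) b :=
      fun t ht b hb => lt_of_le_of_ne (hbelow t ht b hb) (hno t ht b hb)
    obtain ⟨a, ha⟩ := hlim (δ / 2) (half_pos hδ)
    -- a thin shell around the critical section
    set E := Real.exp ((α + 1) * (τ + 1)) with hE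
    set η := min 1 (δ / (4 * E)) with hη
    have hE0 : 0 < E := Real.exp_pos _
    have hη0 : 0 < η := lt_min one_pos (by positivity)
    have hshell : ∫⁻ t in Ioo (τ - η) (τ + η), ENNReal.ofReal (Real.exp ((α + 1) * t)) ≤
        ENNReal.ofReal (δ / 2) := by
      calc _ ≤ ∫⁻ t in Ioo (τ - η) (τ + η), ENNReal.ofReal E := by
            refine setLIntegral_mono' measurableSet_Ioo fun t ht => ?_
            refine ENNReal.ofReal_le_ofReal (Real.exp_le_exp.2 ?_)
            have := min_le_left 1 (δ / (4 * E))
            exact mul_le_mul_of_nonneg_left (by linarith [ht.2]) hα1.le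
        _ = ENNReal.ofReal (E * (2 * η)) := by
            rw [setLIntegral_const, Real.volume_Ioo, ← ENNReal.ofReal_mul hE0.le]
            congr 1; ring
        _ ≤ ENNReal.ofReal (δ / 2) := by
            refine ENNReal.ofReal_le_ofReal ?_
            have h1 := min_le_right 1 (δ / (4 * E))
            rw [← hη, le_div_iff₀ (by positivity)] at h1
            linarith
    have hcpt : ∀ᶠ s in 𝓝 τ, ∀ z ∈ Icc a (τ - η) ×ˢ Icc 0 Real.pi,
        Φ z.1 z.2 < Φ (2 * s - z.1) z.2 := by
      refine (isCompact_Icc.prod isCompact_Icc).eventually_forall_of_forall_eventually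
        fun z hz => ?_
      have hc1 : Continuous fun w : ℝ × (ℝ × ℝ) => Φ w.2.1 w.2.2 :=
        hΦ.continuous.comp (by fun_prop : Continuous fun w : ℝ × (ℝ × ℝ) => (w.2.1, w.2.2))
      have hc2 : Continuous fun w : ℝ × (ℝ × ℝ) => Φ (2 * w.1 - w.2.1) w.2.2 :=
        hΦ.continuous.comp
          (by fun_prop : Continuous fun w : ℝ × (ℝ × ℝ) => (2 * w.1 - w.2.1, w.2.2))
      exact hc1.continuousAt.eventually_lt hc2.continuousAt
        (hstrict z.1 (by linarith [hz.1.2]) z.2 hz.2)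
    obtain ⟨ζ, hζ, hball⟩ := Metric.eventually_nhds_iff.1 hcpt
    have hmem : τ + min ζ η / 2 ∈ Λ := by
      intro τ' hτ'
      rcases lt_or_ge τ' τ with h | h
      · exact hlt τ' h
      · have hmin : 0 < min ζ η := lt_min hζ hη0
        have h1 : τ' < τ + ζ := by linarith [min_le_left ζ η]
        have h2 : τ' < τ + η := by linarith [min_le_right ζ η]
        refine hsmall τ' (Iio a ∪ Ioo (τ - η) (τ + η)) (measurableSet_Iio.union measurableSet_Ioo)
          ?_ fun t ht hnt b hb => ?_
        · refine (lintegral_union_le _ _ _).trans ((add_le_add (ha a le_rfl) hshell).trans ?_)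
          rw [← ENNReal.ofReal_add (half_pos hδ).le (half_pos hδ).le, add_halves]
        · have h3 : a ≤ t := not_lt.1 fun h => hnt (Or.inl h)
          have h4 : t ≤ τ - η := not_lt.1 fun h => hnt (Or.inr ⟨h, by linarith⟩)
          refine (hball (y := τ') ?_ (t, b) ⟨⟨h3, h4⟩, hb⟩).le
          rw [Real.dist_eq, abs_of_nonneg (by linarith)]
          linarith
    have := le_csSup hbdd hmem
    have hmin : 0 < min ζ η := lt_min hζ hη0
    linarith
  obtain ⟨t₀, ht₀, b₀, -, heq⟩ := htouch
  have hsym := hΦ.eq_reflection hα hbelow ht₀ heq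
  refine ⟨τ, fun t b hb => ?_⟩
  rcases lt_trichotomy t τ with h | h | h
  · exact (hsym t h b hb).symm
  · rw [h]; congr 1; ring
  · have := hsym (2 * τ - t) (by linarith) b hb
    rwa [sub_sub_cancel] at this

/-! ### Identification of the solution -/

/-- `r^γ u(r)` attains its maximum, since it tends to `0` at `0` and at infinity. -/
theorem RadialProfile.exists_max {m : ℕ} {α : ℝ} {u : ℝ → ℝ} (hu : RadialProfile m α u)
    (hα : α - 2 * (m : ℝ) + 1 > 0) : ∃ r₀ : ℝ, 0 < r₀ ∧ ∀ r, 0 < r →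
      r ^ ((α + 1) / 2 - (m : ℝ)) * u r ≤ r₀ ^ ((α + 1) / 2 - (m : ℝ)) * u r₀ := by
  set γ := (α + 1) / 2 - (m : ℝ) with hγ
  have hγ0 : 0 < γ := by rw [hγ]; linarith
  have h1 := hu.pos 1 one_pos
  obtain ⟨R, hR1, hR⟩ := hu.decay (u 1) h1
  have hc : Continuous fun r => r ^ γ * u r :=
    (continuous_id.rpow_const fun _ => Or.inr hγ0.le).mul hu.continuous
  obtain ⟨r₀, hr₀, hmax⟩ := isCompact_Icc.exists_isMaxOn (nonempty_Icc.2 (by linarith : (0 : ℝ) ≤ R))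
    hc.continuousOn
  have hge : u 1 ≤ r₀ ^ γ * u r₀ := by
    have : (1 : ℝ) ^ γ * u 1 ≤ r₀ ^ γ * u r₀ := hmax ⟨zero_le_one, hR1⟩
    simpa using this
  have hne : r₀ ≠ 0 := by
    rintro rfl
    rw [Real.zero_rpow hγ0.ne', zero_mul] at hge
    linarith
  refine ⟨r₀, lt_of_le_of_ne hr₀.1 hne.symm, fun r hr => ?_⟩
  rcases le_total r R with h | h
  · exact hmax ⟨hr.le, h⟩
  · refine le_trans ?_ hge
    calc r ^ γ * u r ≤ r ^ γ * (u 1 * r ^ (-γ)) :=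
          mul_le_mul_of_nonneg_left (hR r h) (Real.rpow_nonneg hr.le _)
      _ = u 1 * (r ^ γ * r ^ (-γ)) := by ring
      _ = u 1 := by rw [← Real.rpow_add hr, add_neg_cancel, Real.rpow_zero, mul_one]

/-- The sphere centered at `x₀` across which the solution is symmetric has radius `√(x₀² + r₀²)`: it
passes through the points of norm `r₀` orthogonal to `x₀`, since the image of such a point would otherwise
give a larger value of `r^γ u(r)`. -/
theorem RadialProfile.exists_inversion {m : ℕ} (hm : 1 ≤ m) {α : ℝ} {u : ℝ → ℝ}
    (hu : RadialProfile m α u) (hα : α - 2 * (m : ℝ) + 1 > 0) {r₀ : ℝ} (hr₀ : 0 < r₀)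
    (hmax : ∀ r, 0 < r →
      r ^ ((α + 1) / 2 - (m : ℝ)) * u r ≤ r₀ ^ ((α + 1) / 2 - (m : ℝ)) * u r₀) {x₀ : ℝ} (hx₀ : 0 < x₀)
    {s : ℝ} (hs : 0 < s) :
    s ^ (2 * ((α + 1) / 2 - (m : ℝ))) * u (x₀ + s) =
      (x₀ ^ 2 + r₀ ^ 2) ^ ((α + 1) / 2 - (m : ℝ)) * u (x₀ + (x₀ ^ 2 + r₀ ^ 2) / s) := by
  obtain ⟨τ, hτ⟩ := (hu.cylProfile hm hα hx₀).exists_symmetric hm hα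
  set γ := (α + 1) / 2 - (m : ℝ) with hγ
  have hγ0 : 0 < γ := by rw [hγ]; linarith
  set R := √(x₀ ^ 2 + r₀ ^ 2) with hR
  have hR2 : R ^ 2 = x₀ ^ 2 + r₀ ^ 2 := Real.sq_sqrt (by positivity)
  have hR0 : 0 < R := Real.sqrt_pos.2 (by positivity)
  set b := Real.arccos (-(x₀ / R)) with hb
  have hxR : x₀ / R ≤ 1 := (div_le_one hR0).2 (Real.le_sqrt_of_sq_le (by nlinarith))
  have hxR0 : 0 < x₀ / R := by positivity
  have hcos : Real.cos b = -(x₀ / R) := Real.cos_arccos (by linarith) (by linarith)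
  have hsin : Real.sin b = r₀ / R := by
    rw [hb, Real.sin_arccos, neg_sq, show 1 - (x₀ / R) ^ 2 = (r₀ / R) ^ 2 by
      field_simp; linarith, Real.sqrt_sq (by positivity)]
  have hrad : ∀ t, cylRadius x₀ t b =
      √((x₀ - Real.exp t * x₀ / R) ^ 2 + (Real.exp t * r₀ / R) ^ 2) := fun t => by
    rw [cylRadius, hcos, hsin]; congr 2
    · ring
    · ring
  have h1 := hτ (Real.log R) b ⟨Real.arccos_nonneg _, Real.arccos_le_pi _⟩
  simp only [hrad] at h1
  rw [Real.exp_log hR0, mul_div_cancel_left₀ _ hR0.ne', mul_div_cancel_left₀ _ hR0.ne', sub_self,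
    zero_pow two_ne_zero, zero_add, Real.sqrt_sq hr₀.le] at h1
  set R' := Real.exp (2 * τ - Real.log R) with hR'
  have hR'0 : 0 < R' := Real.exp_pos _
  set ρ := √((x₀ - R' * x₀ / R) ^ 2 + (R' * r₀ / R) ^ 2) with hρ
  have hρ2 : ρ ^ 2 = (x₀ - R' * x₀ / R) ^ 2 + (R' * r₀ / R) ^ 2 := Real.sq_sqrt (by positivity)
  have hρ0 : 0 < ρ := Real.sqrt_pos.2 (by positivity)
  have e1 : Real.exp (γ * (2 * τ - Real.log R)) = R' ^ γ := by rw [hR', ← Real.exp_mul, mul_comm]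
  have e2 : Real.exp (γ * Real.log R) = R ^ γ := by rw [Real.rpow_def_of_pos hR0, mul_comm]
  rw [e1, e2] at h1
  have h2 : (R * ρ) ^ γ ≤ (R' * r₀) ^ γ := by
    rw [Real.mul_rpow hR0.le hρ0.le, Real.mul_rpow hR'0.le hr₀.le]
    refine le_of_mul_le_mul_right ?_ (hu.pos r₀ hr₀)
    calc R ^ γ * ρ ^ γ * u r₀ = R' ^ γ * (ρ ^ γ * u ρ) := by linear_combination (-ρ ^ γ) * h1
      _ ≤ R' ^ γ * (r₀ ^ γ * u r₀) :=
        mul_le_mul_of_nonneg_left (hmax ρ hρ0) (Real.rpow_nonneg hR'0.le _)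
      _ = R' ^ γ * r₀ ^ γ * u r₀ := by ring
  have h3 : R * ρ ≤ R' * r₀ := (Real.rpow_le_rpow_iff (by positivity) (by positivity) hγ0).1 h2
  have h4 : (R * ρ) ^ 2 = x₀ ^ 2 * (R - R') ^ 2 + (R' * r₀) ^ 2 := by
    rw [mul_pow, hρ2]; field_simp
  have h5 : R' = R := by
    have h6 : (R * ρ) ^ 2 ≤ (R' * r₀) ^ 2 := pow_le_pow_left₀ (by positivity) h3 2
    have h7 : x₀ ^ 2 * (R - R') ^ 2 ≤ 0 := by linarith
    have h8 : (R - R') ^ 2 ≤ 0 := by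
      by_contra h
      exact absurd h7 (not_le.2 (mul_pos (pow_pos hx₀ 2) (not_le.1 h)))
    have : R - R' = 0 := pow_eq_zero_iff two_ne_zero |>.1 (le_antisymm h8 (sq_nonneg _))
    linarith
  have h6 : Real.exp (2 * τ) = x₀ ^ 2 + r₀ ^ 2 := by
    rw [← hR2, pow_two]
    nth_rewrite 1 [← h5]
    rw [hR', Real.exp_sub, Real.exp_log hR0]; field_simp
  have hr0 : ∀ t, cylRadius x₀ t 0 = x₀ + Real.exp t := fun t => by
    rw [cylRadius, Real.cos_zero, Real.sin_zero, mul_one, mul_zero, zero_pow two_ne_zero, add_zero,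
      Real.sqrt_sq (by positivity)]
  have h7 := hτ (Real.log s) 0 ⟨le_rfl, Real.pi_pos.le⟩
  simp only [hr0] at h7
  rw [Real.exp_sub, h6, Real.exp_log hs, mul_sub, Real.exp_sub,
    show γ * (2 * τ) = 2 * τ * γ by ring, Real.exp_mul, h6, mul_comm γ (Real.log s), Real.exp_mul,
    Real.exp_log hs] at h7
  have hsγ : s ^ γ ≠ 0 := (Real.rpow_pos_of_pos hs _).ne'
  rw [two_mul, Real.rpow_add hs, mul_assoc, ← h7]
  field_simp

/-- The solution is a multiple of `(r² + r₀²)^{-γ}`. -/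
theorem RadialProfile.eq_rpow {m : ℕ} (hm : 1 ≤ m) {α : ℝ} {u : ℝ → ℝ}
    (hu : RadialProfile m α u) (hα : α - 2 * (m : ℝ) + 1 > 0) : ∃ r₀ κ : ℝ, 0 < r₀ ∧ 0 < κ ∧
      ∀ r, 0 < r → u r = κ * (r ^ 2 + r₀ ^ 2) ^ (-((α + 1) / 2 - (m : ℝ))) := by
  obtain ⟨r₀, hr₀, hmax⟩ := hu.exists_max hα
  set γ := (α + 1) / 2 - (m : ℝ) with hγ
  -- the inversion centered at `x` exchanges `x` and infinity
  have hlim : ∀ x, 0 < x →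
      Tendsto (fun r => r ^ (2 * γ) * u r) atTop (𝓝 ((x ^ 2 + r₀ ^ 2) ^ γ * u x)) := by
    intro x hx
    have h1 : Tendsto (fun s : ℝ => (x ^ 2 + r₀ ^ 2) / s) atTop (𝓝 0) :=
      tendsto_const_nhds.div_atTop tendsto_id
    have h2 : Tendsto (fun s : ℝ => u (x + (x ^ 2 + r₀ ^ 2) / s)) atTop (𝓝 (u x)) := by
      have := (hu.continuous.tendsto (x + 0)).comp (h1.const_add x)
      simpa [Function.comp_def] using this
    have h3 : Tendsto (fun s : ℝ => (x / s + 1) ^ (2 * γ)) atTop (𝓝 1) := by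
      have h4 : Tendsto (fun s : ℝ => x / s + 1) atTop (𝓝 1) := by
        simpa using (tendsto_const_nhds.div_atTop tendsto_id : Tendsto (fun s : ℝ => x / s) atTop
          (𝓝 0)).add_const 1
      simpa using h4.rpow_const (p := 2 * γ) (Or.inl one_ne_zero)
    have h5 : Tendsto (fun s : ℝ => (x + s) ^ (2 * γ) * u (x + s)) atTop
        (𝓝 ((x ^ 2 + r₀ ^ 2) ^ γ * u x)) := by
      have h6 := h3.mul (h2.const_mul ((x ^ 2 + r₀ ^ 2) ^ γ))
      rw [one_mul] at h6
      refine h6.congr' ?_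
      filter_upwards [eventually_gt_atTop 0] with s hs
      rw [← hu.exists_inversion hm hα hr₀ hmax hx hs, ← mul_assoc,
        ← Real.mul_rpow (by positivity) hs.le]
      congr 2
      field_simp
    have h7 := h5.comp (tendsto_atTop_add_const_right atTop (-x) tendsto_id)
    simpa [Function.comp_def] using h7
  refine ⟨r₀, (1 ^ 2 + r₀ ^ 2) ^ γ * u 1, hr₀, mul_pos (by positivity) (hu.pos 1 one_pos),
    fun r hr => ?_⟩
  rw [tendsto_nhds_unique (hlim 1 one_pos) (hlim r hr), mul_comm, ← mul_assoc,
    ← Real.rpow_add (by positivity), neg_add_cancel, Real.rpow_zero, one_mul]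

/-- The constant is determined by the equation tested against a solution of the same form. -/
theorem RadialProfile.rpow_eq {m : ℕ} {α : ℝ} {u : ℝ → ℝ}
    (hu : RadialProfile m α u) (hα1 : 1 < α) (hα : α - 2 * (m : ℝ) + 1 > 0) {r₀ κ : ℝ} (hr₀ : 0 < r₀)
    (hκ : 0 < κ)
    (h : ∀ r, 0 < r → u r = κ * (r ^ 2 + r₀ ^ 2) ^ (-((α + 1) / 2 - (m : ℝ)))) :
    κ ^ (critExp m α - 2) = constP m α * r₀ ^ (2 * m) := by
  obtain ⟨h1, -, h3⟩ := hu.identity 0 r₀ le_rfl hr₀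
  have hpγ := mul_critExp_sub_one hα
  set γ := (α + 1) / 2 - (m : ℝ) with hγ
  set W := ∫ b in (0 : ℝ)..Real.pi, Real.sin b ^ (α - 1) with hW
  have hA : ∀ β s, sphAvg α 0 r₀ β 0 s = (s ^ 2 + r₀ ^ 2) ^ (-β) * W := by
    intro β s
    rw [sphAvg, hW, ← intervalIntegral.integral_const_mul]
    simp [sqDist]
  have hW0 : 0 < W := by
    refine intervalIntegral.intervalIntegral_pos_of_pos_on
      ((Real.continuous_sin.rpow_const fun b => Or.inr (by linarith)).intervalIntegrable _ _)
      (fun b hb => Real.rpow_pos_of_pos (Real.sin_pos_of_mem_Ioo hb) _) Real.pi_pos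
  have hJ : 0 < ∫ s in Ioi (0 : ℝ), u s * sphAvg α 0 r₀ ((α + 1) / 2 + m) 0 s * s ^ α := by
    have hpos : ∀ s ∈ Ioi (0 : ℝ), 0 < u s * sphAvg α 0 r₀ ((α + 1) / 2 + m) 0 s * s ^ α := by
      intro s hs
      have hs0 : 0 < s := hs
      have := hu.pos s hs0
      rw [hA]
      positivity
    rw [setIntegral_pos_iff_support_of_nonneg_ae
      (by filter_upwards [ae_restrict_mem measurableSet_Ioi] with s hs using (hpos s hs).le) h1]
    rw [inter_eq_right.2 fun s hs => Function.mem_support.2 (hpos s hs).ne', Real.volume_Ioi]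
    exact ENNReal.zero_lt_top
  have hcongr : ∀ s ∈ Ioi (0 : ℝ), u s ^ (critExp m α - 1) * sphAvg α 0 r₀ γ 0 s * s ^ α =
      κ ^ (critExp m α - 2) * (u s * sphAvg α 0 r₀ ((α + 1) / 2 + m) 0 s * s ^ α) := by
    intro s hs
    have hd : 0 < s ^ 2 + r₀ ^ 2 := by positivity
    have e1 : κ ^ (critExp m α - 1) = κ ^ (critExp m α - 2) * κ := by
      rw [← Real.rpow_add_one hκ.ne']; congr 1; ring
    rw [hA, hA, h s hs, Real.mul_rpow hκ.le (Real.rpow_nonneg hd.le _), ← Real.rpow_mul hd.le, neg_mul,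
      hpγ, e1]
    ring
  rw [setIntegral_congr_fun measurableSet_Ioi hcongr, integral_const_mul] at h3
  exact (mul_right_cancel₀ hJ.ne' h3).symm

end GenRadial

theorem theorem1p2 (m : ℕ) (hm : 1 ≤ m) (α : ℝ) (hα : α - 2 * (m : ℝ) + 1 > 0)
    (v : ℝ → ℝ) (hv : GenRadial.MemD m α v) (hpos : ∀ r : ℝ, 0 < r → 0 < v r)
    (hsol : GenRadial.IsWeakSolution m α v ∨ GenRadial.IsClassicalSolution m α v)
    (hns : GenRadial.Nonsingular (2 * m - 1) v)
    (hodd : ∀ i : ℕ, i ≤ 2 * m - 1 → Odd i → Tendsto (iteratedDeriv i v) (𝓝[>] 0) (𝓝 0)) :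
    ∃ ε : ℝ, 0 < ε ∧ ∀ r : ℝ, 0 < r → v r = GenRadial.bubble m α ε r := by
  have hm1 : (1 : ℝ) ≤ m := by exact_mod_cast hm
  obtain ⟨u, hu, huv⟩ := GenRadial.exists_radialProfile hm hα hv hpos hsol hns
  obtain ⟨r₀, κ, hr₀, hκ, hform⟩ := hu.eq_rpow hm hα
  have hκ' := hu.rpow_eq (by linarith) hα hr₀ hκ hform
  have hP := GenRadial.constP_pos hα
  refine ⟨r₀, hr₀, fun r hr => ?_⟩
  rw [← huv r hr, hform r hr, GenRadial.bubble]
  have hα' : α - 2 * (m : ℝ) + 1 ≠ 0 := hα.ne'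
  have hm' : (m : ℝ) ≠ 0 := by positivity
  have hd : 0 < r₀ ^ 2 + r ^ 2 := by positivity
  have e1 : κ = GenRadial.constP m α ^ ((α - 2 * m + 1) / (4 * m)) *
      r₀ ^ ((α - 2 * (m : ℝ) + 1) / 2) := by
    have e2 : (GenRadial.critExp m α - 2) * ((α - 2 * m + 1) / (4 * m)) = 1 := by
      rw [GenRadial.critExp]; field_simp; ring
    have e3 : κ = κ ^ ((GenRadial.critExp m α - 2) * ((α - 2 * m + 1) / (4 * m))) := by
      rw [e2, Real.rpow_one]
    rw [e3, Real.rpow_mul hκ.le, hκ', Real.mul_rpow hP.le (by positivity),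
      ← Real.rpow_natCast r₀, ← Real.rpow_mul hr₀.le]
    congr 2
    push_cast; field_simp; ring
  rw [Real.div_rpow hr₀.le hd.le, e1, mul_assoc, div_eq_mul_inv (r₀ ^ _), ← Real.rpow_neg hd.le,
    add_comm (r ^ 2)]
  congr 4
  ring
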